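/- For a compact convex set $K\subset\mathbb R^2$ of positive area $|K|$, let $B_K$ be the disc of area $|K|$ centred at the barycentre $\frac1{|K|}\int_K x\,dx$ of $K$, and put $$\delta(K)=\frac{P(K)-P(B_K)}{P(B_K)},\qquad \lambda_0(K)=\frac{|K\,\Delta\, B_K|}{|K|},$$ where $P(K)=\lim_{\varepsilon\to0^+}\big(|\{x: d(x,K)\le\varepsilon\}|-|K|\big)/\varepsilon$ is the (Minkowski) perimeter. Call $\Omega$ optimal if it minimizes $\delta(K)/\lambda_0(K)^2$ among all compact convex sets $K\subset\mathbb R^2$ of positive area with $\lambda_0(K)\neq0$ (that is, which are not discs). Theorem. Let $\Omega$ be an optimal set with area $\pi$ and barycentre at the origin; write $\delta=\delta(\Omega)$, $\lambda_0=\lambda_0(\Omega)$. Let $B$ be the unit disc centred at the origin, $\partial B^{IN}=\partial B\cap\Omega$, $\partial B^{OUT}=\partial B\cap\Omega^c$, with lengths $|\partial B^{IN}|$, $|\partial B^{OUT}|$. Let $\Gamma$ be a strictly convex part of $\partial\Omega$, i.e. a relatively open subset of $\partial\Omega$ that contains no nondegenerate line segment. Then $\Gamma$ is locally a $C^{1,1}$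 curve, it meets $\partial B$ in a set of length zero, it is $C^2$ near each of its points $(x,y)\notin\partial B$, and at each such point its curvature $\mathcal C$ (with respect to the counterclockwise orientation, so that it is nonnegative) is $$\mathcal C=1-3\delta+\frac{4\delta}{2\pi\lambda_0}\big(|\partial B^{OUT}|-|\partial B^{IN}|\big)\pm\frac{4\delta}{\lambda_0}+\hat\mu_1x+\hat\mu_2y,$$ with the sign $+$ if $(x,y)$ lies outside $B$ and $-$ if it lies inside $B$, where $$\hat\mu_1=\frac{4\delta}{\pi\lambda_0}\Big[\int_{\partial B^{OUT}}\cos t\,dt-\int_{\partial B^{IN}}\cos t\,dt\Big],\qquad \hat\mu_2=\frac{4\delta}{\pi\lambda_0}\Big[\int_{\partial B^{OUT}}\sin t\,dt-\int_{\partial B^{IN}}\sin t\,dt\Big],$$ $t$ being the angle of the point $(\cos t,\sin t)\in\partial B$. -/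

import Mathlib

open MeasureTheory Set Filter Topology
open scoped NNReal

noncomputable section

/-- The Euclidean plane, with its Lebesgue measure `volume`. -/
abbrev Plane : Type := EuclideanSpace ℝ (Fin 2)

/-- The area `|K|` of a plane set (a real number for the compact sets considered here). -/
def area (K : Set Plane) : ℝ := volume.real K

/-- The Minkowski perimeter `P(K) = lim_{ε → 0⁺} (|K^ε| - |K|) / ε`, where
`K^ε = {x | d(x, K) ≤ ε}`. For a compact convex set the limit exists. -/
def minkowskiPerimeter (K : Set Plane) : ℝ :=
  limUnder (𝓝[>] (0 : ℝ)) fun ε => (area (Metric.cthickening ε K) - area K) / ε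

/-- The barycentre `|K|⁻¹ ∫_K x dx`. -/
def barycentre (K : Set Plane) : Plane :=
  (area K)⁻¹ • ∫ x in K, x

/-- The disc of the same area as `K` that is centred at the barycentre of `K`. -/
def barycentricDisc (K : Set Plane) : Set Plane :=
  Metric.closedBall (barycentre K) (Real.sqrt (area K / Real.pi))

/-- The isoperimetric deficit `δ(K) = (P(K) - P(B)) / P(B)`, `B` a disc with `|B| = |K|`. -/
def isoDeficit (K : Set Plane) : ℝ :=
  (minkowskiPerimeter K - minkowskiPerimeter (barycentricDisc K)) /
    minkowskiPerimeter (barycentricDisc K)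

/-- The barycentric asymmetry `λ₀(K) = |K ∆ B| / |K|`, `B` the barycentric disc of `K`. -/
def baryAsymmetry (K : Set Plane) : ℝ :=
  area (symmDiff K (barycentricDisc K)) / area K

/-- The sets on which `δ / λ₀²` is defined: compact convex sets of positive area for which
`λ₀ ≠ 0` (that is, which are not discs). -/
structure IsAdmissible (K : Set Plane) : Prop where
  isCompact : IsCompact K
  convex : Convex ℝ K
  area_pos : 0 < area K
  asymmetry_ne_zero : baryAsymmetry K ≠ 0

/-- `Ω` minimizes `δ / λ₀²` among compact convex plane sets. -/
structure IsOptimal (Ω : Set Plane) : Prop where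
  admissible : IsAdmissible Ω
  le : ∀ K : Set Plane, IsAdmissible K →
    isoDeficit Ω / baryAsymmetry Ω ^ 2 ≤ isoDeficit K / baryAsymmetry K ^ 2

/-- The point `(cos t, sin t)` of the unit circle. -/
def circlePoint (t : ℝ) : Plane := !₂[Real.cos t, Real.sin t]

/-- `∂B^OUT = ∂B ∩ Ωᶜ`, `B` the unit disc centred at the origin, described by the angle
`t ∈ (0, 2π]`, for which the arc length of the circle is Lebesgue measure. -/
def circleOut (Ω : Set Plane) : Set ℝ := {t ∈ Ioc 0 (2 * Real.pi) | circlePoint t ∉ Ω}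

/-- `∂B^IN = ∂B ∩ Ω`, described by the angle `t ∈ (0, 2π]`. -/
def circleIn (Ω : Set Plane) : Set ℝ := {t ∈ Ioc 0 (2 * Real.pi) | circlePoint t ∈ Ω}

/-- The constant `μ̂₁`. -/
def muHat₁ (Ω : Set Plane) : ℝ :=
  4 * isoDeficit Ω / (Real.pi * baryAsymmetry Ω) *
    ((∫ t in circleOut Ω, Real.cos t) - ∫ t in circleIn Ω, Real.cos t)

/-- The constant `μ̂₂`. -/
def muHat₂ (Ω : Set Plane) : ℝ :=
  4 * isoDeficit Ω / (Real.pi * baryAsymmetry Ω) *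
    ((∫ t in circleOut Ω, Real.sin t) - ∫ t in circleIn Ω, Real.sin t)

/-- A strictly convex part of the boundary: a relatively open subset of `∂Ω` that contains no
nondegenerate line segment. -/
structure IsStrictlyConvexPart (Ω Γ : Set Plane) : Prop where
  isOpen : ∃ U : Set Plane, IsOpen U ∧ Γ = frontier Ω ∩ U
  no_segment : ∀ x y : Plane, x ≠ y → ¬ segment ℝ x y ⊆ Γ

/-- The cross product (determinant) of two plane vectors. -/
def planeCross (v w : Plane) : ℝ := v 0 * w 1 - v 1 * w 0

/-- The signed curvature `(x' y'' - y' x'') / |γ'|³` of a regular plane curve `γ = (x, y)`. -/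
def signedCurvature (γ : ℝ → Plane) (t : ℝ) : ℝ :=
  planeCross (deriv γ t) (deriv (deriv γ) t) / ‖deriv γ t‖ ^ 3

/-- `γ` on the open interval `(a, b)` is a regular, injective `C^{1,1}` parametrization of a
relatively open piece of the boundary of the convex set `Ω`, run counterclockwise
(`Ω` lies on the left of each tangent line). -/
structure IsBoundaryParam (Ω : Set Plane) (γ : ℝ → Plane) (a b : ℝ) : Prop where
  image : ∃ U : Set Plane, IsOpen U ∧ γ '' Ioo a b = frontier Ω ∩ U
  injOn : InjOn γ (Ioo a b)
  differentiableAt : ∀ t ∈ Ioo a b, DifferentiableAt ℝ γ t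
  deriv_ne_zero : ∀ t ∈ Ioo a b, deriv γ t ≠ 0
  deriv_lipschitz : ∃ C : ℝ≥0, LipschitzOnWith C (deriv γ) (Ioo a b)
  left : ∀ t ∈ Ioo a b, ∀ x ∈ Ω, 0 ≤ planeCross (deriv γ t) (x - γ t)

end

/-! Write δ, λ₀ for the values at the optimal set Ω. Since λ² ≥ 2λλ₀ - λ₀², minimality of
δ(K)/λ₀(K)² implies that Ω also minimizes λ₀ δ(K) - 2δ λ₀(K) over all convex bodies K, discs
included (`IsOptimal.linearized`). Multiplied by |K|, this is a combination of P(K)√|K|, |K| and the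
overlap |K ∩ B_K|, in which the overlap has coefficient 4δ (`linearized_area`). That coefficient is
positive: Brunn–Minkowski is proved by matching quantiles of vertical section lengths, and its
equality case shows that δ = 0 would force Ω to be a disc (`isoDeficit_pos`).

Near a boundary point, in suitable coordinates, ∂Ω is the graph of a convex function u with a
nondecreasing slope selection f, strictly increasing when the arc contains no segment. The
competitors replace u by u + tv with v' = ζ(f), ζ Lipschitz: the slope f + tζ(f) stays nondecreasing
for small t of either sign, so convexity obstructs neither direction (`isVariation_of_lipschitz`).
Perimeter changes as the integral of √(1+f²) does (`minkowskiPerimeter_sub`). The overlap changes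
because the boundary moves and because the barycentric disc moves; the second effect has only
one-sided derivatives a priori (`tendsto_area_inter_closedBall`).

The points of ∂Ω on the unit circle form a null set. Outside the support of the variation, a disc
moving outward through such a point gains no overlap while one moving inward loses some. Hence
adding the one-sided derivatives for t and -t gives minus the integral of the normal speed of the
disc over these points, and minimality makes the sum nonnegative (`ae_notMem_frontier_diff_strip`).
Two variations with disjoint supports cover the whole circle (`ae_notMem_frontier`).

Once this is known, all derivatives are linear in v and the weak equation ∫ (f/√(1+f²)) v' + ∫ vκ =
0 holds with an explicit bounded κ (`first_variation_eq_zero`). After integration by parts it says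
that f/√(1+f²) minus a primitive of κ is orthogonal to every ζ(f) of mean zero; as f is injective,
these test functions suffice to make it constant almost everywhere. So the sine of the slope angle
is Lipschitz, u is C^{1,1}, and where κ is continuous, that is off the circle, u is C² with
curvature κ (`exists_slope`). -/

noncomputable section

/-! ### Orthonormal frames, and Fubini for sets that are epigraphs in a strip -/

section

/-- Positively oriented orthonormal coordinates of the plane. -/
structure IsFrame (Φ : (ℝ × ℝ) ≃L[ℝ] Plane) : Prop where
  norm_sq : ∀ z, ‖Φ z‖ ^ 2 = z.1 ^ 2 + z.2 ^ 2
  cross : ∀ z w, planeCross (Φ z) (Φ w) = z.1 * w.2 - z.2 * w.1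

theorem plane_norm_sq (x : Plane) : ‖x‖ ^ 2 = x 0 ^ 2 + x 1 ^ 2 := by
  rw [EuclideanSpace.norm_sq_eq]; simp [Fin.sum_univ_two]

/-- The frame whose second axis is the unit vector `e`. -/
def frameOf (e : Plane) (he : ‖e‖ = 1) : (ℝ × ℝ) ≃L[ℝ] Plane :=
  LinearEquiv.toContinuousLinearEquiv (𝕜 := ℝ) (E := ℝ × ℝ) (F := Plane)
    { toFun := fun z => !₂[z.1 * e 1 + z.2 * e 0, -z.1 * e 0 + z.2 * e 1]
      invFun := fun w => (w 0 * e 1 - w 1 * e 0, w 0 * e 0 + w 1 * e 1)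
      map_add' := by
        intro z w; ext i; fin_cases i <;> simp <;> ring
      map_smul' := by
        intro a z; ext i; fin_cases i <;> simp <;> ring
      left_inv := by
        intro z
        have h := plane_norm_sq e
        rw [he] at h
        ext <;> simp
        · linear_combination (-z.1) * h
        · linear_combination (-z.2) * h
      right_inv := by
        intro w
        have h := plane_norm_sq e
        rw [he] at h
        ext i; fin_cases i <;> simp
        · linear_combination (-w 0) * h
        · linear_combination (-w 1) * h }

theorem frameOf_apply (e : Plane) (he : ‖e‖ = 1) (z : ℝ × ℝ) :
    frameOf e he z = !₂[z.1 * e 1 + z.2 * e 0, -z.1 * e 0 + z.2 * e 1] := rfl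

theorem isFrame_frameOf (e : Plane) (he : ‖e‖ = 1) : IsFrame (frameOf e he) := by
  have h := plane_norm_sq e
  rw [he] at h
  constructor
  · intro z
    rw [plane_norm_sq, frameOf_apply]
    simp
    linear_combination (-z.1 ^ 2 - z.2 ^ 2) * h
  · intro z w
    rw [planeCross, frameOf_apply, frameOf_apply]
    simp
    linear_combination (-z.1 * w.2 + z.2 * w.1) * h

variable {Φ : (ℝ × ℝ) ≃L[ℝ] Plane}

/-- The norm of `ℝ × ℝ` is the sup norm, for which a frame is no isometry; it is one for the
Euclidean product `WithLp 2 (ℝ × ℝ)`, which carries the same volume. -/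
theorem IsFrame.measurePreserving (hΦ : IsFrame Φ) : MeasurePreserving Φ := by
  let e : WithLp 2 (ℝ × ℝ) ≃ₗᵢ[ℝ] Plane :=
    { toLinearEquiv := (WithLp.linearEquiv 2 ℝ (ℝ × ℝ)).trans Φ.toLinearEquiv
      norm_map' := by
        intro x
        have h1 := hΦ.norm_sq (WithLp.ofLp x)
        have h2 := WithLp.prod_norm_sq_eq_of_L2 x
        simp only [Real.norm_eq_abs, sq_abs] at h2
        have h3 : ‖Φ (WithLp.ofLp x)‖ ^ 2 = ‖x‖ ^ 2 := by rw [h1, h2]; rfl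
        exact (pow_left_inj₀ (norm_nonneg _) (norm_nonneg _) two_ne_zero).1 h3 }
  exact e.measurePreserving.comp (WithLp.volume_preserving_toLp (U := ℝ) (V := ℝ))

theorem IsFrame.measurableEmbedding (Φ : (ℝ × ℝ) ≃L[ℝ] Plane) : MeasurableEmbedding Φ :=
  Φ.toHomeomorph.measurableEmbedding

theorem IsFrame.area_eq (hΦ : IsFrame Φ) (L : Set Plane) :
    area L = volume.real (Φ ⁻¹' L) := by
  rw [area, Measure.real, Measure.real,
    hΦ.measurePreserving.measure_preimage_emb (IsFrame.measurableEmbedding Φ)]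

theorem IsFrame.setIntegral_eq (hΦ : IsFrame Φ) {E : Type*} [NormedAddCommGroup E]
    [NormedSpace ℝ E] (L : Set Plane) (h : Plane → E) :
    ∫ x in L, h x = ∫ z in Φ ⁻¹' L, h (Φ z) :=
  (hΦ.measurePreserving.setIntegral_preimage_emb (IsFrame.measurableEmbedding Φ) h L).symm

theorem IsFrame.integrableOn_iff (hΦ : IsFrame Φ) {E : Type*} [NormedAddCommGroup E]
    (L : Set Plane) (h : Plane → E) :
    IntegrableOn (fun z => h (Φ z)) (Φ ⁻¹' L) ↔ IntegrableOn h L :=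
  hΦ.measurePreserving.integrableOn_comp_preimage (IsFrame.measurableEmbedding Φ)

theorem IsFrame.dist_sq (hΦ : IsFrame Φ) (z w : ℝ × ℝ) :
    dist (Φ z) (Φ w) ^ 2 = (z.1 - w.1) ^ 2 + (z.2 - w.2) ^ 2 := by
  rw [dist_eq_norm, ← map_sub, hΦ.norm_sq]; rfl

theorem IsFrame.abs_fst_le (hΦ : IsFrame Φ) (z : ℝ × ℝ) : |z.1| ≤ ‖Φ z‖ := by
  apply abs_le_of_sq_le_sq _ (norm_nonneg _)
  rw [hΦ.norm_sq]; nlinarith [sq_nonneg z.2]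

/-- A set which, below the level `y₀` and over the interval `(c, d)`, is the epigraph of `f`. -/
def IsEpiOn (Φ : (ℝ × ℝ) ≃L[ℝ] Plane) (L : Set Plane) (c d y₀ : ℝ) (f : ℝ → ℝ) : Prop :=
  ∀ x ∈ Ioo c d, f x ≤ y₀ ∧ ∀ y < y₀, (Φ (x, y) ∈ L ↔ f x ≤ y)

/-- The strip over `(c, d)` below level `y₀`. -/
def strip (Φ : (ℝ × ℝ) ≃L[ℝ] Plane) (c d y₀ : ℝ) : Set Plane :=
  Φ.symm ⁻¹' (Ioo c d ×ˢ Iio y₀)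

theorem isOpen_strip (Φ : (ℝ × ℝ) ≃L[ℝ] Plane) (c d y₀ : ℝ) : IsOpen (strip Φ c d y₀) :=
  (isOpen_Ioo.prod isOpen_Iio).preimage Φ.symm.continuous

@[simp] theorem mem_strip {Φ : (ℝ × ℝ) ≃L[ℝ] Plane} {c d y₀ : ℝ} {z : ℝ × ℝ} :
    Φ z ∈ strip Φ c d y₀ ↔ z.1 ∈ Ioo c d ∧ z.2 < y₀ := by
  simp [strip]

variable {E : Type*} [NormedAddCommGroup E] [NormedSpace ℝ E]

/-- Fubini, the vertical sections in the strip being [f x, y₀). The almost everywhere vertical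
integrability is recorded because it lets the integrals from f' and from f up to y₀ be merged into
one from f' to f. -/
theorem setIntegral_inter_strip (hΦ : IsFrame Φ) {L : Set Plane} (hL : MeasurableSet L)
    {c d y₀ : ℝ} {f : ℝ → ℝ} (hf : IsEpiOn Φ L c d y₀ f) {h : Plane → E}
    (hh : IntegrableOn h (L ∩ strip Φ c d y₀)) :
    (∫ x in L ∩ strip Φ c d y₀, h x = ∫ x in Ioo c d, ∫ y in f x..y₀, h (Φ (x, y))) ∧
    IntegrableOn (fun x => ∫ y in f x..y₀, h (Φ (x, y))) (Ioo c d) ∧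
    ∀ᵐ x, x ∈ Ioo c d → IntervalIntegrable (fun y => h (Φ (x, y))) volume (f x) y₀ := by
  set A : Set (ℝ × ℝ) := Φ ⁻¹' (L ∩ strip Φ c d y₀) with hA
  have hAm : MeasurableSet A := (hL.inter (isOpen_strip Φ c d y₀).measurableSet).preimage
    Φ.continuous.measurable
  have hi : Integrable (A.indicator fun z => h (Φ z)) := by
    rw [integrable_indicator_iff hAm]
    exact (hΦ.integrableOn_iff _ _).2 hh
  have hi' : Integrable (A.indicator fun z => h (Φ z)) (volume.prod volume) := hi
  have key : ∀ x ∈ Ioo c d, (fun y => A.indicator (fun z => h (Φ z)) (x, y)) =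
      (Ico (f x) y₀).indicator fun y => h (Φ (x, y)) := by
    intro x hx
    ext y
    have : (x, y) ∈ A ↔ y ∈ Ico (f x) y₀ := by
      simp only [hA, mem_preimage, mem_inter_iff, mem_strip, mem_Ico]
      constructor
      · rintro ⟨h1, -, h2⟩
        exact ⟨((hf x hx).2 y h2).1 h1, h2⟩
      · rintro ⟨h1, h2⟩
        exact ⟨((hf x hx).2 y h2).2 h1, hx, h2⟩
    by_cases hy : (x, y) ∈ A
    · rw [indicator_of_mem hy, indicator_of_mem (this.1 hy)]
    · rw [indicator_of_notMem hy, indicator_of_notMem (mt this.2 hy)]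
  have key2 : ∀ x, (∫ y, A.indicator (fun z => h (Φ z)) (x, y)) =
      (Ioo c d).indicator (fun x => ∫ y in f x..y₀, h (Φ (x, y))) x := by
    intro x
    by_cases hx : x ∈ Ioo c d
    · rw [indicator_of_mem hx, key x hx, integral_indicator measurableSet_Ico,
        integral_Ico_eq_integral_Ioo, ← integral_Ioc_eq_integral_Ioo,
        intervalIntegral.integral_of_le (hf x hx).1]
    · rw [indicator_of_notMem hx]
      have : ∀ y, A.indicator (fun z => h (Φ z)) (x, y) = 0 := by
        intro y
        apply indicator_of_notMem
        intro hy
        exact hx (mem_strip.1 hy.2).1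
      simp [this]
  refine ⟨?_, ?_, ?_⟩
  · rw [hΦ.setIntegral_eq, ← integral_indicator hAm, Measure.volume_eq_prod, integral_prod _ hi']
    simp_rw [key2]
    rw [integral_indicator measurableSet_Ioo]
  · have := hi'.integral_prod_left
    simp_rw [key2] at this
    rwa [integrable_indicator_iff measurableSet_Ioo] at this
  · filter_upwards [hi'.prod_right_ae] with x hx hxm
    rw [key x hxm, integrable_indicator_iff measurableSet_Ico] at hx
    rwa [intervalIntegrable_iff_integrableOn_Ico_of_le (hf x hxm).1]

/-- The difference of integrals over two sets that differ only in a strip in which both are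
epigraphs. -/
theorem setIntegral_sub_of_isEpiOn (hΦ : IsFrame Φ) {L L' : Set Plane} (hL : MeasurableSet L)
    (hL' : MeasurableSet L') {c d y₀ : ℝ} {f f' : ℝ → ℝ} (hf : IsEpiOn Φ L c d y₀ f)
    (hf' : IsEpiOn Φ L' c d y₀ f') (hout : L \ strip Φ c d y₀ = L' \ strip Φ c d y₀)
    {h : Plane → E} (hh : IntegrableOn h L) (hh' : IntegrableOn h L') :
    (∫ x in L', h x) - ∫ x in L, h x = ∫ x in Ioo c d, ∫ y in f' x..f x, h (Φ (x, y)) := by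
  have hS := (isOpen_strip Φ c d y₀).measurableSet
  obtain ⟨h1, h2, h3⟩ := setIntegral_inter_strip hΦ hL hf (hh.mono_set inter_subset_left)
  obtain ⟨h1', h2', h3'⟩ := setIntegral_inter_strip hΦ hL' hf' (hh'.mono_set inter_subset_left)
  rw [← integral_inter_add_sdiff hS hh, ← integral_inter_add_sdiff hS hh', ← hout,
    add_sub_add_right_eq_sub, h1, h1', ← integral_sub h2' h2]
  apply setIntegral_congr_ae measurableSet_Ioo
  filter_upwards [h3, h3'] with x hx hx' hxm
  rw [sub_eq_iff_eq_add, intervalIntegral.integral_add_adjacent_intervals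
    ((hx' hxm).trans (hx hxm).symm) (hx hxm)]

end

/-! ### Vertical sections of a convex body and their quantile functions -/

section

variable {Φ : (ℝ × ℝ) ≃L[ℝ] Plane}

/-- The section of `L` over the abscissa `x`. -/
def sec (Φ : (ℝ × ℝ) ≃L[ℝ] Plane) (L : Set Plane) (x : ℝ) : Set ℝ := {y | Φ (x, y) ∈ L}

/-- The length of the section of `L` over the abscissa `x`. -/
def secLen (Φ : (ℝ × ℝ) ≃L[ℝ] Plane) (L : Set Plane) (x : ℝ) : ℝ := volume.real (sec Φ L x)

theorem mem_sec {L : Set Plane} {x y : ℝ} : y ∈ sec Φ L x ↔ Φ (x, y) ∈ L := Iff.rfl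

theorem isCompact_sec {L : Set Plane} (hL : IsCompact L) (x : ℝ) : IsCompact (sec Φ L x) := by
  have h1 : IsCompact (Φ ⁻¹' L) := Φ.toHomeomorph.isCompact_preimage.2 hL
  have h2 : IsCompact (Prod.snd '' (Φ ⁻¹' L)) := h1.image continuous_snd
  refine h2.of_isClosed_subset ?_ ?_
  · exact hL.isClosed.preimage (Φ.continuous.comp (by fun_prop))
  · intro y hy
    exact ⟨(x, y), hy, rfl⟩

theorem frame_combo (Φ : (ℝ × ℝ) ≃L[ℝ] Plane) (s t x y x' y' : ℝ) :
    Φ (s * x + t * x', s * y + t * y') = s • Φ (x, y) + t • Φ (x', y') := by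
  rw [← map_smul, ← map_smul, ← map_add]; rfl

theorem convex_sec {L : Set Plane} (hL : Convex ℝ L) (x : ℝ) : Convex ℝ (sec Φ L x) := by
  intro y hy y' hy' s t hs ht hst
  have := hL hy hy' hs ht hst
  rwa [← frame_combo, ← add_mul, hst, one_mul] at this

theorem exists_sec_eq_Icc {L : Set Plane} (hL : IsCompact L) (hc : Convex ℝ L) {x : ℝ}
    (hx : (sec Φ L x).Nonempty) : ∃ p q, p ≤ q ∧ sec Φ L x = Icc p q := by
  have h := eq_Icc_of_connected_compact
    ⟨hx, (convex_sec (Φ := Φ) hc x).isPreconnected⟩ (isCompact_sec (Φ := Φ) hL x)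
  refine ⟨_, _, ?_, h⟩
  rw [h] at hx
  exact nonempty_Icc.1 hx

theorem secLen_nonneg (L : Set Plane) (x : ℝ) : 0 ≤ secLen Φ L x := measureReal_nonneg

/-- Sections of convex sets are intervals, and combining their endpoints with weights s and t gives
an interval inside the section of `L` whose length is the same combination. With L₀ = L₁ = L this is
concavity of the section length. -/
theorem secLen_combo_le {L₀ L₁ L : Set Plane} (h₀ : IsCompact L₀) (c₀ : Convex ℝ L₀)
    (h₁ : IsCompact L₁) (c₁ : Convex ℝ L₁) (h : IsCompact L) (c : Convex ℝ L) {s t : ℝ}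
    (hs : 0 ≤ s) (ht : 0 ≤ t) (hst : ∀ z ∈ L₀, ∀ w ∈ L₁, s • z + t • w ∈ L) {x₀ x₁ : ℝ}
    (hx₀ : (sec Φ L₀ x₀).Nonempty) (hx₁ : (sec Φ L₁ x₁).Nonempty) :
    s * secLen Φ L₀ x₀ + t * secLen Φ L₁ x₁ ≤ secLen Φ L (s * x₀ + t * x₁) := by
  obtain ⟨p, q, hpq, h1⟩ := exists_sec_eq_Icc h₀ c₀ hx₀
  obtain ⟨p', q', hpq', h2⟩ := exists_sec_eq_Icc h₁ c₁ hx₁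
  have hmem : ∀ y ∈ sec Φ L₀ x₀, ∀ y' ∈ sec Φ L₁ x₁,
      s * y + t * y' ∈ sec Φ L (s * x₀ + t * x₁) := by
    intro y hy y' hy'
    rw [mem_sec, frame_combo]
    exact hst _ hy _ hy'
  have hsub : Icc (s * p + t * p') (s * q + t * q') ⊆ sec Φ L (s * x₀ + t * x₁) := by
    apply (convex_sec c _).ordConnected.out
    · exact hmem _ (h1 ▸ left_mem_Icc.2 hpq) _ (h2 ▸ left_mem_Icc.2 hpq')
    · exact hmem _ (h1 ▸ right_mem_Icc.2 hpq) _ (h2 ▸ right_mem_Icc.2 hpq')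
  have h3 := measureReal_mono (μ := volume) hsub (isCompact_sec h _).measure_lt_top.ne
  rw [secLen, secLen, secLen, h1, h2, Real.volume_real_Icc_of_le hpq,
    Real.volume_real_Icc_of_le hpq']
  have h4 := mul_le_mul_of_nonneg_left hpq hs
  have h5 := mul_le_mul_of_nonneg_left hpq' ht
  rw [Real.volume_real_Icc_of_le (by linarith)] at h3
  linarith

/-- Fubini for plane sets, by vertical sections. -/
theorem IsFrame.volume_eq_lintegral (hΦ : IsFrame Φ) {L : Set Plane} (hL : MeasurableSet L) :
    volume L = ∫⁻ x, volume (sec Φ L x) := by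
  rw [← hΦ.measurePreserving.measure_preimage_emb (IsFrame.measurableEmbedding Φ),
    Measure.volume_eq_prod, Measure.prod_apply (hL.preimage Φ.continuous.measurable)]
  rfl

theorem volume_sec_eq {L : Set Plane} (hL : IsCompact L) (x : ℝ) :
    volume (sec Φ L x) = ENNReal.ofReal (secLen Φ L x) :=
  (ofReal_measureReal (isCompact_sec hL x).measure_lt_top.ne).symm

theorem IsFrame.setIntegral_fst (hΦ : IsFrame Φ) {L : Set Plane} (hL : IsCompact L)
    {φ : ℝ → ℝ} (hφ : Continuous φ) {D : Set ℝ} (hD : MeasurableSet D)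
    (hLD : ∀ x ∉ D, volume (sec Φ L x) = 0) :
    ∫ z in L, φ (Φ.symm z).1 = ∫ x in D, φ x * secLen Φ L x := by
  have hm : MeasurableSet (Φ ⁻¹' L) := hL.measurableSet.preimage Φ.continuous.measurable
  have hi : Integrable ((Φ ⁻¹' L).indicator fun z => φ z.1) (volume.prod volume) := by
    rw [integrable_indicator_iff hm]
    have : IsCompact (Φ ⁻¹' L) := Φ.toHomeomorph.isCompact_preimage.2 hL
    exact (hφ.comp continuous_fst).continuousOn.integrableOn_compact this
  rw [hΦ.setIntegral_eq]
  simp only [ContinuousLinearEquiv.symm_apply_apply]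
  rw [← integral_indicator hm, Measure.volume_eq_prod, integral_prod _ hi,
    ← integral_indicator hD]
  congr 1
  ext x
  have h1 : (fun y => (Φ ⁻¹' L).indicator (fun z : ℝ × ℝ => φ z.1) (x, y)) =
      (sec Φ L x).indicator fun _ => φ x := by
    ext y
    by_cases hy : y ∈ sec Φ L x
    · rw [indicator_of_mem hy, indicator_of_mem (show (x, y) ∈ Φ ⁻¹' L from hy)]
    · rw [indicator_of_notMem hy, indicator_of_notMem (show (x, y) ∉ Φ ⁻¹' L from hy)]
  rw [h1, integral_indicator (isCompact_sec hL x).measurableSet, setIntegral_const,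
    smul_eq_mul, mul_comm]
  by_cases hx : x ∈ D
  · rw [indicator_of_mem hx]; rfl
  · rw [indicator_of_notMem hx, Measure.real, hLD x hx]; simp

/-- The profile of a convex body: its projection is an interval, over the interior of which the
section length is continuous and positive. -/
theorem IsFrame.exists_profile (hΦ : IsFrame Φ) {L : Set Plane} (hL : IsCompact L)
    (hc : Convex ℝ L) (ha : 0 < area L) : ∃ a b, a < b ∧
      (∀ x, (sec Φ L x).Nonempty ↔ x ∈ Icc a b) ∧ ContinuousOn (secLen Φ L) (Ioo a b) ∧
      (∀ x ∈ Ioo a b, 0 < secLen Φ L x) ∧ ∫ x in Ioo a b, secLen Φ L x = area L := by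
  set D : Set ℝ := Prod.fst '' (Φ ⁻¹' L) with hD
  have hcomp : IsCompact (Φ ⁻¹' L) := Φ.toHomeomorph.isCompact_preimage.2 hL
  have hconv : Convex ℝ (Φ ⁻¹' L) := hc.linear_preimage (Φ : (ℝ × ℝ) →ₗ[ℝ] Plane)
  have hne : L.Nonempty := by
    rw [nonempty_iff_ne_empty]
    rintro rfl
    simp [area] at ha
  have hDne : D.Nonempty := by
    obtain ⟨z, hz⟩ := hne
    exact ⟨_, Φ.symm z, by simpa using hz, rfl⟩
  have hDcomp : IsCompact D := hcomp.image continuous_fst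
  have hDconv : Convex ℝ D := hconv.linear_image (LinearMap.fst ℝ ℝ ℝ)
  have hDeq := eq_Icc_of_connected_compact ⟨hDne, hDconv.isPreconnected⟩ hDcomp
  set a := sInf D
  set b := sSup D
  have hsec : ∀ x, (sec Φ L x).Nonempty ↔ x ∈ Icc a b := by
    intro x
    rw [← hDeq]
    constructor
    · rintro ⟨y, hy⟩; exact ⟨(x, y), hy, rfl⟩
    · rintro ⟨⟨x', y⟩, hy, rfl⟩; exact ⟨y, hy⟩
  have harea : ∫ x in Ioo a b, secLen Φ L x = area L := by
    have := hΦ.setIntegral_fst hL (φ := fun _ => 1) continuous_const (D := Icc a b)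
      measurableSet_Icc (by
        intro x hx
        rw [not_nonempty_iff_eq_empty.1 (mt (hsec x).1 hx)]; simp)
    simp only [one_mul, setIntegral_const, smul_eq_mul, mul_one] at this
    rw [← integral_Icc_eq_integral_Ioo, ← this]; rfl
  have hab : a < b := by
    by_contra h
    rw [Ioo_eq_empty h] at harea
    simp at harea
    exact ha.ne harea
  have hconc : ∀ x ∈ Icc a b, ∀ x' ∈ Icc a b, ∀ s t : ℝ, 0 ≤ s → 0 ≤ t → s + t = 1 →
      s * secLen Φ L x + t * secLen Φ L x' ≤ secLen Φ L (s * x + t * x') := by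
    intro x hx x' hx' s t hs ht hst
    exact secLen_combo_le hL hc hL hc hL hc hs ht
      (fun z hz w hw => hc hz hw hs ht hst) ((hsec x).2 hx) ((hsec x').2 hx')
  have hconcave : ConcaveOn ℝ (Icc a b) (secLen Φ L) :=
    ⟨convex_Icc a b, fun x hx x' hx' s t hs ht hst => hconc x hx x' hx' s t hs ht hst⟩
  refine ⟨a, b, hab, hsec, ?_, ?_, harea⟩
  · have h1 : ConcaveOn ℝ (Ioo a b) (secLen Φ L) :=
      hconcave.subset Ioo_subset_Icc_self (convex_Ioo a b)
    exact h1.continuousOn isOpen_Ioo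
  -- Positive area gives one abscissa with a section of positive length; concavity along the chords
  -- to both ends of the projection spreads positivity to the whole open interval.
  · obtain ⟨x₀, hx₀, hpos⟩ : ∃ x ∈ Ioo a b, 0 < secLen Φ L x := by
      by_contra! h
      have : ∫ x in Ioo a b, secLen Φ L x ≤ 0 :=
        setIntegral_nonpos measurableSet_Ioo h
      linarith
    intro x hx
    rcases le_total x x₀ with hxx | hxx
    · have h0 : 0 < x₀ - a := by linarith [hx₀.1]
      have := hconc x₀ (Ioo_subset_Icc_self hx₀) a (left_mem_Icc.2 hab.le) ((x - a) / (x₀ - a))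
        ((x₀ - x) / (x₀ - a)) (div_nonneg (by linarith [hx.1]) h0.le)
        (div_nonneg (by linarith) h0.le) (by field_simp; ring)
      have e : (x - a) / (x₀ - a) * x₀ + (x₀ - x) / (x₀ - a) * a = x := by field_simp; ring
      rw [e] at this
      have h1 : 0 < (x - a) / (x₀ - a) := div_pos (by linarith [hx.1]) h0
      have h2 : 0 ≤ (x₀ - x) / (x₀ - a) := div_nonneg (by linarith) h0.le
      nlinarith [mul_pos h1 hpos, mul_nonneg h2 (secLen_nonneg (Φ := Φ) L a)]
    · have h0 : 0 < b - x₀ := by linarith [hx₀.2]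
      have := hconc x₀ (Ioo_subset_Icc_self hx₀) b (right_mem_Icc.2 hab.le) ((b - x) / (b - x₀))
        ((x - x₀) / (b - x₀)) (div_nonneg (by linarith [hx.2]) h0.le)
        (div_nonneg (by linarith) h0.le) (by field_simp; ring)
      have e : (b - x) / (b - x₀) * x₀ + (x - x₀) / (b - x₀) * b = x := by field_simp; ring
      rw [e] at this
      have h1 : 0 < (b - x) / (b - x₀) := div_pos (by linarith [hx.2]) h0
      have h2 : 0 ≤ (x - x₀) / (b - x₀) := div_nonneg (by linarith) h0.le
      nlinarith [mul_pos h1 hpos, mul_nonneg h2 (secLen_nonneg (Φ := Φ) L b)]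

/-- The quantile function of a positive continuous density. -/
theorem exists_quantile {a b : ℝ} {f : ℝ → ℝ} (hf : ContinuousOn f (Ioo a b))
    (hpos : ∀ x ∈ Ioo a b, 0 < f x) (hab : a < b) {m : ℝ} (hm : 0 < m)
    (hfm : ∫ x in Ioo a b, f x = m) : ∃ X : ℝ → ℝ, MapsTo X (Ioo 0 1) (Ioo a b) ∧
      SurjOn X (Ioo 0 1) (Ioo a b) ∧ StrictMonoOn X (Ioo 0 1) ∧
      ∀ τ ∈ Ioo (0 : ℝ) 1, HasDerivAt X (m / f (X τ)) τ := by
  have hint : IntegrableOn f (Ioo a b) := by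
    by_contra h
    rw [integral_undef h] at hfm
    exact hm.ne hfm
  have hII : IntervalIntegrable f volume a b :=
    (intervalIntegrable_iff_integrableOn_Ioo_of_le hab.le).2 hint
  -- The quantile function is the inverse of the normalized distribution function F; its derivative
  -- is 1/F' = m/f.
  set F : ℝ → ℝ := fun x => (∫ t in a..x, f t) / m with hF
  have hsub : ∀ x ∈ Icc a b, ∀ y ∈ Icc a b, IntervalIntegrable f volume x y := by
    intro x hx y hy
    apply hII.mono_set
    rw [uIcc_of_le hab.le]
    exact uIcc_subset_Icc hx hy
  have hFa : F a = 0 := by simp [hF]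
  have hFb : F b = 1 := by
    simp only [hF]
    rw [intervalIntegral.integral_of_le hab.le, integral_Ioc_eq_integral_Ioo, hfm,
      div_self hm.ne']
  have hFder : ∀ x ∈ Ioo a b, HasStrictDerivAt F (f x / m) x := by
    intro x hx
    apply HasStrictDerivAt.div_const
    apply intervalIntegral.integral_hasStrictDerivAt_right
      (hsub a (left_mem_Icc.2 hab.le) x (Ioo_subset_Icc_self hx))
    · exact hf.stronglyMeasurableAtFilter isOpen_Ioo x hx
    · exact hf.continuousAt (isOpen_Ioo.mem_nhds hx)
  have hFcont : ContinuousOn F (Icc a b) := by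
    have h := (intervalIntegral.continuousOn_primitive_interval' hII left_mem_uIcc).div_const m
    rwa [uIcc_of_le hab.le] at h
  have hFmono : StrictMonoOn F (Icc a b) := by
    apply strictMonoOn_of_deriv_pos (convex_Icc a b) hFcont
    intro x hx
    rw [interior_Icc] at hx
    rw [(hFder x hx).hasDerivAt.deriv]
    exact div_pos (hpos x hx) hm
  have hsurj : SurjOn F (Ioo a b) (Ioo 0 1) := by
    have := hFcont.surjOn_Icc (left_mem_Icc.2 hab.le) (right_mem_Icc.2 hab.le)
    rw [hFa, hFb] at this
    intro τ hτ
    obtain ⟨x, hx, rfl⟩ := this (Ioo_subset_Icc_self hτ)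
    refine ⟨x, ⟨lt_of_le_of_ne hx.1 ?_, lt_of_le_of_ne hx.2 ?_⟩, rfl⟩
    · rintro rfl; rw [hFa] at hτ; exact lt_irrefl _ hτ.1
    · rintro rfl; rw [hFb] at hτ; exact lt_irrefl _ hτ.2
  have hmaps : MapsTo F (Ioo a b) (Ioo 0 1) := by
    intro x hx
    refine ⟨?_, ?_⟩
    · rw [← hFa]; exact hFmono (left_mem_Icc.2 hab.le) (Ioo_subset_Icc_self hx) hx.1
    · rw [← hFb]; exact hFmono (Ioo_subset_Icc_self hx) (right_mem_Icc.2 hab.le) hx.2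
  have hinj : InjOn F (Ioo a b) := (hFmono.mono Ioo_subset_Icc_self).injOn
  set X := Function.invFunOn F (Ioo a b) with hX
  have hXmem : ∀ τ ∈ Ioo (0 : ℝ) 1, X τ ∈ Ioo a b := fun τ hτ =>
    Function.invFunOn_mem (hsurj hτ)
  have hFX : ∀ τ ∈ Ioo (0 : ℝ) 1, F (X τ) = τ := fun τ hτ =>
    Function.invFunOn_eq (hsurj hτ)
  have hXF : ∀ x ∈ Ioo a b, X (F x) = x := fun x hx =>
    hinj (hXmem _ (hmaps hx)) hx (hFX _ (hmaps hx))
  refine ⟨X, hXmem, fun x hx => ⟨F x, hmaps hx, hXF x hx⟩, ?_, ?_⟩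
  · intro τ hτ τ' hτ' h
    by_contra! hle
    have := hFmono.monotoneOn (Ioo_subset_Icc_self (hXmem _ hτ'))
      (Ioo_subset_Icc_self (hXmem _ hτ)) hle
    rw [hFX _ hτ, hFX _ hτ'] at this
    linarith
  · intro τ hτ
    have h1 := (hFder _ (hXmem τ hτ)).to_local_left_inverse
      (div_pos (hpos _ (hXmem τ hτ)) hm).ne' (g := X) (by
        filter_upwards [isOpen_Ioo.mem_nhds (hXmem τ hτ)] with x hx using hXF x hx)
    rw [hFX τ hτ, inv_div] at h1
    exact h1.hasDerivAt

end

/-! ### The Brunn–Minkowski inequality by transport of sections -/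

section

variable {Φ : (ℝ × ℝ) ≃L[ℝ] Plane}

/-- Transport inequality behind the Brunn–Minkowski inequality: the sections of `sK₀ + tK₁` along
the interpolated quantile `sX + tY`. -/
theorem lintegral_transport_le (hΦ : IsFrame Φ) {K₀ K₁ M : Set Plane} (h₀ : IsCompact K₀)
    (c₀ : Convex ℝ K₀) (h₁ : IsCompact K₁) (c₁ : Convex ℝ K₁) (hM : IsCompact M)
    (cM : Convex ℝ M) {s t : ℝ} (hs : 0 < s) (ht : 0 < t)
    (hst : ∀ z ∈ K₀, ∀ w ∈ K₁, s • z + t • w ∈ M) {X Y : ℝ → ℝ} {m₀ m₁ : ℝ}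
    (hX : ∀ τ ∈ Ioo (0 : ℝ) 1, (sec Φ K₀ (X τ)).Nonempty)
    (hY : ∀ τ ∈ Ioo (0 : ℝ) 1, (sec Φ K₁ (Y τ)).Nonempty)
    (hXm : StrictMonoOn X (Ioo 0 1)) (hYm : StrictMonoOn Y (Ioo 0 1))
    (hXd : ∀ τ ∈ Ioo (0 : ℝ) 1, HasDerivAt X (m₀ / secLen Φ K₀ (X τ)) τ)
    (hYd : ∀ τ ∈ Ioo (0 : ℝ) 1, HasDerivAt Y (m₁ / secLen Φ K₁ (Y τ)) τ) :
    ∫⁻ τ in Ioo (0 : ℝ) 1, ENNReal.ofReal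
      ((s * (m₀ / secLen Φ K₀ (X τ)) + t * (m₁ / secLen Φ K₁ (Y τ))) *
        (s * secLen Φ K₀ (X τ) + t * secLen Φ K₁ (Y τ))) ≤ volume M := by
  set Z : ℝ → ℝ := fun τ => s * X τ + t * Y τ with hZ
  have hZm : StrictMonoOn Z (Ioo 0 1) := by
    intro τ hτ τ' hτ' h
    have h1 := mul_lt_mul_of_pos_left (hXm hτ hτ' h) hs
    have h2 := mul_lt_mul_of_pos_left (hYm hτ hτ' h) ht
    simp only [hZ]; linarith
  have hZd : ∀ τ ∈ Ioo (0 : ℝ) 1, HasDerivWithinAt Z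
      (s * (m₀ / secLen Φ K₀ (X τ)) + t * (m₁ / secLen Φ K₁ (Y τ))) (Ioo 0 1) τ := fun τ hτ =>
    (((hXd τ hτ).const_mul s).add ((hYd τ hτ).const_mul t)).hasDerivWithinAt
  -- The integrand is at most Z' times the length of the section of `M` over Z(τ). Since Z is
  -- injective, a change of variables turns this into an integral of section lengths over the image
  -- of Z, which is at most the area.
  calc
    _ ≤ ∫⁻ τ in Ioo (0 : ℝ) 1, ENNReal.ofReal
        (|s * (m₀ / secLen Φ K₀ (X τ)) + t * (m₁ / secLen Φ K₁ (Y τ))|) * volume (sec Φ M (Z τ)) := by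
        apply setLIntegral_mono' measurableSet_Ioo
        intro τ hτ
        rw [volume_sec_eq hM, ← ENNReal.ofReal_mul (abs_nonneg _)]
        apply ENNReal.ofReal_le_ofReal
        have h1 := secLen_combo_le h₀ c₀ h₁ c₁ hM cM hs.le ht.le hst (hX τ hτ) (hY τ hτ)
        have h2 : 0 ≤ s * secLen Φ K₀ (X τ) + t * secLen Φ K₁ (Y τ) :=
          add_nonneg (mul_nonneg hs.le (secLen_nonneg _ _)) (mul_nonneg ht.le (secLen_nonneg _ _))
        exact mul_le_mul (le_abs_self _) h1 h2 (abs_nonneg _)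
    _ = ∫⁻ x in Z '' Ioo 0 1, volume (sec Φ M x) :=
        (lintegral_image_eq_lintegral_abs_deriv_mul measurableSet_Ioo hZd hZm.injOn
          fun x => volume (sec Φ M x)).symm
    _ ≤ ∫⁻ x, volume (sec Φ M x) := setLIntegral_le_lintegral _ _
    _ = volume M := (hΦ.volume_eq_lintegral hM.measurableSet).symm

theorem exists_isFrame : ∃ Φ : (ℝ × ℝ) ≃L[ℝ] Plane, IsFrame Φ := by
  refine ⟨frameOf !₂[0, 1] ?_, isFrame_frameOf _ _⟩
  simp [EuclideanSpace.norm_eq]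

/-- The difference of the two sides is st(√m₁ f - √m₀ g)²/(fg), which also shows when equality
holds. -/
theorem transport_integrand_ge {f g m₀ m₁ s t : ℝ} (hf : 0 < f) (hg : 0 < g) (h₀ : 0 ≤ m₀)
    (h₁ : 0 ≤ m₁) (hs : 0 ≤ s) (ht : 0 ≤ t) :
    (s * √m₀ + t * √m₁) ^ 2 ≤ (s * (m₀ / f) + t * (m₁ / g)) * (s * f + t * g) := by
  have e0 := Real.sq_sqrt h₀
  have e1 := Real.sq_sqrt h₁
  have : (s * (m₀ / f) + t * (m₁ / g)) * (s * f + t * g) - (s * √m₀ + t * √m₁) ^ 2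
      = s * t * ((√m₁ * f - √m₀ * g) ^ 2 / (f * g)) := by
    rw [← e0, ← e1]
    rw [Real.sqrt_sq (Real.sqrt_nonneg _), Real.sqrt_sq (Real.sqrt_nonneg _)]
    field_simp
    ring
  have h2 : 0 ≤ s * t * ((√m₁ * f - √m₀ * g) ^ 2 / (f * g)) := by positivity
  linarith

/-- The Brunn–Minkowski inequality for compact convex plane sets. -/
theorem sqrt_area_combo_le {K₀ K₁ M : Set Plane} (h₀ : IsCompact K₀)
    (c₀ : Convex ℝ K₀) (h₁ : IsCompact K₁) (c₁ : Convex ℝ K₁) (hM : IsCompact M)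
    (cM : Convex ℝ M) (a₀ : 0 < area K₀) (a₁ : 0 < area K₁) {s t : ℝ} (hs : 0 < s) (ht : 0 < t)
    (hst : ∀ z ∈ K₀, ∀ w ∈ K₁, s • z + t • w ∈ M) :
    s * √(area K₀) + t * √(area K₁) ≤ √(area M) := by
  obtain ⟨Φ, hΦ⟩ := exists_isFrame
  obtain ⟨a, b, hab, hsec, hcont, hpos, hint⟩ := hΦ.exists_profile h₀ c₀ a₀
  obtain ⟨a', b', hab', hsec', hcont', hpos', hint'⟩ := hΦ.exists_profile h₁ c₁ a₁
  obtain ⟨X, hX1, -, hX2, hX3⟩ := exists_quantile hcont hpos hab a₀ hint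
  obtain ⟨Y, hY1, -, hY2, hY3⟩ := exists_quantile hcont' hpos' hab' a₁ hint'
  have key := lintegral_transport_le hΦ h₀ c₀ h₁ c₁ hM cM hs ht hst
    (fun τ hτ => (hsec _).2 (Ioo_subset_Icc_self (hX1 hτ)))
    (fun τ hτ => (hsec' _).2 (Ioo_subset_Icc_self (hY1 hτ))) hX2 hY2 hX3 hY3
  have h2 : ENNReal.ofReal ((s * √(area K₀) + t * √(area K₁)) ^ 2) ≤ volume M := by
    calc _ = ∫⁻ _ in Ioo (0 : ℝ) 1, ENNReal.ofReal ((s * √(area K₀) + t * √(area K₁)) ^ 2) := by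
          simp
      _ ≤ _ := setLIntegral_mono' measurableSet_Ioo fun τ hτ => ENNReal.ofReal_le_ofReal
          (transport_integrand_ge (hpos _ (hX1 hτ)) (hpos' _ (hY1 hτ)) a₀.le a₁.le hs.le ht.le)
      _ ≤ _ := key
  apply Real.le_sqrt_of_sq_le
  exact (ENNReal.ofReal_le_iff_le_toReal hM.measure_lt_top.ne).1 h2

/-! ### Parallel sets, the Minkowski perimeter and the isoperimetric inequality -/

theorem mem_cthickening_iff {K : Set Plane} (hK : IsCompact K) {ε : ℝ} (hε : 0 ≤ ε) {z : Plane} :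
    z ∈ Metric.cthickening ε K ↔ ∃ w ∈ K, dist z w ≤ ε := by
  rw [hK.cthickening_eq_biUnion_closedBall hε]
  simp

theorem area_closedBall (x : Plane) {r : ℝ} (hr : 0 ≤ r) :
    area (Metric.closedBall x r) = Real.pi * r ^ 2 := by
  rw [area, Measure.real, EuclideanSpace.volume_closedBall_fin_two, ENNReal.toReal_mul,
    ENNReal.toReal_pow, ENNReal.toReal_ofReal hr]
  simp [mul_comm, Real.pi_pos.le]

theorem area_mono {K L : Set Plane} (h : K ⊆ L) (hL : IsCompact L) : area K ≤ area L :=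
  measureReal_mono h hL.measure_lt_top.ne

/-- For convex `K`, the combination of K^ε and K^δ with weights s, t lies in K^(sε+tδ), so
Brunn–Minkowski applies. This concavity is the reason why the perimeter exists. -/
theorem sqrt_area_cthickening_concave {K : Set Plane} (hK : IsCompact K) (hc : Convex ℝ K)
    (ha : 0 < area K) : ConcaveOn ℝ (Ici 0) fun ε => √(area (Metric.cthickening ε K)) := by
  have hcomp : ∀ ε, IsCompact (Metric.cthickening ε K) := fun ε => hK.cthickening
  have hpos : ∀ ε, 0 < area (Metric.cthickening ε K) := fun ε =>
    ha.trans_le (area_mono (Metric.self_subset_cthickening K) (hcomp ε))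
  refine ⟨convex_Ici 0, ?_⟩
  intro ε hε δ hδ s t hs ht hst
  rcases hs.eq_or_lt with rfl | hs
  · simp at hst; subst hst; simp
  rcases ht.eq_or_lt with rfl | ht
  · simp at hst; subst hst; simp
  simp only [smul_eq_mul]
  apply sqrt_area_combo_le (hcomp ε) (hc.cthickening ε) (hcomp δ) (hc.cthickening δ) (hcomp _)
    (hc.cthickening _) (hpos _) (hpos _) hs ht
  intro z hz w hw
  obtain ⟨z', hz', h1⟩ := (mem_cthickening_iff hK hε).1 hz
  obtain ⟨w', hw', h2⟩ := (mem_cthickening_iff hK hδ).1 hw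
  refine (mem_cthickening_iff hK (add_nonneg (mul_nonneg hs.le hε) (mul_nonneg ht.le hδ))).2
    ⟨s • z' + t • w', hc hz' hw' hs.le ht.le hst, ?_⟩
  refine (dist_add_add_le _ _ _ _).trans ?_
  rw [dist_smul₀, dist_smul₀, Real.norm_of_nonneg hs.le, Real.norm_of_nonneg ht.le]
  gcongr

/-- A displacement of length at most ε is ε/r times a displacement inside the ball of radius r
contained in `K`, so K^ε lies in the dilate of `K` about the centre with ratio 1 + ε/r. This bounds
the difference quotients of √area from above. -/
theorem area_cthickening_le {K : Set Plane} (hK : IsCompact K) (hc : Convex ℝ K) {c : Plane}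
    {r : ℝ} (hr : 0 < r) (hball : Metric.closedBall c r ⊆ K) {ε : ℝ} (hε : 0 < ε) :
    area (Metric.cthickening ε K) ≤ (1 + ε / r) ^ 2 * area K := by
  have hρ : 0 < 1 + ε / r := by positivity
  have hsub : Metric.cthickening ε K ⊆ AffineMap.homothety c (1 + ε / r) '' K := by
    intro w hw
    obtain ⟨z, hz, h1⟩ := (mem_cthickening_iff hK hε.le).1 hw
    have h2 : c + (r / ε) • (w - z) ∈ K := by
      apply hball
      rw [Metric.mem_closedBall, dist_eq_norm, add_sub_cancel_left, norm_smul, Real.norm_of_nonneg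
        (by positivity), ← dist_eq_norm]
      calc r / ε * dist w z ≤ r / ε * ε := by gcongr
        _ = r := by field_simp
    refine ⟨(1 / (1 + ε / r)) • z + ((ε / r) / (1 + ε / r)) • (c + (r / ε) • (w - z)),
      hc hz h2 (by positivity) (by positivity) (by field_simp), ?_⟩
    rw [AffineMap.homothety_apply, vsub_eq_sub, vadd_eq_add, smul_sub, smul_add, smul_smul,
      smul_smul, smul_add, smul_smul]
    have e1 : (1 + ε / r) * (1 / (1 + ε / r)) = 1 := by field_simp
    have e2 : (1 + ε / r) * (ε / r / (1 + ε / r)) = ε / r := by field_simp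
    have e3 : ε / r * (r / ε) = 1 := by field_simp
    rw [e1, e2, e3]
    module
  have h3 : volume (AffineMap.homothety c (1 + ε / r) '' K) =
      ENNReal.ofReal ((1 + ε / r) ^ 2) * volume K := by
    rw [Measure.addHaar_image_homothety]
    simp
  have h4 : volume (Metric.cthickening ε K) ≤ ENNReal.ofReal ((1 + ε / r) ^ 2) * volume K :=
    h3 ▸ measure_mono hsub
  have h5 := ENNReal.toReal_mono
    (ENNReal.mul_ne_top ENNReal.ofReal_ne_top hK.measure_lt_top.ne) h4
  rw [ENNReal.toReal_mul, ENNReal.toReal_ofReal (by positivity)] at h5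
  exact h5

theorem interior_nonempty_of_area_pos {K : Set Plane} (hc : Convex ℝ K)
    (ha : 0 < area K) : (interior K).Nonempty := by
  by_contra h
  rw [not_nonempty_iff_eq_empty] at h
  have h1 := hc.addHaar_frontier volume
  have h2 : volume K ≤ volume (frontier K) := by
    apply measure_mono
    intro x hx
    rw [frontier, h, sdiff_empty]
    exact subset_closure hx
  rw [h1] at h2
  simp [area, Measure.real, le_antisymm h2 bot_le] at ha

/-- The Minkowski perimeter of a convex body is a genuine limit. -/
theorem tendsto_minkowskiPerimeter {K : Set Plane} (hK : IsCompact K) (hc : Convex ℝ K)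
    (ha : 0 < area K) : Tendsto (fun ε => (area (Metric.cthickening ε K) - area K) / ε)
      (𝓝[>] 0) (𝓝 (minkowskiPerimeter K)) := by
  apply tendsto_nhds_limUnder
  set R : ℝ → ℝ := fun ε => √(area (Metric.cthickening ε K)) with hR
  have hconc := sqrt_area_cthickening_concave hK hc ha
  have hR0 : R 0 = √(area K) := by
    simp only [hR]; rw [Metric.cthickening_zero, hK.isClosed.closure_eq]
  have hRsq : ∀ ε, R ε ^ 2 = area (Metric.cthickening ε K) := fun ε =>
    Real.sq_sqrt measureReal_nonneg
  obtain ⟨c, hcint⟩ := interior_nonempty_of_area_pos hc ha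
  obtain ⟨r, hr, hball⟩ := Metric.nhds_basis_closedBall.mem_iff.1
    (mem_interior_iff_mem_nhds.1 hcint)
  -- By concavity the difference quotients of R = √area at 0 decrease in ε; being bounded, they
  -- converge as ε ↓ 0.
  have hanti : AntitoneOn (fun ε => (R ε - R 0) / ε) (Ioi 0) := by
    intro ε hε δ hδ h
    rcases h.eq_or_lt with rfl | h
    · exact le_rfl
    rw [mem_Ioi] at hε hδ
    have h1 := hconc.slope_anti_adjacent (x := 0) (y := ε) (z := δ) (mem_Ici.2 le_rfl)
      (mem_Ici.2 hδ.le) hε h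
    change (R δ - R ε) / (δ - ε) ≤ (R ε - R 0) / (ε - 0) at h1
    rw [sub_zero, div_le_div_iff₀ (by linarith) hε] at h1
    simp only
    rw [div_le_div_iff₀ hδ hε]
    nlinarith
  have hbdd : BddAbove ((fun ε => (R ε - R 0) / ε) '' Ioi 0) := by
    refine ⟨R 0 / r, ?_⟩
    rintro _ ⟨ε, hε, rfl⟩
    rw [mem_Ioi] at hε
    have h1 : R ε ≤ (1 + ε / r) * R 0 := by
      rw [hR0]
      apply Real.sqrt_le_iff.2 ⟨by positivity, ?_⟩
      rw [mul_pow, Real.sq_sqrt ha.le]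
      exact area_cthickening_le hK hc hr hball hε
    simp only
    rw [div_le_div_iff₀ hε hr]
    have : (1 + ε / r) * R 0 * r = R 0 * r + R 0 * ε := by field_simp
    nlinarith
  have hlim := hanti.tendsto_nhdsGT hbdd
  set q := sSup ((fun ε => (R ε - R 0) / ε) '' Ioi 0)
  have hid : Tendsto (fun ε : ℝ => ε) (𝓝[>] 0) (𝓝 0) := tendsto_nhdsWithin_of_tendsto_nhds tendsto_id
  -- The area quotient is recovered from R² - R₀² = (R - R₀)(2R₀ + (R - R₀)).
  have h2 : Tendsto (fun ε => (R ε - R 0) / ε * (2 * R 0 + ε * ((R ε - R 0) / ε))) (𝓝[>] 0)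
      (𝓝 (q * (2 * R 0 + 0 * q))) := hlim.mul ((tendsto_const_nhds).add (hid.mul hlim))
  refine ⟨_, h2.congr' ?_⟩
  filter_upwards [self_mem_nhdsWithin] with ε hε
  have hε' : ε ≠ 0 := (mem_Ioi.1 hε).ne'
  have e : area K = R 0 ^ 2 := by rw [hR0, Real.sq_sqrt ha.le]
  rw [← hRsq, e]
  field_simp
  ring

/-- Brunn–Minkowski for `K` and the unit disc dilated by ε, whose sum is contained in K^ε. -/
theorem area_cthickening_ge {K : Set Plane} (hK : IsCompact K) (hc : Convex ℝ K)
    (ha : 0 < area K) {ε : ℝ} (hε : 0 < ε) :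
    (√(area K) + ε * √Real.pi) ^ 2 ≤ area (Metric.cthickening ε K) := by
  have hB : area (Metric.closedBall (0 : Plane) 1) = Real.pi := by
    rw [area_closedBall _ zero_le_one]; ring
  have := sqrt_area_combo_le hK hc (isCompact_closedBall (0 : Plane) 1) (convex_closedBall _ _)
    (hK.cthickening (r := ε)) (hc.cthickening ε) ha (by rw [hB]; exact Real.pi_pos) one_pos hε (by
      intro z hz w hw
      refine (mem_cthickening_iff hK hε.le).2 ⟨z, hz, ?_⟩
      rw [one_smul, dist_eq_norm, add_sub_cancel_left, norm_smul, Real.norm_of_nonneg hε.le]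
      rw [mem_closedBall_zero_iff] at hw
      nlinarith)
  rw [hB, one_mul] at this
  exact (Real.le_sqrt (by positivity) measureReal_nonneg).1 this

/-- The isoperimetric inequality. -/
theorem le_minkowskiPerimeter {K : Set Plane} (hK : IsCompact K) (hc : Convex ℝ K)
    (ha : 0 < area K) : 2 * √(area K) * √Real.pi ≤ minkowskiPerimeter K := by
  apply ge_of_tendsto (tendsto_minkowskiPerimeter hK hc ha)
  filter_upwards [self_mem_nhdsWithin] with ε hε
  rw [mem_Ioi] at hε
  rw [le_div_iff₀ hε]
  have := area_cthickening_ge hK hc ha hε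
  have e := Real.sq_sqrt ha.le
  nlinarith [sq_nonneg (ε * √Real.pi)]

theorem minkowskiPerimeter_closedBall (x : Plane) {r : ℝ} (hr : 0 < r) :
    minkowskiPerimeter (Metric.closedBall x r) = 2 * Real.pi * r := by
  have h1 := tendsto_minkowskiPerimeter (isCompact_closedBall x r) (convex_closedBall x r)
    (by rw [area_closedBall x hr.le]; positivity)
  refine tendsto_nhds_unique h1 ?_
  have h2 : Tendsto (fun ε : ℝ => 2 * Real.pi * r + Real.pi * ε) (𝓝[>] 0)
      (𝓝 (2 * Real.pi * r + Real.pi * 0)) :=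
    tendsto_nhdsWithin_of_tendsto_nhds (by
      exact (continuous_const.add (continuous_const.mul continuous_id)).tendsto 0)
  rw [mul_zero, add_zero] at h2
  refine h2.congr' ?_
  filter_upwards [self_mem_nhdsWithin] with ε hε
  rw [mem_Ioi] at hε
  rw [cthickening_closedBall hε.le hr.le, area_closedBall x (by positivity),
    area_closedBall x hr.le]
  field_simp
  ring

theorem isoDeficit_eq {K : Set Plane} (ha : 0 < area K) :
    isoDeficit K = minkowskiPerimeter K / (2 * √(area K) * √Real.pi) - 1 := by
  have hpi := Real.pi_pos
  have h : minkowskiPerimeter (barycentricDisc K) = 2 * √(area K) * √Real.pi := by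
    rw [barycentricDisc, minkowskiPerimeter_closedBall _ (by positivity), Real.sqrt_div ha.le]
    have := Real.mul_self_sqrt hpi.le
    have h0 : √Real.pi ≠ 0 := by positivity
    field_simp
    linear_combination -this
  rw [isoDeficit, h, sub_div, div_self (by positivity)]

theorem isoDeficit_nonneg {K : Set Plane} (hK : IsCompact K) (hc : Convex ℝ K)
    (ha : 0 < area K) : 0 ≤ isoDeficit K := by
  rw [isoDeficit_eq ha, sub_nonneg, one_le_div (by have := Real.pi_pos; positivity)]
  exact le_minkowskiPerimeter hK hc ha

end

/-! ### Equality in the isoperimetric inequality -/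

section

variable {Φ : (ℝ × ℝ) ≃L[ℝ] Plane}

theorem setIntegral_id_eq_zero_of_barycentre {K : Set Plane} (ha : 0 < area K)
    (hb : barycentre K = 0) : ∫ x in K, x = 0 := by
  rw [barycentre, smul_eq_zero] at hb
  exact hb.resolve_left (inv_ne_zero ha.ne')

theorem integrableOn_id {K : Set Plane} (hK : IsCompact K) : IntegrableOn (fun x : Plane => x) K :=
  continuousOn_id.integrableOn_compact hK

theorem setIntegral_fst_eq_zero (Φ : (ℝ × ℝ) ≃L[ℝ] Plane) {K : Set Plane} (hK : IsCompact K)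
    (h : ∫ x in K, x = 0) : ∫ z in K, (Φ.symm z).1 = 0 := by
  have := ((ContinuousLinearMap.fst ℝ ℝ ℝ).comp
    (Φ.symm : Plane →L[ℝ] ℝ × ℝ)).integral_comp_comm (integrableOn_id hK)
  rw [h, map_zero] at this
  exact this

theorem setIntegral_closedBall_id (r : ℝ) : ∫ x in Metric.closedBall (0 : Plane) r, x = 0 := by
  have h : ∫ x in Metric.closedBall (0 : Plane) r, x =
      -∫ x in Metric.closedBall (0 : Plane) r, x := by
    rw [← integral_neg, ← integral_indicator Metric.isClosed_closedBall.measurableSet,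
      ← integral_indicator Metric.isClosed_closedBall.measurableSet, ← integral_neg_eq_self]
    congr 1
    ext1 x
    by_cases hx : x ∈ Metric.closedBall (0 : Plane) r
    · rw [indicator_of_mem hx, indicator_of_mem (by simpa using hx)]
    · rw [indicator_of_notMem hx, indicator_of_notMem (by simpa using hx)]
  have h2 : (2 : ℝ) • ∫ x in Metric.closedBall (0 : Plane) r, x = 0 := by
    rw [two_smul]; nth_rewrite 1 [h]; exact neg_add_cancel _
  exact (smul_eq_zero.1 h2).resolve_left two_ne_zero

/-- Equality in the transport inequality forces the profiles to be translates of each other. -/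
theorem secLen_quantile_eq (hΦ : IsFrame Φ) {K : Set Plane} (hK : IsCompact K) (hc : Convex ℝ K)
    (ha : area K = Real.pi) (hP : minkowskiPerimeter K ≤ 2 * Real.pi) {a b a' b' : ℝ}
    (hsec : ∀ x, (sec Φ K x).Nonempty ↔ x ∈ Icc a b)
    (hcont : ContinuousOn (secLen Φ K) (Ioo a b)) (hpos : ∀ x ∈ Ioo a b, 0 < secLen Φ K x)
    (hsec' : ∀ x, (sec Φ (Metric.closedBall 0 1) x).Nonempty ↔ x ∈ Icc a' b')
    (hcont' : ContinuousOn (secLen Φ (Metric.closedBall 0 1)) (Ioo a' b'))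
    (hpos' : ∀ x ∈ Ioo a' b', 0 < secLen Φ (Metric.closedBall 0 1) x) {X Y : ℝ → ℝ}
    (hX : MapsTo X (Ioo 0 1) (Ioo a b)) (hY : MapsTo Y (Ioo 0 1) (Ioo a' b'))
    (hXm : StrictMonoOn X (Ioo 0 1)) (hYm : StrictMonoOn Y (Ioo 0 1))
    (hXd : ∀ τ ∈ Ioo (0 : ℝ) 1, HasDerivAt X (Real.pi / secLen Φ K (X τ)) τ)
    (hYd : ∀ τ ∈ Ioo (0 : ℝ) 1,
      HasDerivAt Y (Real.pi / secLen Φ (Metric.closedBall 0 1) (Y τ)) τ) :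
    EqOn (fun τ => secLen Φ K (X τ)) (fun τ => secLen Φ (Metric.closedBall 0 1) (Y τ))
      (Ioo 0 1) := by
  have hpi := Real.pi_pos
  set f : ℝ → ℝ := fun τ => secLen Φ K (X τ) with hf
  set g : ℝ → ℝ := fun τ => secLen Φ (Metric.closedBall 0 1) (Y τ) with hg
  have hf0 : ∀ τ ∈ Ioo (0 : ℝ) 1, 0 < f τ := fun τ hτ => hpos _ (hX hτ)
  have hg0 : ∀ τ ∈ Ioo (0 : ℝ) 1, 0 < g τ := fun τ hτ => hpos' _ (hY hτ)
  have hfc : ContinuousOn f (Ioo 0 1) :=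
    hcont.comp (fun τ hτ => (hXd τ hτ).continuousAt.continuousWithinAt) hX
  have hgc : ContinuousOn g (Ioo 0 1) :=
    hcont'.comp (fun τ hτ => (hYd τ hτ).continuousAt.continuousWithinAt) hY
  -- J is the defect in the pointwise transport inequality against the disc: for weights 1 and ε the
  -- integrand is exactly π(1+ε)² + εJ.
  set J : ℝ → ℝ := fun τ => Real.pi * ((f τ - g τ) ^ 2 / (f τ * g τ)) with hJ
  have hJc : ContinuousOn J (Ioo 0 1) :=
    continuousOn_const.mul (((hfc.sub hgc).pow 2).div (hfc.mul hgc)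
      fun τ hτ => (mul_pos (hf0 τ hτ) (hg0 τ hτ)).ne')
  have hJ0 : ∀ τ ∈ Ioo (0 : ℝ) 1, 0 ≤ J τ := fun τ hτ =>
    mul_nonneg hpi.le (div_nonneg (sq_nonneg _) (mul_pos (hf0 τ hτ) (hg0 τ hτ)).le)
  set Q := ∫⁻ τ in Ioo (0 : ℝ) 1, ENNReal.ofReal (J τ) with hQ
  have key : ∀ ε > 0, ENNReal.ofReal (Real.pi * (1 + ε) ^ 2) + ENNReal.ofReal ε * Q ≤
      volume (Metric.cthickening ε K) := by
    intro ε hε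
    have h1 := lintegral_transport_le hΦ hK hc (isCompact_closedBall (0 : Plane) 1)
      (convex_closedBall _ _) (hK.cthickening (r := ε)) (hc.cthickening ε) one_pos hε (by
      intro z hz w hw
      refine (mem_cthickening_iff hK hε.le).2 ⟨z, hz, ?_⟩
      rw [one_smul, dist_eq_norm, add_sub_cancel_left, norm_smul, Real.norm_of_nonneg hε.le]
      rw [mem_closedBall_zero_iff] at hw
      nlinarith) (fun τ hτ => (hsec _).2 (Ioo_subset_Icc_self (hX hτ)))
      (fun τ hτ => (hsec' _).2 (Ioo_subset_Icc_self (hY hτ))) hXm hYm hXd hYd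
    refine le_trans (le_of_eq ?_) h1
    have h2 : ENNReal.ofReal (Real.pi * (1 + ε) ^ 2) =
        ∫⁻ _ in Ioo (0 : ℝ) 1, ENNReal.ofReal (Real.pi * (1 + ε) ^ 2) := by simp
    rw [h2, ← lintegral_const_mul' _ _ ENNReal.ofReal_ne_top, ← lintegral_add_left measurable_const]
    apply setLIntegral_congr_fun measurableSet_Ioo
    intro τ hτ
    simp only
    rw [← ENNReal.ofReal_mul hε.le, ← ENNReal.ofReal_add (by positivity)
      (mul_nonneg hε.le (hJ0 τ hτ))]
    congr 1
    have e1 := (hf0 τ hτ).ne'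
    have e2 := (hg0 τ hτ).ne'
    simp only [hJ]
    change _ = (1 * (Real.pi / f τ) + ε * (Real.pi / g τ)) * (1 * f τ + ε * g τ)
    field_simp
    ring
  have hQtop : Q ≠ ⊤ := by
    intro h
    have h1 := key 1 one_pos
    rw [h, ENNReal.mul_top (by simp), add_top, top_le_iff] at h1
    exact (hK.cthickening (r := 1)).measure_lt_top.ne h1
  -- The defect enters at first order in ε, so it survives division by ε and gives P(K) ≥ 2π + Q.
  -- Together with P(K) ≤ 2π this forces Q = 0.
  have hreal : ∀ ε > 0, Q.toReal + 2 * Real.pi ≤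
      (area (Metric.cthickening ε K) - area K) / ε := by
    intro ε hε
    have h1 := ENNReal.toReal_mono (hK.cthickening (r := ε)).measure_lt_top.ne (key ε hε)
    rw [ENNReal.toReal_add ENNReal.ofReal_ne_top (ENNReal.mul_ne_top ENNReal.ofReal_ne_top hQtop),
      ENNReal.toReal_mul, ENNReal.toReal_ofReal hε.le, ENNReal.toReal_ofReal (by positivity)] at h1
    change _ ≤ area (Metric.cthickening ε K) at h1
    rw [le_div_iff₀ hε, ha]
    nlinarith [mul_pos hpi (mul_pos hε hε)]
  have hQ0 : Q = 0 := by
    have h1 : Q.toReal + 2 * Real.pi ≤ minkowskiPerimeter K :=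
      ge_of_tendsto (tendsto_minkowskiPerimeter hK hc (ha ▸ hpi)) (by
        filter_upwards [self_mem_nhdsWithin] with ε hε using hreal ε hε)
    have h2 : Q.toReal = 0 := le_antisymm (by linarith) ENNReal.toReal_nonneg
    exact ((ENNReal.toReal_eq_zero_iff _).1 h2).resolve_right hQtop
  have hae : J =ᵐ[volume.restrict (Ioo 0 1)] fun _ => 0 := by
    rw [hQ, lintegral_eq_zero_iff'
      (hJc.aemeasurable measurableSet_Ioo).ennreal_ofReal] at hQ0
    filter_upwards [hQ0, ae_restrict_mem measurableSet_Ioo] with τ h1 h2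
    exact le_antisymm (ENNReal.ofReal_eq_zero.1 h1) (hJ0 τ h2)
  -- J is continuous, so it vanishes everywhere on (0,1) and not just almost everywhere.
  have hev := Measure.eqOn_open_of_ae_eq hae isOpen_Ioo hJc continuousOn_const
  intro τ hτ
  have h1 : J τ = 0 := hev hτ
  simp only [hJ, mul_eq_zero, hpi.ne', false_or, div_eq_zero_iff, (hf0 τ hτ).ne',
    (hg0 τ hτ).ne', or_false] at h1
  have := pow_eq_zero_iff two_ne_zero |>.1 h1
  exact sub_eq_zero.1 this

/-- Equal section lengths at equal quantiles mean equal derivatives of the quantile functions, so X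
= Y + k and the profile of `K` is that of the unit disc shifted by k. Both barycentres are at the
origin, hence k = 0 and `K` reaches no further than the disc in the direction of the first axis. -/
theorem fst_le_of_minkowskiPerimeter_le (hΦ : IsFrame Φ) {K : Set Plane} (hK : IsCompact K)
    (hc : Convex ℝ K) (ha : area K = Real.pi) (hb : barycentre K = 0)
    (hP : minkowskiPerimeter K ≤ 2 * Real.pi) {z : ℝ × ℝ} (hz : Φ z ∈ K) : z.1 ≤ 1 := by
  have hpi := Real.pi_pos
  have haB : area (Metric.closedBall (0 : Plane) 1) = Real.pi := by
    rw [area_closedBall _ zero_le_one]; ring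
  have hBc := isCompact_closedBall (0 : Plane) 1
  obtain ⟨a, b, hab, hsec, hcont, hpos, hint⟩ := hΦ.exists_profile hK hc (ha ▸ hpi)
  obtain ⟨a', b', hab', hsec', hcont', hpos', hint'⟩ := hΦ.exists_profile
    hBc (convex_closedBall _ _) (haB ▸ hpi)
  obtain ⟨X, hX1, hXs, hX2, hX3⟩ := exists_quantile hcont hpos hab hpi (hint.trans ha)
  obtain ⟨Y, hY1, hYs, hY2, hY3⟩ := exists_quantile hcont' hpos' hab' hpi (hint'.trans haB)
  have heq := secLen_quantile_eq hΦ hK hc ha hP hsec hcont hpos hsec' hcont' hpos' hX1 hY1 hX2 hY2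
    hX3 hY3
  set f := secLen Φ K
  set g := secLen Φ (Metric.closedBall (0 : Plane) 1)
  obtain ⟨k, hk⟩ : ∃ k, ∀ τ ∈ Ioo (0 : ℝ) 1, X τ = Y τ + k := by
    refine ⟨X (1 / 2) - Y (1 / 2), fun τ hτ => ?_⟩
    have hd : ∀ τ ∈ Ioo (0 : ℝ) 1, HasDerivAt (fun τ => X τ - Y τ) 0 τ := by
      intro τ hτ
      have h1 := (hX3 τ hτ).sub (hY3 τ hτ)
      rw [show f (X τ) = g (Y τ) from heq hτ, sub_self] at h1
      exact h1
    have := isOpen_Ioo.is_const_of_deriv_eq_zero (f := fun τ => X τ - Y τ)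
      (isPreconnected_Ioo (a := (0 : ℝ)) (b := 1))
      (fun τ hτ => (hd τ hτ).differentiableAt.differentiableWithinAt)
      (fun τ hτ => (hd τ hτ).deriv) hτ (show (1 / 2 : ℝ) ∈ Ioo (0 : ℝ) 1 by norm_num)
    linarith
  have hmem : ∀ x, x ∈ Ioo a b ↔ x - k ∈ Ioo a' b' := by
    intro x
    constructor
    · intro hx
      obtain ⟨τ, hτ, rfl⟩ := hXs hx
      rw [hk τ hτ, add_sub_cancel_right]; exact hY1 hτ
    · intro hx
      obtain ⟨τ, hτ, h⟩ := hYs hx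
      have : x = X τ := by rw [hk τ hτ, h]; ring
      rw [this]; exact hX1 hτ
  have hfg : ∀ x ∈ Ioo a b, f x = g (x - k) := by
    intro x hx
    obtain ⟨τ, hτ, rfl⟩ := hXs hx
    rw [hk τ hτ, add_sub_cancel_right, ← hk τ hτ]; exact heq hτ
  have hnull : ∀ {L : Set Plane} {p q : ℝ}, (∀ x, (sec Φ L x).Nonempty ↔ x ∈ Icc p q) →
      ∀ x ∉ Icc p q, volume (sec Φ L x) = 0 := by
    intro L p q h x hx
    rw [not_nonempty_iff_eq_empty.1 (mt (h x).1 hx)]; simp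
  have h1 : ∫ x in Ioo a b, x * f x = 0 := by
    rw [← integral_Icc_eq_integral_Ioo,
      ← hΦ.setIntegral_fst hK (φ := fun x => x) continuous_id measurableSet_Icc (hnull hsec)]
    exact setIntegral_fst_eq_zero Φ hK (setIntegral_id_eq_zero_of_barycentre (ha ▸ hpi) hb)
  have h2 : ∫ x in Ioo a' b', x * g x = 0 := by
    rw [← integral_Icc_eq_integral_Ioo,
      ← hΦ.setIntegral_fst hBc (φ := fun x => x) continuous_id measurableSet_Icc (hnull hsec')]
    exact setIntegral_fst_eq_zero Φ hBc (setIntegral_closedBall_id 1)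
  have h3 : ∫ x in Ioo a b, (x - k) * f x = 0 := by
    rw [← h2, ← integral_indicator measurableSet_Ioo, ← integral_indicator measurableSet_Ioo,
      ← integral_sub_right_eq_self ((Ioo a' b').indicator fun x => x * g x) k]
    congr 1
    ext1 x
    by_cases hx : x ∈ Ioo a b
    · rw [indicator_of_mem hx, indicator_of_mem ((hmem x).1 hx), hfg x hx]
    · rw [indicator_of_notMem hx, indicator_of_notMem (mt (hmem x).2 hx)]
  have hfi : IntegrableOn f (Ioo a b) := by
    by_contra h
    rw [integral_undef h] at hint
    exact hpi.ne (hint.trans ha)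
  have hxf : IntegrableOn (fun x => x * f x) (Ioo a b) := by
    refine Integrable.bdd_mul (c := max |a| |b|) hfi
      continuous_id.aestronglyMeasurable ?_
    filter_upwards [ae_restrict_mem measurableSet_Ioo] with x hx
    exact abs_le_max_abs_abs hx.1.le hx.2.le
  -- The first moment of the shifted profile is kπ, and it vanishes because the barycentre of `K` is
  -- the origin.
  have hk0 : k = 0 := by
    have : ∫ x in Ioo a b, (x - k) * f x = (∫ x in Ioo a b, x * f x) - k * Real.pi := by
      rw [← ha, ← hint, ← integral_const_mul, ← integral_sub hxf (hfi.const_mul k)]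
      congr 1; ext x; ring
    rw [h3, h1] at this
    have h5 : k * Real.pi = 0 := by linarith
    exact (mul_eq_zero.1 h5).resolve_right hpi.ne'
  have hbb : b = b' := by
    have : Ioo a b = Ioo a' b' := by
      ext x; rw [hmem x, hk0, sub_zero]
    rw [← csSup_Ioo hab, this, csSup_Ioo hab']
  have hzb : z.1 ≤ b := ((hsec z.1).1 ⟨z.2, hz⟩).2
  obtain ⟨y, hy⟩ := (hsec' b').2 (right_mem_Icc.2 hab'.le)
  rw [mem_sec, mem_closedBall_zero_iff] at hy
  have := (le_abs_self _).trans (hΦ.abs_fst_le (b', y))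
  simp only at this
  linarith

/-- Equality case of the isoperimetric inequality. -/
theorem subset_closedBall_of_minkowskiPerimeter_le {K : Set Plane} (hK : IsCompact K)
    (hc : Convex ℝ K) (ha : area K = Real.pi) (hb : barycentre K = 0)
    (hP : minkowskiPerimeter K ≤ 2 * Real.pi) : K ⊆ Metric.closedBall 0 1 := by
  intro z hz
  rw [mem_closedBall_zero_iff]
  rcases eq_or_ne z 0 with rfl | h0
  · simp
  have hn : ‖z‖ ≠ 0 := norm_ne_zero_iff.2 h0
  have hsq := plane_norm_sq z
  -- This e makes z/‖z‖ the first axis of the frame, so the one-direction bound controls ‖z‖.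
  set e : Plane := !₂[-(z 1 / ‖z‖), z 0 / ‖z‖]
  have he : ‖e‖ = 1 := by
    have h1 := plane_norm_sq e
    have h2 : ‖e‖ ^ 2 = 1 := by
      rw [h1]; simp [e]; field_simp; linarith
    nlinarith [norm_nonneg e]
  have hz' : frameOf e he (‖z‖, 0) = z := by
    rw [frameOf_apply]
    ext i; fin_cases i <;> simp [e] <;> field_simp
  rw [← hz'] at hz
  exact fst_le_of_minkowskiPerimeter_le (isFrame_frameOf e he) hK hc ha hb hP hz

/-! ### Asymmetry as overlap, positivity of the deficit, linearized optimality -/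

theorem barycentricDisc_eq {K : Set Plane} (ha : area K = Real.pi) (hb : barycentre K = 0) :
    barycentricDisc K = Metric.closedBall 0 1 := by
  rw [barycentricDisc, ha, hb, div_self Real.pi_pos.ne', Real.sqrt_one]

theorem area_symmDiff {K L : Set Plane} (hK : IsCompact K) (hL : IsCompact L) :
    area (symmDiff K L) = area K + area L - 2 * area (K ∩ L) := by
  rw [area, measureReal_symmDiff_eq (μ := volume) hK.measurableSet
    hL.measurableSet hK.measure_lt_top.ne hL.measure_lt_top.ne]
  have h1 := measureReal_inter_add_sdiff (μ := volume) (s := K) hL.measurableSet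
    hK.measure_lt_top.ne
  have h2 := measureReal_inter_add_sdiff (μ := volume) (s := L) hK.measurableSet
    hL.measure_lt_top.ne
  rw [inter_comm L K] at h2
  simp only [area]
  linarith

theorem area_barycentricDisc {K : Set Plane} (ha : 0 < area K) :
    area (barycentricDisc K) = area K := by
  have hpi := Real.pi_pos
  rw [barycentricDisc, area_closedBall _ (Real.sqrt_nonneg _), Real.sq_sqrt (by positivity)]
  field_simp

theorem isCompact_barycentricDisc (K : Set Plane) : IsCompact (barycentricDisc K) :=
  isCompact_closedBall _ _

/-- A set and its barycentric disc have equal area, so the symmetric difference is determined by the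
overlap alone. -/
theorem baryAsymmetry_eq {K : Set Plane} (hK : IsCompact K) (ha : 0 < area K) :
    baryAsymmetry K = 2 - 2 * area (K ∩ barycentricDisc K) / area K := by
  rw [baryAsymmetry, area_symmDiff hK (isCompact_barycentricDisc K), area_barycentricDisc ha]
  field_simp
  ring

theorem baryAsymmetry_nonneg (K : Set Plane) : 0 ≤ baryAsymmetry K :=
  div_nonneg measureReal_nonneg measureReal_nonneg

/-- With δ = 0 the equality case puts Ω inside its barycentric disc, which has the same area, and
the asymmetry would vanish. Strict positivity is needed because δ multiplies the overlap in the
linearized functional. -/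
theorem isoDeficit_pos {Ω : Set Plane} (h : IsAdmissible Ω) (ha : area Ω = Real.pi)
    (hb : barycentre Ω = 0) : 0 < isoDeficit Ω := by
  by_contra! hle
  have hpi := Real.pi_pos
  rw [isoDeficit_eq h.area_pos, ha, mul_assoc, Real.mul_self_sqrt hpi.le, sub_nonpos,
    div_le_one (by positivity)] at hle
  have hsub := subset_closedBall_of_minkowskiPerimeter_le h.isCompact h.convex ha hb hle
  apply h.asymmetry_ne_zero
  rw [baryAsymmetry_eq h.isCompact h.area_pos, barycentricDisc_eq ha hb,
    inter_eq_left.2 hsub, mul_div_assoc, div_self h.area_pos.ne']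
  ring

/-- The linearized form of optimality. -/
theorem IsOptimal.linearized {Ω K : Set Plane} (h : IsOptimal Ω) (hK : IsCompact K)
    (hc : Convex ℝ K) (ha : 0 < area K) :
    baryAsymmetry Ω * isoDeficit Ω - 2 * isoDeficit Ω * baryAsymmetry Ω ≤
      baryAsymmetry Ω * isoDeficit K - 2 * isoDeficit Ω * baryAsymmetry K := by
  have hδ := isoDeficit_nonneg h.admissible.isCompact h.admissible.convex h.admissible.area_pos
  have hδK := isoDeficit_nonneg hK hc ha
  have hl : 0 < baryAsymmetry Ω :=
    lt_of_le_of_ne (baryAsymmetry_nonneg Ω) h.admissible.asymmetry_ne_zero.symm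
  by_cases h0 : baryAsymmetry K = 0
  -- Discs are not admissible, but for them the inequality only says that λ₀ δ(K) is at least the
  -- nonpositive number -λ₀ δ.
  · rw [h0]; nlinarith
  have hlK : 0 < baryAsymmetry K := lt_of_le_of_ne (baryAsymmetry_nonneg K) (Ne.symm h0)
  have := h.le K ⟨hK, hc, ha, h0⟩
  rw [div_le_div_iff₀ (by positivity) (by positivity)] at this
  -- The quadratic λ(K)² is replaced by its tangent 2λ(K)λ₀ - λ₀².
  have h2 : 0 ≤ isoDeficit Ω * (baryAsymmetry K - baryAsymmetry Ω) ^ 2 := by positivity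
  have h3 : 0 ≤ baryAsymmetry Ω * (baryAsymmetry Ω * isoDeficit K
      - 2 * isoDeficit Ω * baryAsymmetry K + isoDeficit Ω * baryAsymmetry Ω) := by nlinarith
  have := nonneg_of_mul_nonneg_right h3 hl
  linarith

end

section

variable {Φ : (ℝ × ℝ) ≃L[ℝ] Plane}

/-! ### Subgradients on an interval -/

/-- `f` is a subgradient selection of `u` on `[c, d]`. -/
def IsSubgradOn (u f : ℝ → ℝ) (c d : ℝ) : Prop :=
  ∀ x ∈ Icc c d, ∀ y ∈ Icc c d, u x + f x * (y - x) ≤ u y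

namespace IsSubgradOn

variable {u f : ℝ → ℝ} {c d : ℝ}

theorem monotoneOn (h : IsSubgradOn u f c d) : MonotoneOn f (Icc c d) := by
  intro x hx y hy hxy
  rcases hxy.eq_or_lt with rfl | hxy
  · exact le_rfl
  have h1 := h x hx y hy
  have h2 := h y hy x hx
  by_contra! h3
  nlinarith [mul_pos (sub_pos.2 hxy) (sub_pos.2 h3)]

/-- Applying the subgradient inequality at both points puts the linearization error between 0 and (f
y - f x)(y - x). Differentiability of `u` wherever `f` is continuous follows. -/
theorem abs_sub_le (h : IsSubgradOn u f c d) {x y : ℝ} (hx : x ∈ Icc c d) (hy : y ∈ Icc c d) :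
    |u y - u x - f x * (y - x)| ≤ |f y - f x| * |y - x| := by
  have h1 := h x hx y hy
  have h2 := h y hy x hx
  rw [abs_of_nonneg (by linarith), ← abs_mul]
  refine le_trans ?_ (le_abs_self _)
  linarith

theorem hasDerivAt (h : IsSubgradOn u f c d) {x : ℝ} (hx : x ∈ Ioo c d)
    (hf : ContinuousAt f x) : HasDerivAt u (f x) x := by
  rw [hasDerivAt_iff_isLittleO, Asymptotics.isLittleO_iff]
  intro ε hε
  have h1 : ∀ᶠ y in 𝓝 x, |f y - f x| < ε := by
    have := (Metric.tendsto_nhds.1 hf) ε hε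
    simpa [Real.dist_eq] using this
  filter_upwards [h1, isOpen_Ioo.mem_nhds hx] with y hy hyI
  have := h.abs_sub_le (Ioo_subset_Icc_self hx) (Ioo_subset_Icc_self hyI)
  rw [Real.norm_eq_abs, Real.norm_eq_abs, smul_eq_mul, mul_comm (y - x)]
  exact this.trans (mul_le_mul_of_nonneg_right hy.le (abs_nonneg _))

theorem abs_le (h : IsSubgradOn u f c d) {x : ℝ} (hx : x ∈ Icc c d) :
    |f x| ≤ max |f c| |f d| :=
  abs_le_max_abs_abs (h.monotoneOn (left_mem_Icc.2 (hx.1.trans hx.2)) hx hx.1)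
    (h.monotoneOn hx (right_mem_Icc.2 (hx.1.trans hx.2)) hx.2)

theorem lipschitzOnWith (h : IsSubgradOn u f c d) :
    LipschitzOnWith (Real.toNNReal (max |f c| |f d|)) u (Icc c d) := by
  apply LipschitzOnWith.of_dist_le_mul
  intro x hx y hy
  rw [Real.coe_toNNReal _ (le_max_of_le_left (abs_nonneg _)), Real.dist_eq, Real.dist_eq]
  have h1 := h x hx y hy
  have h2 := h y hy x hx
  have h3 := h.abs_le hx
  have h4 := h.abs_le hy
  have h5 : |f x * (y - x)| ≤ max |f c| |f d| * |x - y| := by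
    rw [abs_mul, abs_sub_comm y x]; gcongr
  have h6 : |f y * (x - y)| ≤ max |f c| |f d| * |x - y| := by
    rw [abs_mul]; gcongr
  rw [_root_.abs_le] at h5 h6
  rw [_root_.abs_le]
  constructor <;> linarith [h5.1, h5.2, h6.1, h6.2]

theorem continuousOn (h : IsSubgradOn u f c d) : ContinuousOn u (Icc c d) :=
  h.lipschitzOnWith.continuousOn

theorem ae_continuousAt (h : IsSubgradOn u f c d) :
    ∀ᵐ x, x ∈ Ioo c d → ContinuousAt f x := by
  have h1 := h.monotoneOn.countable_not_continuousWithinAt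
  filter_upwards [h1.ae_notMem volume] with x hx hxI
  by_contra hc
  apply hx
  refine ⟨Ioo_subset_Icc_self hxI, fun hw => hc (hw.continuousAt (Icc_mem_nhds hxI.1 hxI.2))⟩

theorem intervalIntegrable (h : IsSubgradOn u f c d) {x y : ℝ} (hx : x ∈ Icc c d)
    (hy : y ∈ Icc c d) : IntervalIntegrable f volume x y :=
  (h.monotoneOn.mono (uIcc_subset_Icc hx hy)).intervalIntegrable

/-- `u` is Lipschitz, hence absolutely continuous, and u' = f off the countably many jumps of the
monotone function `f`. -/
theorem integral_eq (h : IsSubgradOn u f c d) {x y : ℝ} (hx : x ∈ Icc c d) (hy : y ∈ Icc c d) :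
    ∫ t in x..y, f t = u y - u x := by
  have hac : AbsolutelyContinuousOnInterval u x y :=
    (h.lipschitzOnWith.mono (uIcc_subset_Icc hx hy)).absolutelyContinuousOnInterval
  rw [← hac.integral_deriv_eq_sub]
  apply intervalIntegral.integral_congr_ae
  have hne : ∀ᵐ t : ℝ, t ≠ c ∧ t ≠ d := by
    filter_upwards [(countable_singleton c).ae_notMem volume,
      (countable_singleton d).ae_notMem volume] with t h1 h2 using ⟨h1, h2⟩
  filter_upwards [h.ae_continuousAt, hne] with t ht htne htm
  have htI := uIcc_subset_Icc hx hy (uIoc_subset_uIcc htm)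
  have htO : t ∈ Ioo c d := ⟨lt_of_le_of_ne htI.1 htne.1.symm, lt_of_le_of_ne htI.2 htne.2⟩
  exact (h.hasDerivAt htO (ht htO)).deriv.symm

theorem of_integral (hf : MonotoneOn f (Icc c d))
    (h : ∀ x ∈ Icc c d, ∀ y ∈ Icc c d, u y - u x = ∫ t in x..y, f t) : IsSubgradOn u f c d := by
  intro x hx y hy
  have hI : IntervalIntegrable f volume x y := (hf.mono (uIcc_subset_Icc hx hy)).intervalIntegrable
  have e := h x hx y hy
  rcases le_total x y with hxy | hxy
  · have := intervalIntegral.integral_mono_on hxy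
      (intervalIntegrable_const (c := f x)) hI
      (fun t ht => hf hx ⟨hx.1.trans ht.1, ht.2.trans hy.2⟩ ht.1)
    rw [intervalIntegral.integral_const, smul_eq_mul] at this
    linarith
  · have := intervalIntegral.integral_mono_on hxy hI.symm
      (intervalIntegrable_const (c := f x))
      (fun t ht => hf ⟨hy.1.trans ht.1, ht.2.trans hx.2⟩ hx ht.2)
    rw [intervalIntegral.integral_const, smul_eq_mul, intervalIntegral.integral_symm] at this
    linarith

end IsSubgradOn

/-! ### Lower boundary arcs -/

/-- Over `[c, d]` the graph of `u` is the lower boundary of `L`, it lies below the axis, which is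
contained in `L` there, and `f` gives slopes of supporting lines. -/
structure IsLowerArc (Φ : (ℝ × ℝ) ≃L[ℝ] Plane) (L : Set Plane) (c d : ℝ) (u f : ℝ → ℝ) :
    Prop where
  lt : c < d
  mem : ∀ x ∈ Icc c d, Φ (x, u x) ∈ L
  top : ∀ x ∈ Icc c d, Φ (x, 0) ∈ L
  neg : ∀ x ∈ Icc c d, u x < 0
  supp : ∀ x ∈ Icc c d, ∀ z, Φ z ∈ L → u x + f x * (z.1 - x) ≤ z.2

/-- Vertical convexity. -/
theorem mem_of_vertical {L : Set Plane} (hc : Convex ℝ L) {x y₁ y y₂ : ℝ} (h₁ : Φ (x, y₁) ∈ L)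
    (h₂ : Φ (x, y₂) ∈ L) (h : y₁ ≤ y) (h' : y ≤ y₂) : Φ (x, y) ∈ L :=
  (convex_sec hc x).ordConnected.out h₁ h₂ ⟨h, h'⟩

namespace IsLowerArc

variable {L : Set Plane} {c d : ℝ} {u f : ℝ → ℝ}

theorem isSubgradOn (h : IsLowerArc Φ L c d u f) : IsSubgradOn u f c d :=
  fun x hx y hy => h.supp x hx (y, u y) (h.mem y hy)

theorem mem_iff (h : IsLowerArc Φ L c d u f) (hc : Convex ℝ L) {x y : ℝ} (hx : x ∈ Icc c d)
    (hy : y ≤ 0) : Φ (x, y) ∈ L ↔ u x ≤ y := by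
  constructor
  · intro hm
    have := h.supp x hx _ hm
    simpa using this
  · intro hu
    exact mem_of_vertical hc (h.mem x hx) (h.top x hx) hu hy

theorem isEpiOn (h : IsLowerArc Φ L c d u f) (hc : Convex ℝ L) : IsEpiOn Φ L c d 0 u :=
  fun x hx => ⟨(h.neg x (Ioo_subset_Icc_self hx)).le,
    fun _ hy => h.mem_iff hc (Ioo_subset_Icc_self hx) hy.le⟩

theorem mono (h : IsLowerArc Φ L c d u f) {c' d' : ℝ} (hcd : c' < d') (hc : c ≤ c')
    (hd : d' ≤ d) : IsLowerArc Φ L c' d' u f := by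
  have hs : Icc c' d' ⊆ Icc c d := Icc_subset_Icc hc hd
  exact ⟨hcd, fun x hx => h.mem x (hs hx), fun x hx => h.top x (hs hx), fun x hx => h.neg x (hs hx),
    fun x hx => h.supp x (hs hx)⟩

theorem exists_neg (h : IsLowerArc Φ L c d u f) : ∃ η > 0, ∀ x ∈ Icc c d, u x ≤ -η := by
  obtain ⟨x₀, hx₀, hmax⟩ := isCompact_Icc.exists_isMaxOn (nonempty_Icc.2 h.lt.le)
    h.isSubgradOn.continuousOn
  exact ⟨-u x₀, by linarith [h.neg x₀ hx₀], fun x hx => by rw [neg_neg]; exact hmax hx⟩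

end IsLowerArc

/-- The set obtained from `L` by replacing the lower boundary over `[c, d]` by the graph of
`w`. -/
def reshape (Φ : (ℝ × ℝ) ≃L[ℝ] Plane) (L : Set Plane) (c d : ℝ) (w : ℝ → ℝ) : Set Plane :=
  (L \ strip Φ c d 0) ∪ Φ '' {z | (z.1 ∈ Icc c d ∧ w z.1 ≤ z.2) ∧ z.2 ≤ 0}

section reshape

variable {L : Set Plane} {c d : ℝ} {u f w h : ℝ → ℝ}

theorem mem_reshape {z : ℝ × ℝ} : Φ z ∈ reshape Φ L c d w ↔
    (Φ z ∈ L ∧ ¬(z.1 ∈ Ioo c d ∧ z.2 < 0)) ∨ (z.1 ∈ Icc c d ∧ w z.1 ≤ z.2) ∧ z.2 ≤ 0 := by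
  rw [reshape, mem_union, Set.mem_sdiff, mem_strip, Φ.injective.mem_set_image]
  rfl

theorem isCompact_reshape (hL : IsCompact L) (hw : ContinuousOn w (Icc c d)) :
    IsCompact (reshape Φ L c d w) := by
  refine (hL.diff (isOpen_strip Φ c d 0)).union (IsCompact.image ?_ Φ.continuous)
  rcases lt_or_ge d c with hdc | hcd
  · convert isCompact_empty
    ext z
    simp [Icc_eq_empty (not_le.2 hdc)]
  obtain ⟨x₀, hx₀, hmin⟩ := isCompact_Icc.exists_isMinOn (nonempty_Icc.2 hcd) hw
  refine ((isCompact_Icc (a := c) (b := d)).prod (isCompact_Icc (a := w x₀) (b := 0))).of_isClosed_subset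
    ((isClosed_Icc.epigraph hw).inter (isClosed_le continuous_snd continuous_const)) ?_
  rintro z ⟨⟨h1, h2⟩, h3⟩
  exact ⟨h1, (hmin h1).trans h2, h3⟩

/-- Separates membership into an upper condition, which refers only to `L`, a lower condition over
[c, d], which refers only to `w`, and the unchanged condition elsewhere. Convexity can then be
checked for each of them. -/
theorem mem_reshape_iff (hL : IsLowerArc Φ L c d u f) (hc : Convex ℝ L) (hwc : w c = u c)
    (hwd : w d = u d) (hneg : ∀ x ∈ Icc c d, w x < 0) {z : ℝ × ℝ} :
    Φ z ∈ reshape Φ L c d w ↔ (∃ y, z.2 ≤ y ∧ Φ (z.1, y) ∈ L) ∧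
      (z.1 ∈ Icc c d → w z.1 ≤ z.2) ∧ (z.1 ∉ Icc c d → Φ z ∈ L) := by
  obtain ⟨x, y⟩ := z
  rw [mem_reshape]
  simp only
  constructor
  · rintro (⟨h1, h2⟩ | ⟨⟨h1, h2⟩, h3⟩)
    · refine ⟨⟨y, le_rfl, h1⟩, fun hx => ?_, fun _ => h1⟩
      by_cases hxo : x ∈ Ioo c d
      · exact (hneg x hx).le.trans (not_lt.1 fun hy => h2 ⟨hxo, hy⟩)
      · have hwu : w x = u x := by
          rcases hx.1.eq_or_lt with rfl | hcx
          · exact hwc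
          · rcases hx.2.eq_or_lt with rfl | hxd
            · exact hwd
            · exact absurd ⟨hcx, hxd⟩ hxo
        have := hL.supp x hx _ h1
        rw [hwu]; simpa using this
    · exact ⟨⟨0, h3, hL.top x h1⟩, fun _ => h2, fun hx => absurd h1 hx⟩
  · rintro ⟨⟨y', hy', hm⟩, h2, h3⟩
    by_cases hx : x ∈ Icc c d
    · rcases le_or_gt y 0 with hy | hy
      · exact Or.inr ⟨⟨hx, h2 hx⟩, hy⟩
      · exact Or.inl ⟨mem_of_vertical hc (hL.top x hx) hm hy.le hy', fun h => hy.not_gt h.2⟩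
    · exact Or.inl ⟨h3 hx, fun h => hx (Ioo_subset_Icc_self h.1)⟩

/-- Over [c, d] this is the subgradient inequality for `w`. Beyond an endpoint, the line at x lies
below the line at that endpoint, because slopes increase, and the latter supports `L`, because value
and slope of `w` agree there with those of `u`. -/
theorem reshape_supp (hL : IsLowerArc Φ L c d u f) (hc : Convex ℝ L) (hwc : w c = u c)
    (hwd : w d = u d) (hhc : h c = f c) (hhd : h d = f d) (hneg : ∀ x ∈ Icc c d, w x < 0)
    (hsub : IsSubgradOn w h c d) : ∀ x ∈ Icc c d, ∀ z, Φ z ∈ reshape Φ L c d w →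
      w x + h x * (z.1 - x) ≤ z.2 := by
  intro x hx z hz
  obtain ⟨-, h2, h3⟩ := (mem_reshape_iff hL hc hwc hwd hneg).1 hz
  by_cases hzx : z.1 ∈ Icc c d
  · exact (hsub x hx _ hzx).trans (h2 hzx)
  have hm := h3 hzx
  have hci := left_mem_Icc.2 hL.lt.le
  have hdi := right_mem_Icc.2 hL.lt.le
  rcases lt_or_ge z.1 c with hlt | hge
  · have h4 := hL.supp c hci z hm
    have h5 := hsub x hx c hci
    have h6 := hsub.monotoneOn hci hx hx.1
    rw [← hwc, ← hhc] at h4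
    nlinarith [mul_nonneg (sub_nonneg.2 h6) (sub_nonneg.2 hlt.le)]
  · have hgt : d < z.1 := not_le.1 fun hle => hzx ⟨hge, hle⟩
    have h4 := hL.supp d hdi z hm
    have h5 := hsub x hx d hdi
    have h6 := hsub.monotoneOn hx hdi hx.2
    rw [← hwd, ← hhd] at h4
    nlinarith [mul_nonneg (sub_nonneg.2 h6) (sub_nonneg.2 hgt.le)]

/-- If a segment from `z₁` to `z₂ ∈ L` crosses the vertical line over `e` in a point of `L`, its
part beyond that line is in `L`. -/
theorem mem_of_crossing (hc : Convex ℝ L) {z₁ z₂ : ℝ × ℝ} (hz₂ : Φ z₂ ∈ L) {e s t : ℝ}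
    (hs : 0 ≤ s) (hst : s + t = 1) (hne : 0 < (z₂.1 - e) / (z₂.1 - z₁.1))
    (hle : s ≤ (z₂.1 - e) / (z₂.1 - z₁.1))
    (hcross : Φ (((z₂.1 - e) / (z₂.1 - z₁.1)) • z₁ + (1 - (z₂.1 - e) / (z₂.1 - z₁.1)) • z₂) ∈ L) :
    Φ (s • z₁ + t • z₂) ∈ L := by
  set s' := (z₂.1 - e) / (z₂.1 - z₁.1)
  have h1 := hc hcross hz₂ (div_nonneg hs hne.le) (sub_nonneg.2 ((div_le_one hne).2 hle))
    (by ring)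
  rw [← map_smul, ← map_smul, ← map_add] at h1
  have e1 : s / s' * (1 - s') + (1 - s / s') = t := by
    have : s = 1 - t := by linarith
    subst this; field_simp; ring
  rwa [smul_add, smul_smul, smul_smul, add_assoc, ← add_smul, div_mul_cancel₀ _ hne.ne', e1] at h1

/-- The upper condition passes to segments by convexity of `L`, the lower one by the supporting
lines of `reshape_supp`. A point of the segment outside [c, d] is either between two points of `L`
or beyond a crossing of the vertical over c or d; there w = u, so the crossing point belongs to `L`
and the outer part of the segment does too. -/
theorem convex_reshape (hL : IsLowerArc Φ L c d u f) (hc : Convex ℝ L) (hwc : w c = u c)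
    (hwd : w d = u d) (hhc : h c = f c) (hhd : h d = f d) (hneg : ∀ x ∈ Icc c d, w x < 0)
    (hsub : IsSubgradOn w h c d) : Convex ℝ (reshape Φ L c d w) := by
  have hM := fun z => mem_reshape_iff hL hc hwc hwd hneg (z := z)
  have hS := reshape_supp hL hc hwc hwd hhc hhd hneg hsub
  have hci := left_mem_Icc.2 hL.lt.le
  have hdi := right_mem_Icc.2 hL.lt.le
  have key : ∀ z₁ z₂ : ℝ × ℝ, Φ z₁ ∈ reshape Φ L c d w → Φ z₂ ∈ reshape Φ L c d w →
      ∀ s t : ℝ, 0 ≤ s → 0 ≤ t → s + t = 1 → z₁.1 ≤ z₂.1 →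
      Φ (s • z₁ + t • z₂) ∈ reshape Φ L c d w := by
    intro z₁ z₂ h₁ h₂ s t hs ht hst h12
    have hlow : ∀ s t : ℝ, 0 ≤ s → 0 ≤ t → s + t = 1 → (s • z₁ + t • z₂).1 ∈ Icc c d →
        w (s • z₁ + t • z₂).1 ≤ (s • z₁ + t • z₂).2 := by
      intro s t hs ht hst hx
      set x := (s • z₁ + t • z₂).1 with hxdef
      have e1 := mul_le_mul_of_nonneg_left (hS x hx z₁ h₁) hs
      have e2 := mul_le_mul_of_nonneg_left (hS x hx z₂ h₂) ht
      have e3 : x = s * z₁.1 + t * z₂.1 := rfl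
      have e4 : (s • z₁ + t • z₂).2 = s * z₁.2 + t * z₂.2 := rfl
      have e5 : s * (w x + h x * (z₁.1 - x)) + t * (w x + h x * (z₂.1 - x)) = w x := by
        rw [show s * (w x + h x * (z₁.1 - x)) + t * (w x + h x * (z₂.1 - x)) =
          (s + t) * w x + h x * (s * z₁.1 + t * z₂.1 - (s + t) * x) by ring, hst, ← e3]
        ring
      rw [e4]; linarith
    have hup : ∀ s t : ℝ, 0 ≤ s → 0 ≤ t → s + t = 1 →
        ∃ y, (s • z₁ + t • z₂).2 ≤ y ∧ Φ ((s • z₁ + t • z₂).1, y) ∈ L := by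
      intro s t hs ht hst
      obtain ⟨⟨y₁, hy₁, m₁⟩, -, -⟩ := (hM z₁).1 h₁
      obtain ⟨⟨y₂, hy₂, m₂⟩, -, -⟩ := (hM z₂).1 h₂
      refine ⟨s * y₁ + t * y₂, ?_, ?_⟩
      · have e4 : (s • z₁ + t • z₂).2 = s * z₁.2 + t * z₂.2 := rfl
        rw [e4]; gcongr
      · have := hc m₁ m₂ hs ht hst
        rwa [← frame_combo] at this
    have hend : ∀ s t : ℝ, 0 ≤ s → 0 ≤ t → s + t = 1 → (s • z₁ + t • z₂).1 ∈ Icc c d →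
        u (s • z₁ + t • z₂).1 = w (s • z₁ + t • z₂).1 → Φ (s • z₁ + t • z₂) ∈ L := by
      intro s t hs ht hst hx hu
      obtain ⟨y, hy, hm⟩ := hup s t hs ht hst
      exact mem_of_vertical hc (hL.mem _ hx) hm (hu ▸ hlow s t hs ht hst hx) hy
    refine (hM _).2 ⟨hup s t hs ht hst, hlow s t hs ht hst, fun hx => ?_⟩
    have e3 : (s • z₁ + t • z₂).1 = s * z₁.1 + t * z₂.1 := rfl
    have e7 : (s • z₁ + t • z₂).1 - z₁.1 = t * (z₂.1 - z₁.1) := by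
      rw [e3]; linear_combination z₁.1 * hst
    have e8 : z₂.1 - (s • z₁ + t • z₂).1 = s * (z₂.1 - z₁.1) := by
      rw [e3]; linear_combination -z₂.1 * hst
    have e9 := mul_nonneg ht (sub_nonneg.2 h12)
    have e10 := mul_nonneg hs (sub_nonneg.2 h12)
    rcases lt_or_ge (s • z₁ + t • z₂).1 c with hlt | hge
    · have hz1 : z₁.1 < c := by linarith
      have m₁ : Φ z₁ ∈ L := ((hM z₁).1 h₁).2.2 fun h => h.1.not_gt hz1
      by_cases hz2 : z₂.1 < c
      · have m₂ : Φ z₂ ∈ L := ((hM z₂).1 h₂).2.2 fun h => h.1.not_gt hz2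
        have := hc m₁ m₂ hs ht hst
        rwa [← map_smul, ← map_smul, ← map_add] at this
      · push Not at hz2
        have hd0 : 0 < z₂.1 - z₁.1 := by linarith
        have hrat : (z₁.1 - c) / (z₁.1 - z₂.1) = (c - z₁.1) / (z₂.1 - z₁.1) := by
          rw [← neg_sub c, ← neg_sub z₂.1, neg_div_neg_eq]
        have hpos : 0 < (c - z₁.1) / (z₂.1 - z₁.1) := div_pos (by linarith) hd0
        have hone : (c - z₁.1) / (z₂.1 - z₁.1) ≤ 1 := (div_le_one hd0).2 (by linarith)
        have hxc : ((1 - (c - z₁.1) / (z₂.1 - z₁.1)) • z₁ +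
            ((c - z₁.1) / (z₂.1 - z₁.1)) • z₂).1 = c := by
          simp only [Prod.fst_add, Prod.smul_fst, smul_eq_mul]
          field_simp; ring
        rw [add_comm]
        refine mem_of_crossing hc m₁ (e := c) ht (by linarith) (hrat ▸ hpos) ?_ ?_
        · rw [hrat, le_div_iff₀ hd0]; linarith
        · rw [hrat, add_comm]
          apply hend _ _ (by linarith) hpos.le (by ring)
          · rw [hxc]; exact hci
          · rw [hxc, hwc]
    · have hgt : d < (s • z₁ + t • z₂).1 := not_le.1 fun hle => hx ⟨hge, hle⟩
      have hz2 : d < z₂.1 := by linarith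
      have m₂ : Φ z₂ ∈ L := ((hM z₂).1 h₂).2.2 fun h => h.2.not_gt hz2
      by_cases hz1 : d < z₁.1
      · have m₁ : Φ z₁ ∈ L := ((hM z₁).1 h₁).2.2 fun h => h.2.not_gt hz1
        have := hc m₁ m₂ hs ht hst
        rwa [← map_smul, ← map_smul, ← map_add] at this
      · push Not at hz1
        have hd0 : 0 < z₂.1 - z₁.1 := by linarith
        have hpos : 0 < (z₂.1 - d) / (z₂.1 - z₁.1) := div_pos (by linarith) hd0
        have hone : (z₂.1 - d) / (z₂.1 - z₁.1) ≤ 1 := (div_le_one hd0).2 (by linarith)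
        have hxd : (((z₂.1 - d) / (z₂.1 - z₁.1)) • z₁ +
            (1 - (z₂.1 - d) / (z₂.1 - z₁.1)) • z₂).1 = d := by
          simp only [Prod.fst_add, Prod.smul_fst, smul_eq_mul]
          field_simp; ring
        refine mem_of_crossing hc m₂ (e := d) hs hst hpos ?_ ?_
        · rw [le_div_iff₀ hd0]; linarith
        · apply hend _ _ hpos.le (by linarith) (by ring)
          · rw [hxd]; exact hdi
          · rw [hxd, hwd]
  intro p₁ h₁ p₂ h₂ s t hs ht hst
  obtain ⟨z₁, rfl⟩ := Φ.surjective p₁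
  obtain ⟨z₂, rfl⟩ := Φ.surjective p₂
  rw [← map_smul, ← map_smul, ← map_add]
  rcases le_total z₁.1 z₂.1 with h12 | h12
  · exact key z₁ z₂ h₁ h₂ s t hs ht hst h12
  · rw [add_comm]
    exact key z₂ z₁ h₂ h₁ t s ht hs (by linarith) h12

theorem isLowerArc_reshape (hL : IsLowerArc Φ L c d u f) (hc : Convex ℝ L) (hwc : w c = u c)
    (hwd : w d = u d) (hhc : h c = f c) (hhd : h d = f d) (hneg : ∀ x ∈ Icc c d, w x < 0)
    (hsub : IsSubgradOn w h c d) : IsLowerArc Φ (reshape Φ L c d w) c d w h where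
  lt := hL.lt
  mem x hx := mem_reshape.2 (Or.inr ⟨⟨hx, le_rfl⟩, (hneg x hx).le⟩)
  top x hx := mem_reshape.2 (Or.inr ⟨⟨hx, (hneg x hx).le⟩, le_rfl⟩)
  neg := hneg
  supp := reshape_supp hL hc hwc hwd hhc hhd hneg hsub

theorem reshape_diff_strip (hL : IsLowerArc Φ L c d u f) (hc : Convex ℝ L) (hwc : w c = u c)
    (hwd : w d = u d) (hneg : ∀ x ∈ Icc c d, w x < 0) :
    L \ strip Φ c d 0 = reshape Φ L c d w \ strip Φ c d 0 := by
  ext p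
  obtain ⟨⟨x, y⟩, rfl⟩ := Φ.surjective p
  rw [Set.mem_sdiff, Set.mem_sdiff, mem_strip]
  constructor
  · rintro ⟨h1, h2⟩
    exact ⟨mem_reshape.2 (Or.inl ⟨h1, h2⟩), h2⟩
  · rintro ⟨h1, h2⟩
    refine ⟨?_, h2⟩
    rcases mem_reshape.1 h1 with h3 | ⟨⟨h3, h4⟩, h5⟩
    · exact h3.1
    · simp only at h2 h3 h4 h5
      by_cases hxo : x ∈ Ioo c d
      · have : y = 0 := le_antisymm h5 (not_lt.1 fun h => h2 ⟨hxo, h⟩)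
        rw [this]; exact hL.top x h3
      · rw [hL.mem_iff hc h3 h5]
        rcases h3.1.eq_or_lt with rfl | hcx
        · rwa [← hwc]
        · rcases h3.2.eq_or_lt with rfl | hxd
          · rwa [← hwd]
          · exact absurd ⟨hcx, hxd⟩ hxo

end reshape

end

/-! ### The change of perimeter when a lower arc is replaced -/

section

variable {Φ : (ℝ × ℝ) ≃L[ℝ] Plane}

theorem setIntegral_one_eq_area (L : Set Plane) : ∫ _ in L, (1 : ℝ) = area L := by
  rw [setIntegral_const, smul_eq_mul, mul_one]; rfl

theorem area_sub_of_isEpiOn (hΦ : IsFrame Φ) {L L' : Set Plane} (hL : IsCompact L)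
    (hL' : IsCompact L') {c d y₀ : ℝ} {f f' : ℝ → ℝ} (hf : IsEpiOn Φ L c d y₀ f)
    (hf' : IsEpiOn Φ L' c d y₀ f') (hout : L \ strip Φ c d y₀ = L' \ strip Φ c d y₀) :
    area L' - area L = ∫ x in Ioo c d, (f x - f' x) := by
  have := setIntegral_sub_of_isEpiOn hΦ hL.measurableSet hL'.measurableSet hf hf' hout
    (h := fun _ => (1 : ℝ)) (integrableOn_const hL.measure_lt_top.ne)
    (integrableOn_const hL'.measure_lt_top.ne)
  rw [setIntegral_one_eq_area, setIntegral_one_eq_area] at this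
  simpa using this

theorem integrableOn_of_isEpiOn (hΦ : IsFrame Φ) {L : Set Plane} (hL : IsCompact L)
    {c d y₀ : ℝ} {f : ℝ → ℝ} (hf : IsEpiOn Φ L c d y₀ f) : IntegrableOn f (Ioo c d) := by
  have h1 := (setIntegral_inter_strip hΦ hL.measurableSet hf (h := fun _ => (1 : ℝ))
    (integrableOn_const ((measure_mono inter_subset_left).trans_lt hL.measure_lt_top).ne)).2.1
  simp only [intervalIntegral.integral_const, smul_eq_mul, mul_one] at h1
  have h2 : IntegrableOn (fun x => y₀ - (y₀ - f x)) (Ioo c d) :=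
    (integrableOn_const (by simp)).sub h1
  simpa using h2

/-- The lower end of the section of `L` over `x`. -/
def lowEnd (Φ : (ℝ × ℝ) ≃L[ℝ] Plane) (L : Set Plane) (x : ℝ) : ℝ := sInf (sec Φ L x)

theorem lowEnd_mem {L : Set Plane} (hL : IsCompact L) {x q : ℝ} (hq : Φ (x, q) ∈ L) :
    Φ (x, lowEnd Φ L x) ∈ L :=
  (isCompact_sec (Φ := Φ) hL x).sInf_mem ⟨q, hq⟩

theorem lowEnd_le {L : Set Plane} (hL : IsCompact L) {x y : ℝ} (hy : Φ (x, y) ∈ L) :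
    lowEnd Φ L x ≤ y :=
  csInf_le (isCompact_sec (Φ := Φ) hL x).bddBelow hy

theorem mem_iff_lowEnd_le {L : Set Plane} (hL : IsCompact L) (hc : Convex ℝ L) {x y q : ℝ}
    (hq : Φ (x, q) ∈ L) (hy : y ≤ q) : Φ (x, y) ∈ L ↔ lowEnd Φ L x ≤ y :=
  ⟨fun h => lowEnd_le hL h, fun h => mem_of_vertical hc (lowEnd_mem hL hq) hq h hy⟩

theorem IsFrame.mem_cthickening_iff (hΦ : IsFrame Φ) {L : Set Plane} (hL : IsCompact L) {ε : ℝ}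
    (hε : 0 ≤ ε) {z : ℝ × ℝ} : Φ z ∈ Metric.cthickening ε L ↔
      ∃ w, Φ w ∈ L ∧ (z.1 - w.1) ^ 2 + (z.2 - w.2) ^ 2 ≤ ε ^ 2 := by
  rw [_root_.mem_cthickening_iff hL hε]
  constructor
  · rintro ⟨w, hw, h⟩
    obtain ⟨w, rfl⟩ := Φ.surjective w
    refine ⟨w, hw, ?_⟩
    rw [← hΦ.dist_sq]
    exact pow_le_pow_left₀ dist_nonneg h 2
  · rintro ⟨w, hw, h⟩
    refine ⟨_, hw, ?_⟩
    rw [← hΦ.dist_sq] at h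
    exact le_of_sq_le_sq h hε

namespace IsLowerArc

variable {L : Set Plane} {c d : ℝ} {u f : ℝ → ℝ}

/-- K^ε lies above the supporting line of slope f x pushed down by Euclidean distance ε, which is
vertical distance ε√(1 + f x²). The estimate is Cauchy–Schwarz. -/
theorem le_of_mem_cthickening (h : IsLowerArc Φ L c d u f) (hΦ : IsFrame Φ) (hL : IsCompact L)
    {ε : ℝ} (hε : 0 ≤ ε) {x y : ℝ} (hx : x ∈ Icc c d) (hm : Φ (x, y) ∈ Metric.cthickening ε L) :
    u x - y ≤ ε * √(1 + f x ^ 2) := by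
  obtain ⟨w, hw, hd⟩ := (hΦ.mem_cthickening_iff hL hε).1 hm
  have h1 := h.supp x hx w hw
  simp only at hd
  have h2 : (f x * (x - w.1) + (w.2 - y)) ^ 2 ≤ (ε * √(1 + f x ^ 2)) ^ 2 := by
    rw [mul_pow, Real.sq_sqrt (by positivity)]
    have h3 : (f x * (x - w.1) + (w.2 - y)) ^ 2 ≤
        ((x - w.1) ^ 2 + (y - w.2) ^ 2) * (1 + f x ^ 2) := by
      nlinarith [sq_nonneg ((x - w.1) - f x * (w.2 - y))]
    exact h3.trans (by gcongr)
  have h4 := (abs_le_of_sq_le_sq h2 (by positivity))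
  have h5 := (le_abs_self _).trans h4
  nlinarith

/-- The boundary of the parallel set sinks vertically at speed √(1 + f²). The supporting line bounds
it from above. From below, the point of the graph over x + εσ is moved by ε in the direction of the
outer normal at x, with σ chosen so that it lands over x; differentiability of `u` at x gives the
same limit. -/
theorem tendsto_lowEnd (h : IsLowerArc Φ L c d u f) (hΦ : IsFrame Φ) (hL : IsCompact L)
    {x : ℝ} (hx : x ∈ Ioo c d) (hf : ContinuousAt f x) :
    Tendsto (fun ε => (u x - lowEnd Φ (Metric.cthickening ε L) x) / ε) (𝓝[>] 0)
      (𝓝 √(1 + f x ^ 2)) := by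
  set q := √(1 + f x ^ 2) with hq
  have hq0 : 0 < q := by positivity
  have hq2 : q ^ 2 = 1 + f x ^ 2 := Real.sq_sqrt (by positivity)
  set σ := -f x / q with hσ
  have hx' := Ioo_subset_Icc_self hx
  have hder : HasDerivAt (fun ε : ℝ => u (x + ε * σ)) (f x * σ) 0 := by
    have h1 := h.isSubgradOn.hasDerivAt hx hf
    have h2 : HasDerivAt (fun ε : ℝ => x + ε * σ) σ 0 := by
      simpa using ((hasDerivAt_id (0 : ℝ)).mul_const σ).const_add x
    have h3 : HasDerivAt u (f x) (x + 0 * σ) := by simpa using h1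
    exact h3.comp (0 : ℝ) h2
  have hslope : Tendsto (fun ε : ℝ => ε⁻¹ * (u (x + ε * σ) - u x)) (𝓝[>] 0) (𝓝 (f x * σ)) := by
    have := hder.tendsto_slope_zero_right
    simpa using this
  have hlower : Tendsto (fun ε : ℝ => -(ε⁻¹ * (u (x + ε * σ) - u x)) + 1 / q) (𝓝[>] 0) (𝓝 q) := by
    have := hslope.neg.add_const (1 / q)
    convert this using 2
    rw [hσ]; field_simp; linarith
  have hev : ∀ᶠ ε : ℝ in 𝓝[>] 0, x + ε * σ ∈ Icc c d := by
    have h1 : Tendsto (fun ε : ℝ => x + ε * σ) (𝓝[>] 0) (𝓝 (x + 0 * σ)) :=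
      tendsto_nhdsWithin_of_tendsto_nhds (by
        exact (continuous_const.add (continuous_id.mul continuous_const)).tendsto 0)
    rw [zero_mul, add_zero] at h1
    exact h1.eventually (Icc_mem_nhds hx.1 hx.2)
  refine tendsto_of_tendsto_of_tendsto_of_le_of_le' hlower tendsto_const_nhds ?_ ?_
  · filter_upwards [hev, self_mem_nhdsWithin] with ε hε hpos
    rw [mem_Ioi] at hpos
    have hm : Φ (x, u (x + ε * σ) - ε / q) ∈ Metric.cthickening ε L := by
      refine (hΦ.mem_cthickening_iff hL hpos.le).2 ⟨_, h.mem _ hε, le_of_eq ?_⟩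
      simp only [hσ]
      field_simp
      linear_combination (-ε ^ 2) * hq2
    have h1 := lowEnd_le hL.cthickening hm
    rw [le_div_iff₀ hpos]
    have : (-(ε⁻¹ * (u (x + ε * σ) - u x)) + 1 / q) * ε = -(u (x + ε * σ) - u x) + ε / q := by
      field_simp
    rw [this]; linarith
  · filter_upwards [self_mem_nhdsWithin] with ε hpos
    rw [mem_Ioi] at hpos
    rw [div_le_iff₀ hpos, mul_comm]
    exact h.le_of_mem_cthickening hΦ hL hpos.le hx' (lowEnd_mem hL.cthickening
      (Metric.self_subset_cthickening L (h.mem x hx')))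

theorem isEpiOn_cthickening (h : IsLowerArc Φ L c d u f) (hL : IsCompact L) (hc : Convex ℝ L)
    {c' d' y₀ ε : ℝ} (hcc : c ≤ c') (hdd : d' ≤ d) (hu : ∀ x ∈ Icc c d, u x ≤ y₀) (hy : y₀ ≤ 0) :
    IsEpiOn Φ (Metric.cthickening ε L) c' d' y₀ (lowEnd Φ (Metric.cthickening ε L)) := by
  intro x hx
  have hx' : x ∈ Icc c d := Icc_subset_Icc hcc hdd (Ioo_subset_Icc_self hx)
  have hs := Metric.self_subset_cthickening (δ := ε) L
  exact ⟨(lowEnd_le hL.cthickening (hs (h.mem x hx'))).trans (hu x hx'), fun y hyy =>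
    mem_iff_lowEnd_le hL.cthickening (hc.cthickening ε) (hs (h.top x hx')) (hyy.le.trans hy)⟩

end IsLowerArc

section

variable {L L' : Set Plane} {c d c₁ d₁ : ℝ} {u f u' f' : ℝ → ℝ}

/-- Where `L` and `L'` differ, their points lie below the level -η or over (c₁, d₁). A point of K^ε
outside the wider strip whose ε-neighbour w in `L` lies over (c₁, d₁) must be at height at least y₀,
so w is above -η and belongs to `L'` as well. Thus the parallel sets differ only inside the strip.
-/
theorem cthickening_diff_strip_subset (hΦ : IsFrame Φ) (hL : IsCompact L) (hL' : IsCompact L')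
    (cL' : Convex ℝ L') (h : IsLowerArc Φ L c d u f) (h' : IsLowerArc Φ L' c d u' f')
    (hout : L \ strip Φ c d 0 ⊆ L') (heq : ∀ x ∈ Icc c d, x ∉ Ioo c₁ d₁ → u' x = u x)
    {η c₂ d₂ y₀ ε : ℝ} (hε : 0 ≤ ε) (hη : ∀ x ∈ Icc c d, u' x ≤ -η) (hy : ε ≤ y₀ + η)
    (hc : c₂ ≤ c₁ - ε) (hd : d₁ + ε ≤ d₂) :
    Metric.cthickening ε L \ strip Φ c₂ d₂ y₀ ⊆ Metric.cthickening ε L' \ strip Φ c₂ d₂ y₀ := by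
  rintro p ⟨hp, hps⟩
  refine ⟨?_, hps⟩
  obtain ⟨z, rfl⟩ := Φ.surjective p
  obtain ⟨w, hw, hd'⟩ := (hΦ.mem_cthickening_iff hL hε).1 hp
  refine (hΦ.mem_cthickening_iff hL' hε).2 ⟨w, ?_, hd'⟩
  by_cases hws : Φ w ∈ strip Φ c d 0
  swap
  · exact hout ⟨hw, hws⟩
  obtain ⟨hw1, hw2⟩ := mem_strip.1 hws
  have hw1' := Ioo_subset_Icc_self hw1
  have hwle := h.supp w.1 hw1' w hw
  rw [sub_self, mul_zero, add_zero] at hwle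
  have hiff := h'.mem_iff cL' hw1' hw2.le
  refine hiff.2 ?_
  by_cases hx : w.1 ∈ Ioo c₁ d₁
  · have h1 : |z.1 - w.1| ≤ ε := abs_le_of_sq_le_sq (by nlinarith [sq_nonneg (z.2 - w.2)]) hε
    have h2 : |z.2 - w.2| ≤ ε := abs_le_of_sq_le_sq (by nlinarith [sq_nonneg (z.1 - w.1)]) hε
    rw [abs_le] at h1 h2
    have hz : y₀ ≤ z.2 := by
      by_contra! hlt
      exact hps (mem_strip.2 ⟨⟨by linarith [hx.1, h1.1], by linarith [hx.2, h1.2]⟩, hlt⟩)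
    linarith [hη _ hw1', h2.2]
  · rw [heq _ hw1' hx]; exact hwle

/-- The difference of the perimeters of two convex bodies that differ only by their lower
boundaries over `(c₁, d₁)`. -/
theorem minkowskiPerimeter_sub (hΦ : IsFrame Φ) (hL : IsCompact L) (cL : Convex ℝ L)
    (aL : 0 < area L) (hL' : IsCompact L') (cL' : Convex ℝ L') (aL' : 0 < area L')
    (h : IsLowerArc Φ L c d u f) (h' : IsLowerArc Φ L' c d u' f')
    (hout : L \ strip Φ c d 0 = L' \ strip Φ c d 0) (hc : c < c₁) (hd : d₁ < d)
    (heq : ∀ x ∈ Icc c d, x ∉ Ioo c₁ d₁ → u' x = u x)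
    (heqf : ∀ x ∈ Icc c d, x ∉ Ioo c₁ d₁ → f' x = f x) :
    minkowskiPerimeter L' - minkowskiPerimeter L =
      ∫ x in Ioo c d, (√(1 + f' x ^ 2) - √(1 + f x ^ 2)) := by
  obtain ⟨η, hη, hu⟩ := h.exists_neg
  obtain ⟨η', hη', hu'⟩ := h'.exists_neg
  -- Halfway between the axis and the higher of the two bounds for the arcs: the parallel sets are
  -- compared below this level, and ε must stay under its distance to -η and -η'.
  set y₀ := -(min η η' / 2) with hy₀
  have hmin : 0 < min η η' := lt_min hη hη'
  have hy₀η : y₀ + η > 0 := by simp only [hy₀]; linarith [min_le_left η η']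
  have hy₀η' : y₀ + η' > 0 := by simp only [hy₀]; linarith [min_le_right η η']
  have hy0 : y₀ ≤ 0 := by simp only [hy₀]; linarith
  set c₂ := (c + c₁) / 2 with hc₂
  set d₂ := (d₁ + d) / 2 with hd₂
  have hcc : c < c₂ ∧ c₂ < c₁ := by constructor <;> simp only [hc₂] <;> linarith
  have hdd : d₁ < d₂ ∧ d₂ < d := by constructor <;> simp only [hd₂] <;> linarith
  have hsub : Ioo c₂ d₂ ⊆ Ioo c d := Ioo_subset_Ioo hcc.1.le hdd.2.le
  have hshrink : ∀ g : ℝ → ℝ, (∀ x ∈ Icc c d, x ∉ Ioo c₁ d₁ → g x = 0) →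
      ∫ x in Ioo c d, g x = ∫ x in Ioo c₂ d₂, g x := by
    intro g hg
    refine (setIntegral_eq_of_subset_of_forall_sdiff_eq_zero (f := g) (μ := volume)
      measurableSet_Ioo hsub ?_)
    rintro x ⟨hx, hx2⟩
    refine hg x (Ioo_subset_Icc_self hx) fun hx1 => hx2 ?_
    exact ⟨hcc.2.trans hx1.1, hx1.2.trans hdd.1⟩
  set low := fun ε => lowEnd Φ (Metric.cthickening ε L) with hlow
  set low' := fun ε => lowEnd Φ (Metric.cthickening ε L') with hlow'
  have hepi : ∀ ε, IsEpiOn Φ (Metric.cthickening ε L) c₂ d₂ y₀ (low ε) := fun ε =>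
    h.isEpiOn_cthickening hL cL hcc.1.le hdd.2.le (fun x hx => by linarith [hu x hx]) hy0
  have hepi' : ∀ ε, IsEpiOn Φ (Metric.cthickening ε L') c₂ d₂ y₀ (low' ε) := fun ε =>
    h'.isEpiOn_cthickening hL' cL' hcc.1.le hdd.2.le (fun x hx => by linarith [hu' x hx]) hy0
  have hlowint : ∀ ε, IntegrableOn (low ε) (Ioo c₂ d₂) := fun ε =>
    integrableOn_of_isEpiOn hΦ hL.cthickening (hepi ε)
  have hlowint' : ∀ ε, IntegrableOn (low' ε) (Ioo c₂ d₂) := fun ε =>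
    integrableOn_of_isEpiOn hΦ hL'.cthickening (hepi' ε)
  have huint : IntegrableOn u (Ioo c₂ d₂) :=
    (integrableOn_of_isEpiOn hΦ hL (h.isEpiOn cL)).mono_set hsub
  have huint' : IntegrableOn u' (Ioo c₂ d₂) :=
    (integrableOn_of_isEpiOn hΦ hL' (h'.isEpiOn cL')).mono_set hsub
  have harea : area L' - area L = ∫ x in Ioo c₂ d₂, (u x - u' x) := by
    rw [area_sub_of_isEpiOn hΦ hL hL' (h.isEpiOn cL) (h'.isEpiOn cL') hout]
    exact hshrink _ fun x hx hx1 => by rw [heq x hx hx1, sub_self]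
  have hquot : ∀ᶠ ε : ℝ in 𝓝[>] 0,
      (∫ x in Ioo c₂ d₂, ((u' x - low' ε x) / ε - (u x - low ε x) / ε)) =
      (area (Metric.cthickening ε L') - area L') / ε
        - (area (Metric.cthickening ε L) - area L) / ε := by
    have hsmall : ∀ᶠ ε : ℝ in 𝓝[>] 0, ε < min (min (y₀ + η) (y₀ + η'))
        (min (c₁ - c₂) (d₂ - d₁)) :=
      eventually_nhdsWithin_of_eventually_nhds (eventually_lt_nhds (lt_min (lt_min hy₀η hy₀η')
        (lt_min (by linarith [hcc.2]) (by linarith [hdd.1]))))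
    filter_upwards [hsmall, self_mem_nhdsWithin] with ε hε hpos
    rw [mem_Ioi] at hpos
    simp only [lt_min_iff] at hε
    have hout2 : Metric.cthickening ε L \ strip Φ c₂ d₂ y₀ =
        Metric.cthickening ε L' \ strip Φ c₂ d₂ y₀ := by
      apply subset_antisymm
      · exact cthickening_diff_strip_subset hΦ hL hL' cL' h h'
          (hout ▸ sdiff_subset) heq hpos.le hu' hε.1.2.le (by linarith) (by linarith)
      · exact cthickening_diff_strip_subset hΦ hL' hL cL h' h
          (hout ▸ sdiff_subset) (fun x hx hx1 => (heq x hx hx1).symm) hpos.le hu hε.1.1.le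
          (by linarith) (by linarith)
    have h1 := area_sub_of_isEpiOn hΦ hL.cthickening hL'.cthickening (hepi ε) (hepi' ε) hout2
    have h2 : (area (Metric.cthickening ε L') - area L') / ε
        - (area (Metric.cthickening ε L) - area L) / ε =
        ((area (Metric.cthickening ε L') - area (Metric.cthickening ε L))
          - (area L' - area L)) / ε := by ring
    have i1 : Integrable (fun x => low ε x - low' ε x) (volume.restrict (Ioo c₂ d₂)) :=
      (hlowint ε).sub (hlowint' ε)
    have i2 : Integrable (fun x => u x - u' x) (volume.restrict (Ioo c₂ d₂)) := huint.sub huint'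
    rw [h2, h1, harea, ← integral_sub i1 i2,
      ← integral_div]
    congr 1
    ext x
    ring
  -- The speeds are dominated by √(1 + M²) with M bounding the slopes at the ends, and they converge
  -- at every common continuity point of the slopes.
  have hlim : Tendsto (fun ε : ℝ =>
      ∫ x in Ioo c₂ d₂, ((u' x - low' ε x) / ε - (u x - low ε x) / ε)) (𝓝[>] 0)
      (𝓝 (∫ x in Ioo c₂ d₂, (√(1 + f' x ^ 2) - √(1 + f x ^ 2)))) := by
    set M := max |f c| |f d|
    set M' := max |f' c| |f' d|
    apply tendsto_integral_filter_of_dominated_convergence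
      (fun _ => √(1 + M' ^ 2) + √(1 + M ^ 2))
    · exact Eventually.of_forall fun ε =>
        (((huint'.sub (hlowint' ε)).div_const ε).sub
          ((huint.sub (hlowint ε)).div_const ε)).aestronglyMeasurable
    · filter_upwards [self_mem_nhdsWithin] with ε hpos
      rw [mem_Ioi] at hpos
      filter_upwards [ae_restrict_mem measurableSet_Ioo] with x hx
      have hx' := Ioo_subset_Icc_self (hsub hx)
      have hbd : ∀ {L : Set Plane} {u f : ℝ → ℝ}, IsCompact L → IsLowerArc Φ L c d u f →
          |(u x - lowEnd Φ (Metric.cthickening ε L) x) / ε| ≤ √(1 + max |f c| |f d| ^ 2) := by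
        intro L u f hL h
        have hm := Metric.self_subset_cthickening (δ := ε) L (h.mem x hx')
        have h1 : 0 ≤ u x - lowEnd Φ (Metric.cthickening ε L) x :=
          sub_nonneg.2 (lowEnd_le hL.cthickening hm)
        have h2 := h.le_of_mem_cthickening hΦ hL hpos.le hx' (lowEnd_mem hL.cthickening hm)
        rw [abs_of_nonneg (div_nonneg h1 hpos.le), div_le_iff₀ hpos, mul_comm]
        refine h2.trans ?_
        have h3 : f x ^ 2 ≤ max |f c| |f d| ^ 2 :=
          sq_le_sq' (by linarith [(abs_le.1 (h.isSubgradOn.abs_le hx')).1])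
            (abs_le.1 (h.isSubgradOn.abs_le hx')).2
        gcongr
      exact (abs_sub _ _).trans (add_le_add (hbd hL' h') (hbd hL h))
    · exact integrable_const _
    · filter_upwards [ae_restrict_mem measurableSet_Ioo,
        ae_restrict_of_ae h.isSubgradOn.ae_continuousAt,
        ae_restrict_of_ae h'.isSubgradOn.ae_continuousAt] with x hx h1 h2
      exact (h'.tendsto_lowEnd hΦ hL' (hsub hx) (h2 (hsub hx))).sub
        (h.tendsto_lowEnd hΦ hL (hsub hx) (h1 (hsub hx)))
  rw [hshrink _ fun x hx hx1 => by rw [heqf x hx hx1, sub_self]]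
  exact tendsto_nhds_unique ((tendsto_minkowskiPerimeter hL' cL' aL').sub
    (tendsto_minkowskiPerimeter hL cL aL)) (hlim.congr' hquot)

end

end

/-! ### One-sided derivatives of the overlap with a moving disc -/

section

theorem norm_circlePoint (t : ℝ) : ‖circlePoint t‖ = 1 := by
  simp [circlePoint, EuclideanSpace.norm_eq]

theorem continuous_circlePoint : Continuous circlePoint := by
  unfold circlePoint
  exact (PiLp.continuous_toLp 2 _).comp (continuous_pi fun i => by fin_cases i <;> simp <;> fun_prop)

/-- The distance from the origin to the circle `∂B(b, R)` in the direction `θ`. -/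
def discRadius (b : Plane) (R θ : ℝ) : ℝ :=
  inner ℝ b (circlePoint θ) + √(R ^ 2 - ‖b‖ ^ 2 + inner ℝ b (circlePoint θ) ^ 2)

theorem mem_closedBall_iff_le_discRadius {b : Plane} {R : ℝ} (hb : ‖b‖ < R) {r θ : ℝ}
    (hr : 0 < r) : r • circlePoint θ ∈ Metric.closedBall b R ↔ r ≤ discRadius b R θ := by
  have hR : 0 < R := (norm_nonneg b).trans_lt hb
  have hQ : 0 ≤ R ^ 2 - ‖b‖ ^ 2 := by nlinarith [norm_nonneg b]
  set i := inner ℝ b (circlePoint θ) with hi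
  set q := √(R ^ 2 - ‖b‖ ^ 2 + i ^ 2) with hq
  have hq2 : q ^ 2 = R ^ 2 - ‖b‖ ^ 2 + i ^ 2 := Real.sq_sqrt (by positivity)
  have hq0 : 0 ≤ q := Real.sqrt_nonneg _
  have hiq : i ≤ q := Real.le_sqrt_of_sq_le (by linarith)
  have hd : dist (r • circlePoint θ) b ^ 2 = (r - i) ^ 2 + R ^ 2 - q ^ 2 := by
    rw [dist_eq_norm, norm_sub_sq_real, norm_smul, norm_circlePoint, Real.norm_of_nonneg hr.le,
      real_inner_smul_left, real_inner_comm, hq2, ← hi]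
    ring
  change _ ↔ r ≤ i + q
  rw [Metric.mem_closedBall]
  constructor
  · intro h
    have h1 : dist (r • circlePoint θ) b ^ 2 ≤ R ^ 2 := pow_le_pow_left₀ dist_nonneg h 2
    have h2 : (r - i) ^ 2 ≤ q ^ 2 := by linarith
    have := abs_le_of_sq_le_sq h2 hq0
    linarith [le_abs_self (r - i)]
  · intro h
    apply le_of_sq_le_sq _ hR.le
    have h2 : (r - i) ^ 2 ≤ q ^ 2 := sq_le_sq' (by linarith) (by linarith)
    linarith

theorem discRadius_pos {b : Plane} {R : ℝ} (hb : ‖b‖ < R) (θ : ℝ) : 0 < discRadius b R θ := by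
  have h : |inner ℝ b (circlePoint θ)| < √(R ^ 2 - ‖b‖ ^ 2 + inner ℝ b (circlePoint θ) ^ 2) := by
    rw [← Real.sqrt_sq_eq_abs]
    apply Real.sqrt_lt_sqrt (sq_nonneg _)
    nlinarith [norm_nonneg b]
  unfold discRadius
  linarith [neg_abs_le (inner ℝ b (circlePoint θ))]

/-- The point at distance `discRadius` lies on the circle of radius R about b; compare its distances
to b and to the origin. -/
theorem abs_discRadius_sub_le {b : Plane} {R : ℝ} (hb : ‖b‖ < R) (θ : ℝ) :
    |discRadius b R θ - R| ≤ ‖b‖ := by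
  have hρ := discRadius_pos hb θ
  set i := inner ℝ b (circlePoint θ) with hi
  have hQ : 0 ≤ R ^ 2 - ‖b‖ ^ 2 := by nlinarith [norm_nonneg b]
  have hd : ‖discRadius b R θ • circlePoint θ - b‖ = R := by
    have hR : 0 ≤ R := (norm_nonneg b).trans hb.le
    have h2 : √(R ^ 2 - ‖b‖ ^ 2 + i ^ 2) ^ 2 = R ^ 2 - ‖b‖ ^ 2 + i ^ 2 :=
      Real.sq_sqrt (by positivity)
    rw [← sq_eq_sq₀ (norm_nonneg _) hR, norm_sub_sq_real, norm_smul, norm_circlePoint,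
      Real.norm_of_nonneg hρ.le, real_inner_smul_left, real_inner_comm, ← hi, discRadius, ← hi]
    linear_combination h2
  have h1 := abs_norm_sub_norm_le (discRadius b R θ • circlePoint θ)
    (discRadius b R θ • circlePoint θ - b)
  rwa [hd, sub_sub_cancel, norm_smul, norm_circlePoint, mul_one, Real.norm_of_nonneg hρ.le] at h1

/-- Integration in polar coordinates. -/
theorem area_inter_closedBall {E : Set Plane} (hE : MeasurableSet E) {b : Plane} {R : ℝ}
    (hb : ‖b‖ < R) : area (E ∩ Metric.closedBall b R) =
      ∫ θ in Ioo (-Real.pi) Real.pi, ∫ r in (0 : ℝ)..discRadius b R θ,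
        r * E.indicator 1 (r • circlePoint θ) ∧
    IntegrableOn (fun θ => ∫ r in (0 : ℝ)..discRadius b R θ,
        r * E.indicator 1 (r • circlePoint θ)) (Ioo (-Real.pi) Real.pi) := by
  obtain ⟨Φ, hΦ, hΦe⟩ : ∃ Φ : (ℝ × ℝ) ≃L[ℝ] Plane, IsFrame Φ ∧ ∀ r θ : ℝ,
      Φ (r * Real.cos θ, r * Real.sin θ) = r • circlePoint θ := by
    refine ⟨frameOf !₂[0, 1] (by simp [EuclideanSpace.norm_eq]), isFrame_frameOf _ _, ?_⟩
    intro r θ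
    rw [frameOf_apply]
    ext i; fin_cases i <;> simp [circlePoint]
  set A := E ∩ Metric.closedBall b R with hA
  have hAm : MeasurableSet A := hE.inter Metric.isClosed_closedBall.measurableSet
  have hAm' : MeasurableSet (Φ ⁻¹' A) := hAm.preimage Φ.continuous.measurable
  set g : ℝ × ℝ → ℝ := fun p => p.1 * A.indicator 1 (p.1 • circlePoint p.2) with hg
  have hgm : Measurable g := by
    apply measurable_fst.mul
    apply (measurable_one.indicator hAm).comp
    exact (continuous_fst.smul (continuous_circlePoint.comp continuous_snd)).measurable
  have h1 : area A = ∫ p in polarCoord.target, g p := by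
    rw [hΦ.area_eq, ← integral_indicator_one hAm', ← integral_comp_polarCoord_symm]
    apply setIntegral_congr_fun polarCoord.open_target.measurableSet
    rintro ⟨r, θ⟩ hp
    simp only [hg, smul_eq_mul]
    congr 1
    rw [← hΦe]
    rfl
  have hinner : ∀ θ, ∫ r in Ioi (0 : ℝ), g (r, θ) = ∫ r in (0 : ℝ)..discRadius b R θ,
      r * E.indicator 1 (r • circlePoint θ) := by
    intro θ
    rw [intervalIntegral.integral_of_le (discRadius_pos hb θ).le,
      ← integral_indicator measurableSet_Ioi, ← integral_indicator measurableSet_Ioc]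
    congr 1
    ext r
    by_cases hr : 0 < r
    · rw [indicator_of_mem (mem_Ioi.2 hr)]
      have hiff := mem_closedBall_iff_le_discRadius hb hr (θ := θ)
      by_cases hr2 : r ≤ discRadius b R θ
      · rw [indicator_of_mem (show r ∈ Ioc _ _ from ⟨hr, hr2⟩)]
        simp only [hg]
        congr 1
        by_cases hm : r • circlePoint θ ∈ E
        · rw [indicator_of_mem hm, indicator_of_mem (show _ ∈ A from ⟨hm, hiff.2 hr2⟩)]
        · rw [indicator_of_notMem hm, indicator_of_notMem fun h => hm h.1]
      · rw [indicator_of_notMem fun h : r ∈ Ioc _ _ => hr2 h.2]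
        simp only [hg]
        rw [indicator_of_notMem fun h : _ ∈ A => hr2 (hiff.1 h.2), mul_zero]
    · rw [indicator_of_notMem (mt mem_Ioi.1 hr), indicator_of_notMem fun h : r ∈ Ioc _ _ => hr h.1]
  -- The integrand is bounded and vanishes for r > 2R, because the radius of the disc in any
  -- direction is at most R + ‖b‖ < 2R.
  have hgi : IntegrableOn g (Ioi (0 : ℝ) ×ˢ Ioo (-Real.pi) Real.pi) (volume.prod volume) := by
    have hsub : IntegrableOn g (Ioc (0 : ℝ) (2 * R) ×ˢ Ioo (-Real.pi) Real.pi)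
        (volume.prod volume) := by
      refine Measure.integrableOn_of_bounded (M := 2 * R) ?_ hgm.aestronglyMeasurable ?_
      · rw [Measure.prod_prod]; exact ENNReal.mul_ne_top measure_Ioc_lt_top.ne measure_Ioo_lt_top.ne
      · filter_upwards [ae_restrict_mem (measurableSet_Ioc.prod measurableSet_Ioo)] with p hp
        simp only [hg]
        rw [norm_mul, Real.norm_of_nonneg hp.1.1.le]
        have : ‖A.indicator (1 : Plane → ℝ) (p.1 • circlePoint p.2)‖ ≤ 1 := by
          by_cases hm : p.1 • circlePoint p.2 ∈ A
          · rw [indicator_of_mem hm]; simp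
          · rw [indicator_of_notMem hm]; simp
        calc p.1 * _ ≤ (2 * R) * 1 := by
              apply mul_le_mul hp.1.2 this (norm_nonneg _); linarith [norm_nonneg b]
          _ = 2 * R := mul_one _
    refine hsub.of_forall_sdiff_eq_zero (measurableSet_Ioi.prod measurableSet_Ioo) ?_
    rintro ⟨r, θ⟩ ⟨⟨hr, hθ⟩, h2⟩
    simp only [hg]
    rw [indicator_of_notMem, mul_zero]
    intro hm
    have h3 := (mem_closedBall_iff_le_discRadius hb hr).1 hm.2
    have h4 := (abs_le.1 (abs_discRadius_sub_le hb θ)).2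
    exact h2 ⟨⟨hr, by simp only; linarith⟩, hθ⟩
  have hgi' : Integrable g ((volume.restrict (Ioi (0 : ℝ))).prod
      (volume.restrict (Ioo (-Real.pi) Real.pi))) := by
    rw [Measure.prod_restrict]; exact hgi
  constructor
  · rw [h1, polarCoord_target, Measure.volume_eq_prod, ← Measure.prod_restrict,
      integral_prod_symm _ hgi']
    simp_rw [hinner]
  · have := hgi'.integral_prod_right
    simp_rw [hinner] at this
    exact this

/-- To first order the circle moves outward in direction θ by the growth of the radius plus the
component of the velocity of the centre; the terms under the root involving b are of second order.
-/
theorem hasDerivAt_discRadius {b : ℝ → Plane} {R : ℝ → ℝ} {β : Plane} {ρ : ℝ}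
    (hb : HasDerivAt b β 0) (hR : HasDerivAt R ρ 0) (hb0 : b 0 = 0) (hR0 : R 0 = 1) (θ : ℝ) :
    HasDerivAt (fun t => discRadius (b t) (R t) θ) (ρ + inner ℝ β (circlePoint θ)) 0 := by
  have h1 : HasDerivAt (fun t => inner ℝ (b t) (circlePoint θ)) (inner ℝ β (circlePoint θ)) 0 := by
    simpa using hb.inner ℝ (hasDerivAt_const (0 : ℝ) (circlePoint θ))
  have h2 : HasDerivAt (fun t => ‖b t‖ ^ 2) 0 0 := by
    have := hb.norm_sq
    rwa [hb0, inner_zero_left, mul_zero] at this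
  have h3 : HasDerivAt (fun t => R t ^ 2 - ‖b t‖ ^ 2 + inner ℝ (b t) (circlePoint θ) ^ 2)
      (2 * ρ) 0 := by
    have h : HasDerivAt (fun t => R t ^ 2 - ‖b t‖ ^ 2 + inner ℝ (b t) (circlePoint θ) ^ 2) _ 0 :=
      ((hR.pow 2).sub h2).add (h1.pow 2)
    exact h.congr_deriv (by simp [hb0, hR0])
  have h4 := h3.sqrt (by rw [hb0, hR0]; simp)
  have h5 : HasDerivAt (fun t => discRadius (b t) (R t) θ) _ 0 := h1.add h4
  refine h5.congr_deriv ?_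
  simp [hb0, hR0]
  ring

theorem integral_mul_one_add (χ s : ℝ) : ∫ r in (1 : ℝ)..1 + s, r * χ = χ * (s + s ^ 2 / 2) := by
  rw [intervalIntegral.integral_mul_const, integral_id]
  ring

theorem intervalIntegrable_mul_indicator {E : Set Plane} (hE : MeasurableSet E) (θ x y : ℝ) :
    IntervalIntegrable (fun r : ℝ => r * E.indicator 1 (r • circlePoint θ)) volume x y := by
  have hm : Measurable fun r : ℝ => r * E.indicator (1 : Plane → ℝ) (r • circlePoint θ) := by
    apply measurable_id.mul
    apply (measurable_one.indicator hE).comp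
    exact (continuous_id.smul continuous_const).measurable
  refine (continuous_id.intervalIntegrable x y).mono_fun hm.aestronglyMeasurable
    (Eventually.of_forall fun r => ?_)
  change ‖r * E.indicator (1 : Plane → ℝ) (r • circlePoint θ)‖ ≤ ‖r‖
  by_cases h : r • circlePoint θ ∈ E
  · rw [indicator_of_mem h]; simp
  · rw [indicator_of_notMem h]; simp

theorem abs_integral_mul_indicator_le {E : Set Plane} (θ : ℝ) {s : ℝ} (hs : |s| ≤ 1) :
    |∫ r in (1 : ℝ)..1 + s, r * E.indicator 1 (r • circlePoint θ)| ≤ 2 * |s| := by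
  have h : ∀ r ∈ Set.uIoc 1 (1 + s), ‖r * E.indicator (1 : Plane → ℝ) (r • circlePoint θ)‖ ≤ 2 := by
    intro r hr
    have hr' := uIoc_subset_uIcc hr
    rw [uIcc_eq_union, mem_union] at hr'
    rw [abs_le] at hs
    have h1 : |r| ≤ 2 := by
      rw [abs_le]
      rcases hr' with h | h <;> constructor <;> linarith [h.1, h.2]
    rw [norm_mul]
    have : ‖E.indicator (1 : Plane → ℝ) (r • circlePoint θ)‖ ≤ 1 := by
      by_cases h : r • circlePoint θ ∈ E
      · rw [indicator_of_mem h]; simp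
      · rw [indicator_of_notMem h]; simp
    calc ‖r‖ * _ ≤ 2 * 1 := mul_le_mul h1 this (norm_nonneg _) zero_le_two
      _ = 2 := mul_one _
  simpa using intervalIntegral.norm_integral_le_of_norm_le_const h

/-- An outward displacement meets only the value χp of the indicator beyond the circle, an inward
one only the value χm inside it. The two maxima treat both signs of s in one formula. -/
theorem eventually_integral_eq {E : Set Plane} {θ χp χm : ℝ}
    (hp : ∀ᶠ r : ℝ in 𝓝[>] 1, E.indicator 1 (r • circlePoint θ) = χp)
    (hm : ∀ᶠ r : ℝ in 𝓝[<] 1, E.indicator 1 (r • circlePoint θ) = χm) :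
    ∀ᶠ s : ℝ in 𝓝 0, ∫ r in (1 : ℝ)..1 + s, r * E.indicator 1 (r • circlePoint θ) =
      (χp * max s 0 - χm * max (-s) 0) * (1 + s / 2) := by
  rw [eventually_nhdsWithin_iff] at hp hm
  obtain ⟨δ, hδ, h⟩ := Metric.eventually_nhds_iff.1 (hp.and hm)
  refine Metric.eventually_nhds_iff.2 ⟨δ, hδ, fun s hs => ?_⟩
  rw [Real.dist_eq, sub_zero] at hs
  rcases le_total 0 s with h0 | h0
  · rw [max_eq_left h0, max_eq_right (by linarith : -s ≤ 0), mul_zero, sub_zero]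
    have : ∫ r in (1 : ℝ)..1 + s, r * E.indicator 1 (r • circlePoint θ) =
        ∫ r in (1 : ℝ)..1 + s, r * χp := by
      apply intervalIntegral.integral_congr_ae
      refine Eventually.of_forall fun r hr => ?_
      rw [uIoc_of_le (by linarith)] at hr
      rw [(h (y := r) ?_).1 hr.1]
      rw [Real.dist_eq, abs_of_pos (by linarith [hr.1])]
      linarith [hr.2, le_abs_self s]
    rw [this, integral_mul_one_add]; ring
  · rw [max_eq_right h0, max_eq_left (by linarith : 0 ≤ -s), mul_zero, zero_sub]
    have : ∫ r in (1 : ℝ)..1 + s, r * E.indicator 1 (r • circlePoint θ) =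
        ∫ r in (1 : ℝ)..1 + s, r * χm := by
      apply intervalIntegral.integral_congr_ae
      filter_upwards [(countable_singleton (1 : ℝ)).ae_notMem volume] with r hne hr
      rw [uIoc_of_ge (by linarith)] at hr
      rw [(h (y := r) ?_).2 (lt_of_le_of_ne hr.2 hne)]
      rw [Real.dist_eq, abs_sub_comm, abs_of_nonneg (by linarith [hr.2])]
      linarith [hr.1, neg_abs_le s]
    rw [this, integral_mul_one_add]; ring

theorem tendsto_integral_div {E : Set Plane} {θ χp χm n : ℝ} {s : ℝ → ℝ}
    (hp : ∀ᶠ r : ℝ in 𝓝[>] 1, E.indicator 1 (r • circlePoint θ) = χp)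
    (hm : ∀ᶠ r : ℝ in 𝓝[<] 1, E.indicator 1 (r • circlePoint θ) = χm)
    (hs : HasDerivAt s n 0) (hs0 : s 0 = 0) :
    Tendsto (fun t => (∫ r in (1 : ℝ)..1 + s t, r * E.indicator 1 (r • circlePoint θ)) / t)
      (𝓝[>] 0) (𝓝 (χp * max n 0 - χm * max (-n) 0)) := by
  have hs1 : Tendsto s (𝓝[>] 0) (𝓝 0) := by
    have := hs.continuousAt.tendsto
    rw [hs0] at this
    exact tendsto_nhdsWithin_of_tendsto_nhds this
  have hs2 : Tendsto (fun t => t⁻¹ * s t) (𝓝[>] 0) (𝓝 n) := by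
    simpa [hs0] using hs.tendsto_slope_zero_right
  have h1 : Tendsto (fun t => (χp * max (t⁻¹ * s t) 0 - χm * max (-(t⁻¹ * s t)) 0) *
      (1 + s t / 2)) (𝓝[>] 0) (𝓝 ((χp * max n 0 - χm * max (-n) 0) * (1 + 0 / 2))) :=
    (((hs2.max tendsto_const_nhds).const_mul χp).sub
      ((hs2.neg.max tendsto_const_nhds).const_mul χm)).mul ((hs1.div_const 2).const_add 1)
  rw [zero_div, add_zero, mul_one] at h1
  refine h1.congr' ?_
  filter_upwards [hs1.eventually (eventually_integral_eq hp hm), self_mem_nhdsWithin] with t ht ht0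
  rw [mem_Ioi] at ht0
  rw [ht]
  have e1 : max (t⁻¹ * s t) 0 = max (s t) 0 / t := by
    rw [max_div_div_right ht0.le (s t) 0 |>.symm, zero_div, div_eq_inv_mul]
  have e2 : max (-(t⁻¹ * s t)) 0 = max (-s t) 0 / t := by
    rw [max_div_div_right ht0.le (-s t) 0 |>.symm, zero_div, neg_div, div_eq_inv_mul]
  rw [e1, e2]
  field_simp

/-- One-sided derivative of the area that a moving disc cuts out of a set whose indicator
function has one-sided limits along the rays at the unit circle. -/
theorem tendsto_area_inter_closedBall {E : Set Plane} (hE : MeasurableSet E) {χp χm : ℝ → ℝ}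
    (hχ : ∀ᵐ θ, θ ∈ Ioo (-Real.pi) Real.pi →
      (∀ᶠ r : ℝ in 𝓝[>] 1, E.indicator 1 (r • circlePoint θ) = χp θ) ∧
      ∀ᶠ r : ℝ in 𝓝[<] 1, E.indicator 1 (r • circlePoint θ) = χm θ)
    {b : ℝ → Plane} {R : ℝ → ℝ} {β : Plane} {ρ : ℝ}
    (hb : HasDerivAt b β 0) (hR : HasDerivAt R ρ 0) (hb0 : b 0 = 0) (hR0 : R 0 = 1) :
    Tendsto (fun t => (area (E ∩ Metric.closedBall (b t) (R t)) -
        area (E ∩ Metric.closedBall 0 1)) / t) (𝓝[>] 0)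
      (𝓝 (∫ θ in Ioo (-Real.pi) Real.pi, (χp θ * max (ρ + inner ℝ β (circlePoint θ)) 0 -
        χm θ * max (-(ρ + inner ℝ β (circlePoint θ))) 0))) := by
  have hb1 : Tendsto b (𝓝[>] 0) (𝓝 0) := by
    have := hb.continuousAt.tendsto
    rw [hb0] at this
    exact tendsto_nhdsWithin_of_tendsto_nhds this
  have hR1 : Tendsto R (𝓝[>] 0) (𝓝 1) := by
    have := hR.continuousAt.tendsto
    rw [hR0] at this
    exact tendsto_nhdsWithin_of_tendsto_nhds this
  have hlt : ∀ᶠ t in 𝓝[>] (0 : ℝ), ‖b t‖ < R t :=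
    (hb1.norm.eventually_lt hR1 (by simp))
  have hsmall : ∀ᶠ t in 𝓝[>] (0 : ℝ), ‖b t‖ + |R t - 1| ≤ 1 := by
    have h1 : Tendsto (fun t => ‖b t‖ + |R t - 1|) (𝓝[>] 0) (𝓝 (‖(0 : Plane)‖ + |(1 : ℝ) - 1|)) :=
      hb1.norm.add (hR1.sub_const 1).abs
    exact h1.eventually (eventually_le_nhds (by simp))
  -- A bound on the displacement of the circle per unit t, uniform in θ, for dominated convergence.
  have hbd : ∀ᶠ t in 𝓝[>] (0 : ℝ), (‖b t‖ + |R t - 1|) / t ≤ ‖β‖ + |ρ| + 1 := by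
    have h1 : Tendsto (fun t => t⁻¹ • b t) (𝓝[>] 0) (𝓝 β) := by
      simpa [hb0] using hb.tendsto_slope_zero_right
    have h2 : Tendsto (fun t => t⁻¹ • (R t - 1)) (𝓝[>] 0) (𝓝 ρ) := by
      simpa [hR0] using hR.tendsto_slope_zero_right
    have h3 := (h1.norm.add h2.abs).eventually (eventually_le_nhds (lt_add_one (‖β‖ + |ρ|)))
    filter_upwards [h3, self_mem_nhdsWithin] with t ht ht0
    rw [mem_Ioi] at ht0
    rw [norm_smul, smul_eq_mul, abs_mul, norm_inv, Real.norm_of_nonneg ht0.le,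
      abs_of_pos (inv_pos.2 ht0)] at ht
    rw [add_div, div_eq_inv_mul, div_eq_inv_mul]
    exact ht
  have hball0 := area_inter_closedBall hE (b := 0) (R := 1) (by simp)
  have hrad0 : ∀ θ, discRadius 0 1 θ = 1 := fun θ => by simp [discRadius]
  have hrw : ∀ᶠ t in 𝓝[>] (0 : ℝ), ∫ θ in Ioo (-Real.pi) Real.pi,
      (∫ r in (1 : ℝ)..1 + (discRadius (b t) (R t) θ - 1),
        r * E.indicator 1 (r • circlePoint θ)) / t =
      (area (E ∩ Metric.closedBall (b t) (R t)) - area (E ∩ Metric.closedBall 0 1)) / t := by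
    filter_upwards [hlt] with t ht
    have h1 := area_inter_closedBall hE ht
    rw [h1.1, hball0.1, ← integral_sub h1.2 hball0.2, ← integral_div]
    congr 1
    ext θ
    rw [hrad0, add_sub_cancel, intervalIntegral.integral_interval_sub_left
      (intervalIntegrable_mul_indicator hE θ _ _) (intervalIntegrable_mul_indicator hE θ _ _)]
  refine Tendsto.congr' hrw ?_
  apply tendsto_integral_filter_of_dominated_convergence (fun _ => 2 * (‖β‖ + |ρ| + 1))
  · filter_upwards [hlt] with t ht
    have h1 := area_inter_closedBall hE ht
    have h2 := ((h1.2.sub hball0.2).div_const t).aestronglyMeasurable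
    refine h2.congr (Eventually.of_forall fun θ => ?_)
    simp only [Pi.sub_apply]
    rw [hrad0, add_sub_cancel, intervalIntegral.integral_interval_sub_left
      (intervalIntegrable_mul_indicator hE θ _ _) (intervalIntegrable_mul_indicator hE θ _ _)]
  · filter_upwards [hlt, hsmall, hbd, self_mem_nhdsWithin] with t h1 h2 h3 ht0
    rw [mem_Ioi] at ht0
    refine Eventually.of_forall fun θ => ?_
    have h4 : |discRadius (b t) (R t) θ - 1| ≤ ‖b t‖ + |R t - 1| := by
      have h5 := abs_discRadius_sub_le h1 θ
      have h6 := abs_sub_le (discRadius (b t) (R t) θ) (R t) 1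
      linarith
    have h5 := abs_integral_mul_indicator_le (E := E) θ (h4.trans h2)
    rw [norm_div, Real.norm_of_nonneg ht0.le, div_le_iff₀ ht0]
    rw [div_le_iff₀ ht0] at h3
    rw [Real.norm_eq_abs]
    linarith
  · exact integrable_const _
  · filter_upwards [ae_restrict_mem measurableSet_Ioo, ae_restrict_of_ae hχ] with θ hθ h
    exact tendsto_integral_div (h hθ).1 (h hθ).2
      ((hasDerivAt_discRadius hb hR hb0 hR0 θ).sub_const 1) (by rw [hb0, hR0, hrad0]; simp)

end

section

variable {Φ : (ℝ × ℝ) ≃L[ℝ] Plane}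

/-! ### Convex sets along rays -/

/-- A convex set is star-shaped about its interior point 0: if the ray meets the boundary at the
circle, it is inside before and outside after, since a point of `K` further out would make the
boundary point interior. So the outer limit of the indicator sees the interior and the inner limit
sees `K`. The hypothesis keeps the circle point off the boundary of `A`. -/
theorem indicator_ray_eventually {K A : Set Plane} (hK : IsCompact K) (hc : Convex ℝ K)
    (h0 : (0 : Plane) ∈ interior K) {θ : ℝ}
    (hA : A ∈ 𝓝 (circlePoint θ) ∨ Aᶜ ∈ 𝓝 (circlePoint θ)) :
    (∀ᶠ r : ℝ in 𝓝[>] 1, (K ∩ A).indicator (1 : Plane → ℝ) (r • circlePoint θ) =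
      (interior K ∩ A).indicator 1 (circlePoint θ)) ∧
    ∀ᶠ r : ℝ in 𝓝[<] 1, (K ∩ A).indicator (1 : Plane → ℝ) (r • circlePoint θ) =
      (K ∩ A).indicator 1 (circlePoint θ) := by
  set e := circlePoint θ with he
  have hcont : Tendsto (fun r : ℝ => r • e) (𝓝 1) (𝓝 e) := by
    have h1 : Continuous fun r : ℝ => r • e := by fun_prop
    simpa using h1.tendsto 1
  have hout : ∀ X : Set Plane, X ∈ 𝓝 e → ∀ᶠ r : ℝ in 𝓝 1, r • e ∈ X := fun X hX =>
    hcont.eventually hX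
  rcases hA with hA | hA
  swap
  · have hn : ∀ X : Set Plane, e ∉ X ∩ A := fun X h => mem_of_mem_nhds hA h.2
    have h1 : ∀ᶠ r : ℝ in 𝓝 1, (K ∩ A).indicator (1 : Plane → ℝ) (r • e) = 0 := by
      filter_upwards [hout _ hA] with r hr
      exact indicator_of_notMem (fun h => hr h.2) _
    rw [indicator_of_notMem (hn _), indicator_of_notMem (hn _)]
    exact ⟨eventually_nhdsWithin_of_eventually_nhds h1,
      eventually_nhdsWithin_of_eventually_nhds h1⟩
  have heA : e ∈ A := mem_of_mem_nhds hA
  have hrA := hout A hA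
  by_cases heK : e ∈ K
  swap
  · have h1 : ∀ᶠ r : ℝ in 𝓝 1, (K ∩ A).indicator (1 : Plane → ℝ) (r • e) = 0 := by
      filter_upwards [hout _ (hK.isClosed.isOpen_compl.mem_nhds heK)] with r hr
      exact indicator_of_notMem (fun h => hr h.1) _
    rw [indicator_of_notMem (fun h => heK (interior_subset h.1)),
      indicator_of_notMem (fun h => heK h.1)]
    exact ⟨eventually_nhdsWithin_of_eventually_nhds h1,
      eventually_nhdsWithin_of_eventually_nhds h1⟩
  constructor
  · by_cases hei : e ∈ interior K
    · rw [indicator_of_mem (show e ∈ interior K ∩ A from ⟨hei, heA⟩)]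
      apply eventually_nhdsWithin_of_eventually_nhds
      filter_upwards [hrA, hout _ (isOpen_interior.mem_nhds hei)] with r h1 h2
      exact indicator_of_mem (show r • e ∈ K ∩ A from ⟨interior_subset h2, h1⟩) _
    · rw [indicator_of_notMem fun h => hei h.1]
      filter_upwards [self_mem_nhdsWithin] with r hr
      rw [mem_Ioi] at hr
      apply indicator_of_notMem
      intro h
      apply hei
      have h2 := hc.combo_interior_self_mem_interior h0 h.1
        (a := 1 - 1 / r) (b := 1 / r) (by rw [sub_pos, div_lt_one] <;> linarith) (by positivity)
        (by ring)
      rwa [smul_zero, zero_add, smul_smul, one_div_mul_cancel (by linarith), one_smul] at h2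
  · rw [indicator_of_mem (show e ∈ K ∩ A from ⟨heK, heA⟩)]
    have h01 : Ioo (0 : ℝ) 1 ∈ 𝓝[<] (1 : ℝ) := Ioo_mem_nhdsLT zero_lt_one
    filter_upwards [h01, mem_nhdsWithin_of_mem_nhds hrA] with r hr h1
    refine indicator_of_mem (show r • e ∈ K ∩ A from ⟨?_, h1⟩) _
    have := hc (interior_subset h0) heK (a := 1 - r) (b := r) (by linarith [hr.2]) hr.1.le (by ring)
    rwa [smul_zero, zero_add] at this

theorem countable_cos_eq (k : ℝ) : {θ : ℝ | Real.cos θ = k}.Countable := by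
  rcases eq_empty_or_nonempty {θ : ℝ | Real.cos θ = k} with h | ⟨θ₀, h₀⟩
  · rw [h]; exact countable_empty
  have : {θ : ℝ | Real.cos θ = k} ⊆ (range fun m : ℤ => 2 * m * Real.pi + θ₀) ∪
      range fun m : ℤ => 2 * m * Real.pi - θ₀ := by
    intro θ hθ
    rw [mem_ofPred_eq] at hθ h₀
    rw [← h₀, eq_comm, Real.cos_eq_cos_iff] at hθ
    obtain ⟨m, hm | hm⟩ := hθ
    · exact Or.inl ⟨m, hm.symm⟩
    · exact Or.inr ⟨m, hm.symm⟩
  exact ((countable_range _).union (countable_range _)).mono this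

theorem inner_circlePoint (v : Plane) (θ : ℝ) :
    inner ℝ v (circlePoint θ) = v 0 * Real.cos θ + v 1 * Real.sin θ := by
  simp [circlePoint, PiLp.inner_apply, Fin.sum_univ_two]
  ring

/-- A line meets the unit circle in a set of angles that is countable. -/
theorem countable_inner_circlePoint_eq {v : Plane} {k : ℝ} (h : v ≠ 0 ∨ k ≠ 0) :
    {θ : ℝ | inner ℝ v (circlePoint θ) = k}.Countable := by
  by_cases hv : v = 0
  · have hk := h.resolve_left (not_not.2 hv)
    convert countable_empty
    ext θ
    simp [hv, hk.symm]
  set z : ℂ := ⟨v 0, v 1⟩ with hz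
  have hz0 : z ≠ 0 := by
    intro h0
    apply hv
    have h1 := congrArg Complex.re h0
    have h2 := congrArg Complex.im h0
    ext i; fin_cases i
    · exact h1
    · exact h2
  have hn : ‖z‖ ≠ 0 := norm_ne_zero_iff.2 hz0
  have hre : v 0 = ‖z‖ * Real.cos z.arg := (Complex.norm_mul_cos_arg z).symm
  have him : v 1 = ‖z‖ * Real.sin z.arg := (Complex.norm_mul_sin_arg z).symm
  have hsub : {θ : ℝ | inner ℝ v (circlePoint θ) = k} =
      (fun θ => θ - z.arg) ⁻¹' {θ : ℝ | Real.cos θ = k / ‖z‖} := by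
    ext θ
    simp only [mem_ofPred_eq, mem_preimage]
    rw [inner_circlePoint, hre, him, Real.cos_sub, eq_div_iff hn]
    constructor <;> intro h <;> linarith
  rw [hsub]
  exact (countable_cos_eq _).preimage (sub_left_injective)

theorem ae_inner_circlePoint_ne {v : Plane} {k : ℝ} (h : v ≠ 0 ∨ k ≠ 0) :
    ∀ᵐ θ : ℝ, inner ℝ v (circlePoint θ) ≠ k :=
  (countable_inner_circlePoint_eq h).ae_notMem volume

theorem IsFrame.inner_eq (hΦ : IsFrame Φ) (z w : ℝ × ℝ) :
    inner ℝ (Φ z) (Φ w) = z.1 * w.1 + z.2 * w.2 := by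
  have h1 := norm_add_sq_real (Φ z) (Φ w)
  rw [← map_add, hΦ.norm_sq, hΦ.norm_sq, hΦ.norm_sq] at h1
  simp only [Prod.fst_add, Prod.snd_add] at h1
  linarith

theorem IsFrame.symm_fst (hΦ : IsFrame Φ) (p : Plane) :
    (Φ.symm p).1 = inner ℝ (Φ (1, 0)) p := by
  obtain ⟨z, rfl⟩ := Φ.surjective p
  rw [hΦ.inner_eq]; simp

theorem IsFrame.symm_snd (hΦ : IsFrame Φ) (p : Plane) :
    (Φ.symm p).2 = inner ℝ (Φ (0, 1)) p := by
  obtain ⟨z, rfl⟩ := Φ.surjective p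
  rw [hΦ.inner_eq]; simp

/-- Almost every point of the unit circle is not on the boundary of a given strip. -/
theorem ae_strip_mem_nhds (hΦ : IsFrame Φ) (c d : ℝ) : ∀ᵐ θ : ℝ,
    (strip Φ c d 0)ᶜ ∈ 𝓝 (circlePoint θ) ∨ (strip Φ c d 0)ᶜᶜ ∈ 𝓝 (circlePoint θ) := by
  have h1 : Φ (1, 0) ≠ 0 := by
    rw [Ne, map_eq_zero_iff Φ Φ.injective]; simp
  have h2 : Φ (0, 1) ≠ 0 := by
    rw [Ne, map_eq_zero_iff Φ Φ.injective]; simp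
  filter_upwards [ae_inner_circlePoint_ne (k := c) (Or.inl h1),
    ae_inner_circlePoint_ne (k := d) (Or.inl h1), ae_inner_circlePoint_ne (k := 0) (Or.inl h2)]
    with θ hc hd h0
  rw [← hΦ.symm_fst] at hc hd
  rw [← hΦ.symm_snd] at h0
  by_cases hm : circlePoint θ ∈ strip Φ c d 0
  · right
    rw [compl_compl]
    exact (isOpen_strip Φ c d 0).mem_nhds hm
  left
  have hopen : IsOpen (Φ.symm ⁻¹' {z : ℝ × ℝ | z.1 < c ∨ d < z.1 ∨ 0 < z.2}) := by
    apply IsOpen.preimage Φ.symm.continuous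
    exact (isOpen_lt continuous_fst continuous_const).union
      ((isOpen_lt continuous_const continuous_fst).union
        (isOpen_lt continuous_const continuous_snd))
  refine mem_of_superset (hopen.mem_nhds ?_) ?_
  · simp only [mem_preimage, mem_ofPred_eq]
    by_contra! h
    apply hm
    exact ⟨⟨lt_of_le_of_ne h.1 hc.symm, lt_of_le_of_ne h.2.1 hd⟩, lt_of_le_of_ne h.2.2 h0⟩
  · rintro p hp ⟨⟨h3, h4⟩, h5⟩
    rw [mem_Iio] at h5
    rcases hp with hp | hp | hp
    · exact (lt_asymm h3 hp)
    · exact (lt_asymm h4 hp)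
    · exact (lt_asymm h5 hp)

/-- The barycentre of a convex body is an interior point. -/
theorem zero_mem_interior {K : Set Plane} (hK : IsCompact K) (hc : Convex ℝ K) (ha : 0 < area K)
    (hb : barycentre K = 0) : (0 : Plane) ∈ interior K := by
  by_contra h0
  -- If 0 is not interior, a linear functional is negative on the interior, whereas its integral
  -- over `K` is 0.
  obtain ⟨ℓ, hℓ⟩ := geometric_hahn_banach_open_point hc.interior isOpen_interior h0
  rw [map_zero] at hℓ
  have hint : ∫ x in K, ℓ x = 0 := by
    have := ℓ.integral_comp_comm (integrableOn_id hK)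
    rw [setIntegral_id_eq_zero_of_barycentre ha hb, map_zero] at this
    exact this
  have hKi : interior K =ᵐ[volume] K := by
    have h1 := hc.addHaar_frontier volume
    refine (ae_eq_set.2 ⟨?_, ?_⟩)
    · rw [sdiff_eq_empty.2 interior_subset]; simp
    · exact measure_mono_null (fun x hx => show x ∈ frontier K from ⟨subset_closure hx.1, hx.2⟩) h1
  rw [← setIntegral_congr_set hKi] at hint
  have hii : IntegrableOn ℓ (interior K) :=
    (ℓ.continuous.continuousOn.integrableOn_compact hK).mono_set interior_subset
  have h2 : ∫ x in interior K, -ℓ x = 0 := by rw [integral_neg, hint, neg_zero]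
  rw [setIntegral_eq_zero_iff_of_nonneg_ae] at h2
  · have h3 : volume (interior K) = 0 := by
      have h4 : ∀ᵐ x ∂volume.restrict (interior K), False := by
        filter_upwards [h2, ae_restrict_mem isOpen_interior.measurableSet] with x hx hm
        have := hℓ x hm
        simp at hx
        linarith
      rw [eventually_false_iff_eq_bot, ae_eq_bot, Measure.restrict_eq_zero] at h4
      exact h4
    exact (isOpen_interior.measure_pos volume (interior_nonempty_of_area_pos hc ha)).ne' h3
  · filter_upwards [ae_restrict_mem isOpen_interior.measurableSet] with x hm
    simpa using (hℓ x hm).le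
  · exact hii.neg

/-! ### The inner and outer parts of the circle -/

theorem circlePoint_periodic : Function.Periodic circlePoint (2 * Real.pi) := by
  intro t
  simp [circlePoint]

/-- Polar coordinates use the angles (-π, π), the definition of ∂B^IN and ∂B^OUT uses (0, 2π];
periodicity identifies the integrals. -/
theorem setIntegral_circle_eq {g : ℝ → ℝ} (hg : Function.Periodic g (2 * Real.pi)) :
    ∫ θ in Ioo (-Real.pi) Real.pi, g θ = ∫ θ in Ioc 0 (2 * Real.pi), g θ := by
  have hpi := Real.pi_pos
  rw [← integral_Ioc_eq_integral_Ioo, ← intervalIntegral.integral_of_le (by linarith),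
    ← intervalIntegral.integral_of_le (by linarith)]
  have := hg.intervalIntegral_add_eq (-Real.pi) 0
  rw [zero_add] at this
  rw [← this]
  congr 1
  ring

theorem setIntegral_circleIn_eq {K : Set Plane} (hK : IsCompact K) {g : ℝ → ℝ}
    (hg : Function.Periodic g (2 * Real.pi)) :
    ∫ θ in Ioo (-Real.pi) Real.pi, K.indicator 1 (circlePoint θ) * g θ =
      ∫ θ in circleIn K, g θ := by
  rw [setIntegral_circle_eq, circleIn, show {t ∈ Ioc 0 (2 * Real.pi) | circlePoint t ∈ K} =
    Ioc 0 (2 * Real.pi) ∩ circlePoint ⁻¹' K from rfl, ← setIntegral_indicator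
      (hK.measurableSet.preimage continuous_circlePoint.measurable)]
  · congr 1
    ext θ
    by_cases h : circlePoint θ ∈ K
    · rw [indicator_of_mem h, indicator_of_mem (show θ ∈ circlePoint ⁻¹' K from h)]; simp
    · rw [indicator_of_notMem h, indicator_of_notMem (show θ ∉ circlePoint ⁻¹' K from h)]; simp
  · intro θ
    simp only
    rw [circlePoint_periodic, hg]

theorem circleIn_union_circleOut (K : Set Plane) :
    circleIn K ∪ circleOut K = Ioc 0 (2 * Real.pi) := by
  ext t
  simp only [circleIn, circleOut, mem_union, mem_ofPred_eq]
  tauto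

theorem disjoint_circleIn_circleOut (K : Set Plane) : Disjoint (circleIn K) (circleOut K) := by
  rw [Set.disjoint_left]
  exact fun t h h' => h'.2 h.2

theorem measurableSet_circleOut {K : Set Plane} (hK : IsCompact K) :
    MeasurableSet (circleOut K) :=
  measurableSet_Ioc.inter (hK.measurableSet.compl.preimage continuous_circlePoint.measurable)

theorem integral_circleOut {K : Set Plane} (hK : IsCompact K) {g : ℝ → ℝ} (hg : Continuous g) :
    ∫ t in circleOut K, g t = (∫ t in (0 : ℝ)..2 * Real.pi, g t) - ∫ t in circleIn K, g t := by
  have hi : IntegrableOn g (Ioc 0 (2 * Real.pi)) :=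
    (hg.continuousOn.integrableOn_compact isCompact_Icc).mono_set Ioc_subset_Icc_self
  rw [← circleIn_union_circleOut K] at hi
  rw [intervalIntegral.integral_of_le (by have := Real.pi_pos; linarith),
    ← circleIn_union_circleOut K, setIntegral_union (disjoint_circleIn_circleOut K)
      (measurableSet_circleOut hK) hi.left_of_union hi.right_of_union]
  ring

theorem volume_circleOut {K : Set Plane} (hK : IsCompact K) :
    volume.real (circleOut K) = 2 * Real.pi - volume.real (circleIn K) := by
  have := integral_circleOut hK (g := fun _ => (1 : ℝ)) continuous_const
  simpa using this

end

section

/-! ### Variations of a lower boundary arc -/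

/-- A lower boundary arc of an optimal set. -/
structure IsOptimalArc (Φ : (ℝ × ℝ) ≃L[ℝ] Plane) (Ω : Set Plane) (c d : ℝ) (u f : ℝ → ℝ) :
    Prop where
  optimal : IsOptimal Ω
  area_eq : area Ω = Real.pi
  bary_eq : barycentre Ω = 0
  frame : IsFrame Φ
  arc : IsLowerArc Φ Ω c d u f

/-- `v`, with derivative `g`, vanishes outside `(c₁, d₁)` and `u + t v`, with slope `f + t g`, is
convex for `|t| ≤ t₀`. -/
structure IsVariation (c d : ℝ) (f : ℝ → ℝ) (c₁ d₁ t₀ : ℝ) (v g : ℝ → ℝ) : Prop where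
  pos : 0 < t₀
  left : c < c₁
  right : d₁ < d
  mono : ∀ t, |t| ≤ t₀ → MonotoneOn (fun x => f x + t * g x) (Icc c d)
  integral_eq : ∀ x ∈ Icc c d, ∀ y ∈ Icc c d, v y - v x = ∫ s in x..y, g s
  v_eq_zero : ∀ x ∈ Icc c d, x ∉ Ioo c₁ d₁ → v x = 0
  g_eq_zero : ∀ x ∈ Icc c d, x ∉ Ioo c₁ d₁ → g x = 0

variable {Φ : (ℝ × ℝ) ≃L[ℝ] Plane} {Ω : Set Plane} {c d c₁ d₁ t₀ : ℝ} {u f v g : ℝ → ℝ}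

namespace IsVariation

theorem neg (hv : IsVariation c d f c₁ d₁ t₀ v g) :
    IsVariation c d f c₁ d₁ t₀ (fun x => -v x) (fun x => -g x) where
  pos := hv.pos
  left := hv.left
  right := hv.right
  mono t ht := by
    have := hv.mono (-t) (by rwa [abs_neg])
    simpa using this
  integral_eq x hx y hy := by
    rw [intervalIntegral.integral_neg, ← hv.integral_eq x hx y hy]; ring
  v_eq_zero x hx h := by rw [hv.v_eq_zero x hx h, neg_zero]
  g_eq_zero x hx h := by rw [hv.g_eq_zero x hx h, neg_zero]

/-- Exhibits `g` as a multiple of the difference of two monotone functions, which yields its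
integrability and boundedness with no further hypothesis. -/
theorem g_eq (hv : IsVariation c d f c₁ d₁ t₀ v g) (x : ℝ) :
    g x = t₀⁻¹ * ((f x + t₀ * g x) - f x) := by
  have := hv.pos.ne'
  field_simp
  ring

theorem mono_self (hv : IsVariation c d f c₁ d₁ t₀ v g) : MonotoneOn f (Icc c d) := by
  simpa using hv.mono 0 (by rw [abs_zero]; exact hv.pos.le)

theorem integrableOn (hv : IsVariation c d f c₁ d₁ t₀ v g) : IntegrableOn g (Icc c d) := by
  have h1 := (hv.mono t₀ (abs_of_pos hv.pos).le).integrableOn_isCompact (μ := volume) isCompact_Icc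
  have h2 := hv.mono_self.integrableOn_isCompact (μ := volume) isCompact_Icc
  have h3 : IntegrableOn (fun x => t₀⁻¹ * ((f x + t₀ * g x) - f x)) (Icc c d) :=
    (h1.sub h2).const_mul _
  exact h3.congr_fun (fun x _ => (hv.g_eq x).symm) measurableSet_Icc

theorem bounded (hv : IsVariation c d f c₁ d₁ t₀ v g) : ∃ C, ∀ x ∈ Icc c d, |g x| ≤ C := by
  refine ⟨t₀⁻¹ * (f d - f c), fun x hx => ?_⟩
  have hcd : c ≤ d := hx.1.trans hx.2
  have hc : c ∈ Icc c d := left_mem_Icc.2 hcd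
  have hd : d ∈ Icc c d := right_mem_Icc.2 hcd
  have gc : g c = 0 := hv.g_eq_zero c hc fun h => lt_asymm h.1 hv.left
  have gd : g d = 0 := hv.g_eq_zero d hd fun h => lt_asymm h.2 hv.right
  have hm := hv.mono t₀ (abs_of_pos hv.pos).le
  have h1 := hm hc hx hx.1
  have h2 := hm hx hd hx.2
  have h3 := hv.mono_self hc hx hx.1
  have h4 := hv.mono_self hx hd hx.2
  simp only [gc, gd] at h1 h2
  rw [hv.g_eq, abs_mul, abs_of_pos (inv_pos.2 hv.pos)]
  apply mul_le_mul_of_nonneg_left _ (inv_pos.2 hv.pos).le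
  rw [abs_le]; constructor <;> linarith

theorem continuousOn (hv : IsVariation c d f c₁ d₁ t₀ v g) : ContinuousOn v (Icc c d) := by
  rcases lt_or_ge d c with h | h
  · rw [Icc_eq_empty (not_le.2 h)]; exact continuousOn_empty _
  have hi : IntervalIntegrable g volume c d := by
    rw [intervalIntegrable_iff_integrableOn_Icc_of_le h]; exact hv.integrableOn
  have h2 := intervalIntegral.continuousOn_primitive_interval (a := c) (b := d) (μ := volume)
    (f := g) (by rw [uIcc_of_le h]; exact hv.integrableOn)
  rw [uIcc_of_le h] at h2
  refine (h2.add (continuousOn_const (c := v c))).congr fun x hx => ?_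
  have := hv.integral_eq c (left_mem_Icc.2 h) x hx
  simp only [Pi.add_apply]
  linarith

theorem integrable_mul (hv : IsVariation c d f c₁ d₁ t₀ v g) {h : ℝ → ℝ}
    (hh : ContinuousOn h (Icc c d)) : IntegrableOn (fun x => v x * h x) (Ioo c d) :=
  ((hv.continuousOn.mul hh).integrableOn_compact isCompact_Icc).mono_set Ioo_subset_Icc_self

theorem integrable_v (hv : IsVariation c d f c₁ d₁ t₀ v g) : IntegrableOn v (Ioo c d) :=
  (hv.continuousOn.integrableOn_compact isCompact_Icc).mono_set Ioo_subset_Icc_self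

theorem abs_v_le (hv : IsVariation c d f c₁ d₁ t₀ v g) : ∃ C, ∀ x ∈ Icc c d, |v x| ≤ C :=
  isCompact_Icc.exists_bound_of_continuousOn hv.continuousOn

end IsVariation

namespace IsOptimalArc

variable (hΩ : IsOptimalArc Φ Ω c d u f) (hv : IsVariation c d f c₁ d₁ t₀ v g) {t : ℝ}
include hΩ

theorem isCompact : IsCompact Ω := hΩ.optimal.admissible.isCompact

theorem convex : Convex ℝ Ω := hΩ.optimal.admissible.convex

theorem area_pos : 0 < area Ω := hΩ.optimal.admissible.area_pos

theorem baryAsymmetry_pos : 0 < baryAsymmetry Ω :=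
  lt_of_le_of_ne (baryAsymmetry_nonneg Ω) hΩ.optimal.admissible.asymmetry_ne_zero.symm

theorem isoDeficit_pos : 0 < isoDeficit Ω :=
  _root_.isoDeficit_pos hΩ.optimal.admissible hΩ.area_eq hΩ.bary_eq

theorem zero_mem_interior : (0 : Plane) ∈ interior Ω :=
  _root_.zero_mem_interior hΩ.isCompact hΩ.convex hΩ.area_pos hΩ.bary_eq

theorem continuousOn_u : ContinuousOn u (Icc c d) := hΩ.arc.isSubgradOn.continuousOn

include hv

theorem isSubgradOn_add (ht : |t| ≤ t₀) :
    IsSubgradOn (fun x => u x + t * v x) (fun x => f x + t * g x) c d := by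
  apply IsSubgradOn.of_integral (hv.mono t ht)
  intro x hx y hy
  have hg : IntervalIntegrable g volume x y :=
    (hv.integrableOn.mono_set (uIcc_subset_Icc hx hy)).intervalIntegrable
  rw [intervalIntegral.integral_add (hΩ.arc.isSubgradOn.intervalIntegrable hx hy)
    (hg.const_mul t), hΩ.arc.isSubgradOn.integral_eq hx hy,
    intervalIntegral.integral_const_mul, ← hv.integral_eq x hx y hy]
  ring

theorem eventually_small : ∀ᶠ t in 𝓝 (0 : ℝ), |t| ≤ t₀ ∧ ∀ x ∈ Icc c d, u x + t * v x < 0 := by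
  obtain ⟨η, hη, hu⟩ := hΩ.arc.exists_neg
  obtain ⟨C, hC⟩ := hv.abs_v_le
  have h1 : ∀ᶠ t in 𝓝 (0 : ℝ), |t| ≤ t₀ :=
    (continuous_abs.tendsto (0 : ℝ)).eventually (eventually_le_nhds (by rw [abs_zero]; exact hv.pos))
  have h2 : ∀ᶠ t in 𝓝 (0 : ℝ), |t| * C < η := by
    have : Tendsto (fun t : ℝ => |t| * C) (𝓝 0) (𝓝 (|0| * C)) :=
      (continuous_abs.mul continuous_const).tendsto 0
    exact this.eventually (eventually_lt_nhds (by simpa using hη))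
  filter_upwards [h1, h2] with t h1 h2
  refine ⟨h1, fun x hx => ?_⟩
  have h3 : t * v x ≤ |t| * C := (le_abs_self _).trans (by
    rw [abs_mul]; exact mul_le_mul_of_nonneg_left (hC x hx) (abs_nonneg t))
  linarith [hu x hx]

theorem endpoints : (u c + t * v c = u c ∧ u d + t * v d = u d) ∧
    f c + t * g c = f c ∧ f d + t * g d = f d := by
  have hc : c ∈ Icc c d := left_mem_Icc.2 hΩ.arc.lt.le
  have hd : d ∈ Icc c d := right_mem_Icc.2 hΩ.arc.lt.le
  rw [hv.v_eq_zero c hc fun h => lt_asymm h.1 hv.left,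
    hv.v_eq_zero d hd fun h => lt_asymm h.2 hv.right,
    hv.g_eq_zero c hc fun h => lt_asymm h.1 hv.left,
    hv.g_eq_zero d hd fun h => lt_asymm h.2 hv.right]
  simp

end IsOptimalArc

/-- The one-parameter family of perturbed sets. -/
def perturb (Φ : (ℝ × ℝ) ≃L[ℝ] Plane) (Ω : Set Plane) (c d : ℝ) (u v : ℝ → ℝ) (t : ℝ) :
    Set Plane :=
  reshape Φ Ω c d fun x => u x + t * v x

/-- The barycentre of the perturbed set. -/
def perturbCentre (Φ : (ℝ × ℝ) ≃L[ℝ] Plane) (c d : ℝ) (u v : ℝ → ℝ) (t : ℝ) : Plane :=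
  (Real.pi - t * ∫ x in Ioo c d, v x)⁻¹ • Φ (-t * ∫ x in Ioo c d, v x * x,
    -t * (∫ x in Ioo c d, v x * u x) - t ^ 2 / 2 * ∫ x in Ioo c d, v x * v x)

/-- The radius of the barycentric disc of the perturbed set. -/
def perturbRadius (c d : ℝ) (v : ℝ → ℝ) (t : ℝ) : ℝ :=
  √((Real.pi - t * ∫ x in Ioo c d, v x) / Real.pi)

namespace IsOptimalArc

variable (hΩ : IsOptimalArc Φ Ω c d u f) (hv : IsVariation c d f c₁ d₁ t₀ v g) {t : ℝ}
  (ht : |t| ≤ t₀ ∧ ∀ x ∈ Icc c d, u x + t * v x < 0)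
include hΩ hv ht

theorem isCompact_perturb : IsCompact (perturb Φ Ω c d u v t) :=
  isCompact_reshape hΩ.isCompact (hΩ.isSubgradOn_add hv ht.1).continuousOn

theorem convex_perturb : Convex ℝ (perturb Φ Ω c d u v t) := by
  have h := hΩ.endpoints hv (t := t)
  exact convex_reshape hΩ.arc hΩ.convex h.1.1 h.1.2 h.2.1 h.2.2 ht.2 (hΩ.isSubgradOn_add hv ht.1)

theorem isLowerArc_perturb :
    IsLowerArc Φ (perturb Φ Ω c d u v t) c d (fun x => u x + t * v x)
      (fun x => f x + t * g x) := by
  have h := hΩ.endpoints hv (t := t)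
  exact isLowerArc_reshape hΩ.arc hΩ.convex h.1.1 h.1.2 h.2.1 h.2.2 ht.2
    (hΩ.isSubgradOn_add hv ht.1)

theorem perturb_diff_strip : Ω \ strip Φ c d 0 = perturb Φ Ω c d u v t \ strip Φ c d 0 := by
  have h := hΩ.endpoints hv (t := t)
  exact reshape_diff_strip hΩ.arc hΩ.convex h.1.1 h.1.2 ht.2

theorem area_perturb :
    area (perturb Φ Ω c d u v t) = Real.pi - t * ∫ x in Ioo c d, v x := by
  have h := area_sub_of_isEpiOn hΩ.frame hΩ.isCompact (hΩ.isCompact_perturb hv ht)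
    (hΩ.arc.isEpiOn hΩ.convex) ((hΩ.isLowerArc_perturb hv ht).isEpiOn (hΩ.convex_perturb hv ht))
    (hΩ.perturb_diff_strip hv ht)
  have e : ∀ x, u x - (u x + t * v x) = -t * v x := fun x => by ring
  simp_rw [e] at h
  rw [integral_const_mul, hΩ.area_eq] at h
  linarith

/-- The first moment of Ω vanishes, so only the layer between the graphs of u + tv and u counts. The
quadratic term in t is the height integrated across that layer. -/
theorem setIntegral_perturb : ∫ p in perturb Φ Ω c d u v t, p =
    Φ (-t * ∫ x in Ioo c d, v x * x,
      -t * (∫ x in Ioo c d, v x * u x) - t ^ 2 / 2 * ∫ x in Ioo c d, v x * v x) := by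
  have h := setIntegral_sub_of_isEpiOn hΩ.frame hΩ.isCompact.measurableSet
    (hΩ.isCompact_perturb hv ht).measurableSet (hΩ.arc.isEpiOn hΩ.convex)
    ((hΩ.isLowerArc_perturb hv ht).isEpiOn (hΩ.convex_perturb hv ht))
    (hΩ.perturb_diff_strip hv ht) (h := fun p => p) (integrableOn_id hΩ.isCompact)
    (integrableOn_id (hΩ.isCompact_perturb hv ht))
  rw [setIntegral_id_eq_zero_of_barycentre hΩ.area_pos hΩ.bary_eq, sub_zero] at h
  rw [h]
  have inner : ∀ x, ∫ y in (u x + t * v x)..u x, Φ (x, y) =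
      Φ (-t * (v x * x), -t * (v x * u x) - t ^ 2 / 2 * (v x * v x)) := by
    intro x
    have e1 := Φ.toContinuousLinearMap.intervalIntegral_comp_comm (μ := volume)
      (a := u x + t * v x) (b := u x) (f := fun y => ((x, y) : ℝ × ℝ))
      ((continuous_const.prodMk continuous_id).intervalIntegrable _ _)
    simp only [ContinuousLinearEquiv.coe_coe] at e1
    rw [e1]
    congr 1
    have i1 : IntervalIntegrable (fun y : ℝ => ((x, y) : ℝ × ℝ)) volume (u x + t * v x) (u x) :=
      (continuous_const.prodMk continuous_id).intervalIntegrable _ _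
    ext
    · have := (ContinuousLinearMap.fst ℝ ℝ ℝ).intervalIntegral_comp_comm i1
      simp only [ContinuousLinearMap.coe_fst'] at this
      rw [← this, intervalIntegral.integral_const, smul_eq_mul]; ring
    · have := (ContinuousLinearMap.snd ℝ ℝ ℝ).intervalIntegral_comp_comm i1
      simp only [ContinuousLinearMap.coe_snd'] at this
      rw [← this, integral_id]; ring
  simp_rw [inner]
  have h1 : IntegrableOn (fun x => -t * (v x * x)) (Ioo c d) :=
    (hv.integrable_mul continuousOn_id).const_mul _
  have h2 := (hv.integrable_mul hΩ.continuousOn_u).const_mul (-t)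
  have h3 := (hv.integrable_mul hv.continuousOn).const_mul (t ^ 2 / 2)
  have h4 : IntegrableOn (fun x => -t * (v x * u x) - t ^ 2 / 2 * (v x * v x)) (Ioo c d) :=
    h2.sub h3
  have e2 := Φ.toContinuousLinearMap.integral_comp_comm (h1.prodMk h4)
  simp only [ContinuousLinearEquiv.coe_coe] at e2
  rw [e2, integral_pair h1 h4, integral_const_mul, integral_sub h2 h3, integral_const_mul,
    integral_const_mul]

theorem barycentre_perturb :
    barycentre (perturb Φ Ω c d u v t) = perturbCentre Φ c d u v t := by
  rw [barycentre, hΩ.area_perturb hv ht, hΩ.setIntegral_perturb hv ht, perturbCentre]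

theorem barycentricDisc_perturb : barycentricDisc (perturb Φ Ω c d u v t) =
    Metric.closedBall (perturbCentre Φ c d u v t) (perturbRadius c d v t) := by
  rw [barycentricDisc, hΩ.barycentre_perturb hv ht, hΩ.area_perturb hv ht, perturbRadius]

theorem minkowskiPerimeter_perturb (hA : 0 < Real.pi - t * ∫ x in Ioo c d, v x) :
    minkowskiPerimeter (perturb Φ Ω c d u v t) = minkowskiPerimeter Ω +
      ∫ x in Ioo c d, (√(1 + (f x + t * g x) ^ 2) - √(1 + f x ^ 2)) := by
  rw [← minkowskiPerimeter_sub hΩ.frame hΩ.isCompact hΩ.convex hΩ.area_pos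
    (hΩ.isCompact_perturb hv ht) (hΩ.convex_perturb hv ht) (by rwa [hΩ.area_perturb hv ht])
    hΩ.arc (hΩ.isLowerArc_perturb hv ht) (hΩ.perturb_diff_strip hv ht) hv.left hv.right
    (fun x hx h => by rw [hv.v_eq_zero x hx h, mul_zero, add_zero])
    (fun x hx h => by rw [hv.g_eq_zero x hx h, mul_zero, add_zero])]
  ring

end IsOptimalArc

/-! ### Derivatives along a variation -/

theorem hasDerivAt_perturbCentre (Φ : (ℝ × ℝ) ≃L[ℝ] Plane) (c d : ℝ) (u v : ℝ → ℝ) :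
    HasDerivAt (perturbCentre Φ c d u v)
      (-(Real.pi⁻¹ • Φ (∫ x in Ioo c d, v x * x, ∫ x in Ioo c d, v x * u x))) 0 := by
  unfold perturbCentre
  generalize (∫ x in Ioo c d, v x) = V
  generalize (∫ x in Ioo c d, v x * x) = X
  generalize (∫ x in Ioo c d, v x * u x) = Y
  generalize (∫ x in Ioo c d, v x * v x) = Z
  have hpi := Real.pi_pos.ne'
  have h0 : HasDerivAt (fun t : ℝ => Real.pi - t * V) (-V) 0 := by
    simpa using ((hasDerivAt_id (0 : ℝ)).mul_const V).const_sub Real.pi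
  have h1 : HasDerivAt (fun t : ℝ => (Real.pi - t * V)⁻¹) (V / Real.pi ^ 2) 0 := by
    have := h0.fun_inv (by simp)
    simpa using this
  have h2 : HasDerivAt (fun t : ℝ => -t * X) (-X) 0 := by
    simpa using (hasDerivAt_id (0 : ℝ)).mul_const (-X)
  have h3 : HasDerivAt (fun t : ℝ => -t * Y - t ^ 2 / 2 * Z) (-Y) 0 := by
    have a : HasDerivAt (fun t : ℝ => -t * Y) (-Y) 0 := by
      simpa using (hasDerivAt_id (0 : ℝ)).mul_const (-Y)
    have b : HasDerivAt (fun t : ℝ => t ^ 2 / 2 * Z) 0 0 := by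
      simpa using (((hasDerivAt_id (0 : ℝ)).pow 2).div_const 2).mul_const Z
    exact (a.sub b).congr_deriv (by ring)
  have h4 := (Φ.toContinuousLinearMap.hasFDerivAt (x := ((-0 * X, -0 * Y - 0 ^ 2 / 2 * Z) :
    ℝ × ℝ))).comp_hasDerivAt (0 : ℝ) (h2.prodMk h3)
  have h5 := h1.smul h4
  refine h5.congr_deriv ?_
  simp only [Function.comp, ContinuousLinearEquiv.coe_coe, zero_mul, neg_zero, ne_eq,
    OfNat.ofNat_ne_zero, not_false_eq_true, zero_pow, zero_div, sub_zero, sub_self]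
  rw [show ((0, 0) : ℝ × ℝ) = 0 from rfl, map_zero, smul_zero, add_zero,
    show ((-X, -Y) : ℝ × ℝ) = -(X, Y) from rfl, map_neg, smul_neg]

theorem perturbCentre_zero (Φ : (ℝ × ℝ) ≃L[ℝ] Plane) (c d : ℝ) (u v : ℝ → ℝ) :
    perturbCentre Φ c d u v 0 = 0 := by
  rw [perturbCentre]
  simp only [neg_zero, zero_mul, ne_eq, OfNat.ofNat_ne_zero, not_false_eq_true, zero_pow,
    zero_div, sub_zero]
  rw [show ((0, 0) : ℝ × ℝ) = 0 from rfl, map_zero, smul_zero]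

theorem hasDerivAt_perturbRadius (c d : ℝ) (v : ℝ → ℝ) :
    HasDerivAt (perturbRadius c d v) (-(∫ x in Ioo c d, v x) / (2 * Real.pi)) 0 := by
  unfold perturbRadius
  generalize (∫ x in Ioo c d, v x) = V
  have hpi := Real.pi_pos.ne'
  have h0 : HasDerivAt (fun t : ℝ => (Real.pi - t * V) / Real.pi) (-V / Real.pi) 0 := by
    simpa using (((hasDerivAt_id (0 : ℝ)).mul_const V).const_sub Real.pi).div_const Real.pi
  have h1 := h0.sqrt (by simp [hpi])
  refine h1.congr_deriv ?_
  simp [hpi]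
  field_simp

theorem perturbRadius_zero (c d : ℝ) (v : ℝ → ℝ) : perturbRadius c d v 0 = 1 := by
  simp [perturbRadius, Real.pi_pos.ne']

theorem hasDerivAt_sqrt_one_add_sq (s : ℝ) :
    HasDerivAt (fun s : ℝ => √(1 + s ^ 2)) (s / √(1 + s ^ 2)) s := by
  have h0 : HasDerivAt (fun s : ℝ => 1 + s ^ 2) (2 * s) s := by
    simpa using ((hasDerivAt_id s).pow 2).const_add 1
  refine (h0.sqrt (by positivity)).congr_deriv ?_
  rw [mul_div_mul_left _ _ two_ne_zero]

theorem abs_div_sqrt_one_add_sq_le (s : ℝ) : |s / √(1 + s ^ 2)| ≤ 1 := by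
  rw [abs_div, abs_of_nonneg (Real.sqrt_nonneg _), div_le_one (by positivity)]
  apply Real.le_sqrt_of_sq_le
  rw [sq_abs]; linarith

/-- Differentiation under the integral: s ↦ √(1 + s²) has derivative bounded by 1, so |g| dominates.
-/
theorem hasDerivAt_perimeter (hv : IsVariation c d f c₁ d₁ t₀ v g) :
    HasDerivAt (fun t => ∫ x in Ioo c d, (√(1 + (f x + t * g x) ^ 2) - √(1 + f x ^ 2)))
      (∫ x in Ioo c d, f x / √(1 + f x ^ 2) * g x) 0 := by
  obtain ⟨C, hC⟩ := hv.bounded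
  have hg : IntegrableOn g (Ioo c d) := hv.integrableOn.mono_set Ioo_subset_Icc_self
  have hf : IntegrableOn f (Ioo c d) :=
    (hv.mono_self.integrableOn_isCompact (μ := volume) isCompact_Icc).mono_set Ioo_subset_Icc_self
  have hc1 : Continuous fun s : ℝ => √(1 + s ^ 2) := by fun_prop
  have hm : ∀ t : ℝ, AEStronglyMeasurable (fun x => √(1 + (f x + t * g x) ^ 2) - √(1 + f x ^ 2))
      (volume.restrict (Ioo c d)) := fun t =>
    (hc1.comp_aestronglyMeasurable (hf.1.add (hg.1.const_mul t))).sub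
      (hc1.comp_aestronglyMeasurable hf.1)
  have key := hasDerivAt_integral_of_dominated_loc_of_deriv_le (μ := volume.restrict (Ioo c d))
    (F := fun t x => √(1 + (f x + t * g x) ^ 2) - √(1 + f x ^ 2))
    (F' := fun t x => (f x + t * g x) / √(1 + (f x + t * g x) ^ 2) * g x) (x₀ := 0)
    (s := univ) (bound := fun x => |g x|) univ_mem (Eventually.of_forall hm) ?_ ?_ ?_ ?_ ?_
  · simpa using key.2
  · simp
  · have hc2 : Continuous fun s : ℝ => s / √(1 + s ^ 2) :=
      continuous_id.div hc1 fun s => by positivity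
    exact (hc2.comp_aestronglyMeasurable (hf.1.add (hg.1.const_mul 0))).mul hg.1
  · refine Eventually.of_forall fun x t _ => ?_
    rw [Real.norm_eq_abs, abs_mul]
    exact mul_le_of_le_one_left (abs_nonneg _) (abs_div_sqrt_one_add_sq_le _)
  · exact hg.abs
  · refine Eventually.of_forall fun x t _ => ?_
    have h1 : HasDerivAt (fun t : ℝ => f x + t * g x) (g x) t := by
      simpa using ((hasDerivAt_id t).mul_const (g x)).const_add (f x)
    exact ((hasDerivAt_sqrt_one_add_sq (f x + t * g x)).comp t h1).sub_const _

/-- The smooth part of the functional that is minimal at the optimal set. -/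
def smoothPart (Ω : Set Plane) (c d : ℝ) (f v g : ℝ → ℝ) (t : ℝ) : ℝ :=
  baryAsymmetry Ω * ((minkowskiPerimeter Ω +
    ∫ x in Ioo c d, (√(1 + (f x + t * g x) ^ 2) - √(1 + f x ^ 2))) *
      √(Real.pi - t * ∫ x in Ioo c d, v x) / (2 * √Real.pi)) -
    (4 * isoDeficit Ω - baryAsymmetry Ω * isoDeficit Ω + baryAsymmetry Ω) *
      (Real.pi - t * ∫ x in Ioo c d, v x)

/-- The linearized inequality multiplied by |K|. The area in the denominator disappears and the
overlap enters linearly, with coefficient 4δ. -/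
theorem linearized_area {Ω K : Set Plane} (h : IsOptimal Ω) (hK : IsCompact K)
    (hc : Convex ℝ K) (ha : 0 < area K) :
    0 ≤ baryAsymmetry Ω * (minkowskiPerimeter K * √(area K) / (2 * √Real.pi)) -
      (4 * isoDeficit Ω - baryAsymmetry Ω * isoDeficit Ω + baryAsymmetry Ω) * area K +
      4 * isoDeficit Ω * area (K ∩ barycentricDisc K) := by
  have h1 := h.linearized hK hc ha
  rw [baryAsymmetry_eq hK ha, isoDeficit_eq ha (K := K)] at h1
  have hpi : 0 < √Real.pi := Real.sqrt_pos.2 Real.pi_pos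
  have hs : 0 < √(area K) := Real.sqrt_pos.2 ha
  have hsq : √(area K) * √(area K) = area K := Real.mul_self_sqrt ha.le
  have e1 : area K * (minkowskiPerimeter K / (2 * √(area K) * √Real.pi)) =
      minkowskiPerimeter K * √(area K) / (2 * √Real.pi) := by
    field_simp
    linear_combination (-minkowskiPerimeter K) * hsq
  have e2 : area K * (2 * area (K ∩ barycentricDisc K) / area K) =
      2 * area (K ∩ barycentricDisc K) := by
    field_simp
  have h2 := mul_nonneg ha.le (sub_nonneg.2 h1)
  rw [← e1]
  refine h2.trans (le_of_eq ?_)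
  linear_combination 2 * isoDeficit Ω * e2

namespace IsOptimalArc

variable (hΩ : IsOptimalArc Φ Ω c d u f) (hv : IsVariation c d f c₁ d₁ t₀ v g)
include hΩ

theorem perimeter_eq : minkowskiPerimeter Ω = 2 * Real.pi * (1 + isoDeficit Ω) := by
  have hpi := Real.pi_pos
  have h := isoDeficit_eq hΩ.area_pos
  rw [hΩ.area_eq, mul_assoc, Real.mul_self_sqrt hpi.le] at h
  rw [h]; field_simp; ring

/-- The functional vanishes at the optimal set. -/
theorem smoothPart_zero :
    smoothPart Ω c d f v g 0 + 4 * isoDeficit Ω * area (Ω ∩ Metric.closedBall 0 1) = 0 := by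
  have hpi := Real.pi_pos
  have hs : 0 < √Real.pi := Real.sqrt_pos.2 hpi
  have h := baryAsymmetry_eq hΩ.isCompact hΩ.area_pos
  rw [barycentricDisc_eq hΩ.area_eq hΩ.bary_eq, hΩ.area_eq] at h
  have h2 : area (Ω ∩ Metric.closedBall 0 1) = Real.pi * (2 - baryAsymmetry Ω) / 2 := by
    rw [h]; field_simp; ring
  rw [h2, smoothPart]
  simp only [zero_mul, add_zero, sub_self, integral_zero, sub_zero]
  rw [hΩ.perimeter_eq]
  field_simp
  ring

include hv

theorem smoothPart_nonneg : ∀ᶠ t in 𝓝 (0 : ℝ), 0 ≤ smoothPart Ω c d f v g t +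
    4 * isoDeficit Ω * area (perturb Φ Ω c d u v t ∩
      Metric.closedBall (perturbCentre Φ c d u v t) (perturbRadius c d v t)) := by
  have h1 : ∀ᶠ t in 𝓝 (0 : ℝ), 0 < Real.pi - t * ∫ x in Ioo c d, v x := by
    have : Tendsto (fun t : ℝ => Real.pi - t * ∫ x in Ioo c d, v x) (𝓝 0)
        (𝓝 (Real.pi - 0 * ∫ x in Ioo c d, v x)) :=
      (continuous_const.sub (continuous_id.mul continuous_const)).tendsto 0
    exact this.eventually (eventually_gt_nhds (by simpa using Real.pi_pos))
  filter_upwards [h1, hΩ.eventually_small hv] with t hA ht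
  have hA' : 0 < area (perturb Φ Ω c d u v t) := by rwa [hΩ.area_perturb hv ht]
  have := linearized_area hΩ.optimal (hΩ.isCompact_perturb hv ht) (hΩ.convex_perturb hv ht) hA'
  rwa [hΩ.minkowskiPerimeter_perturb hv ht hA, hΩ.barycentricDisc_perturb hv ht,
    hΩ.area_perturb hv ht] at this

/-- The constant 1 - 3δ collects -(1 + δ), from differentiating √|K| against the perimeter 2π(1 +
δ), and 2 - 2δ, from the area term; the rest of the area term gives 8δ/λ₀. -/
theorem hasDerivAt_smoothPart : HasDerivAt (smoothPart Ω c d f v g)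
    (baryAsymmetry Ω / 2 * ((∫ x in Ioo c d, f x / √(1 + f x ^ 2) * g x) +
      (1 - 3 * isoDeficit Ω + 8 * isoDeficit Ω / baryAsymmetry Ω) * ∫ x in Ioo c d, v x)) 0 := by
  have hl := hΩ.baryAsymmetry_pos.ne'
  have hpi := Real.pi_pos
  have hs : 0 < √Real.pi := Real.sqrt_pos.2 hpi
  have hP := hasDerivAt_perimeter hv
  have hper := hΩ.perimeter_eq
  unfold smoothPart
  generalize (∫ x in Ioo c d, v x) = V at *
  have h0 : HasDerivAt (fun t : ℝ => Real.pi - t * V) (-V) 0 := by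
    simpa using ((hasDerivAt_id (0 : ℝ)).mul_const V).const_sub Real.pi
  have h1 := h0.sqrt (by simp)
  have h2 := ((((hP.const_add (minkowskiPerimeter Ω)).mul h1).div_const (2 * √Real.pi)).const_mul
    (baryAsymmetry Ω)).sub (h0.const_mul
    (4 * isoDeficit Ω - baryAsymmetry Ω * isoDeficit Ω + baryAsymmetry Ω))
  refine HasDerivAt.congr_deriv h2 ?_
  simp only [zero_mul, add_zero, sub_self, integral_zero, sub_zero, hper]
  have hsq : √Real.pi ^ 2 = Real.pi := Real.sq_sqrt hpi.le
  field_simp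
  rw [hsq]
  ring

end IsOptimalArc

end

section

variable {Φ : (ℝ × ℝ) ≃L[ℝ] Plane} {Ω : Set Plane} {c d c₁ d₁ t₀ : ℝ} {u f v g : ℝ → ℝ}

/-! ### The boundary meets the circle in a null set -/

theorem isEpiOn_lowEnd {L : Set Plane} (hL : IsCompact L) (hc : Convex ℝ L) {y₀ : ℝ}
    (h : ∀ x ∈ Ioo c d, Φ (x, y₀) ∈ L) : IsEpiOn Φ L c d y₀ (lowEnd Φ L) :=
  fun x hx => ⟨lowEnd_le hL (h x hx), fun _ hy => mem_iff_lowEnd_le hL hc (h x hx) hy.le⟩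

theorem area_inter_strip (hΦ : IsFrame Φ) {L : Set Plane} (hL : IsCompact L) {y₀ : ℝ}
    (h : IsEpiOn Φ L c d y₀ f) :
    area (L ∩ strip Φ c d y₀) = ∫ x in Ioo c d, (y₀ - f x) := by
  have h1 := (setIntegral_inter_strip hΦ hL.measurableSet h (h := fun _ => (1 : ℝ))
    (integrableOn_const ((measure_mono inter_subset_left).trans_lt hL.measure_lt_top).ne)).1
  rw [setIntegral_one_eq_area] at h1
  simpa using h1

/-- Averaging sections. -/
theorem area_strip_add_le (hΦ : IsFrame Φ) {L L₁ L₂ : Set Plane} (hL : IsCompact L)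
    (cL : Convex ℝ L) (hL₁ : IsCompact L₁) (cL₁ : Convex ℝ L₁) (hL₂ : IsCompact L₂)
    (cL₂ : Convex ℝ L₂) (h₁ : ∀ x ∈ Ioo c d, Φ (x, 0) ∈ L₁) (h₂ : ∀ x ∈ Ioo c d, Φ (x, 0) ∈ L₂)
    (hmid : ∀ x ∈ Ioo c d, ∀ y₁ ≤ 0, ∀ y₂ ≤ 0, Φ (x, y₁) ∈ L₁ → Φ (x, y₂) ∈ L₂ →
      Φ (x, (y₁ + y₂) / 2) ∈ L) :
    area (L₁ ∩ strip Φ c d 0) + area (L₂ ∩ strip Φ c d 0) ≤ 2 * area (L ∩ strip Φ c d 0) := by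
  have h : ∀ x ∈ Ioo c d, Φ (x, 0) ∈ L := fun x hx => by
    simpa using hmid x hx 0 le_rfl 0 le_rfl (h₁ x hx) (h₂ x hx)
  have e := isEpiOn_lowEnd hL cL h
  have e₁ := isEpiOn_lowEnd hL₁ cL₁ h₁
  have e₂ := isEpiOn_lowEnd hL₂ cL₂ h₂
  have i := integrableOn_of_isEpiOn hΦ hL e
  have i₁ := integrableOn_of_isEpiOn hΦ hL₁ e₁
  have i₂ := integrableOn_of_isEpiOn hΦ hL₂ e₂
  rw [area_inter_strip hΦ hL e, area_inter_strip hΦ hL₁ e₁, area_inter_strip hΦ hL₂ e₂]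
  simp only [zero_sub]
  have j₁ : IntegrableOn (fun x => -lowEnd Φ L₁ x) (Ioo c d) := i₁.neg
  have j₂ : IntegrableOn (fun x => -lowEnd Φ L₂ x) (Ioo c d) := i₂.neg
  have j : IntegrableOn (fun x => -lowEnd Φ L x) (Ioo c d) := i.neg
  rw [← integral_add j₁ j₂, ← integral_const_mul]
  apply setIntegral_mono_on (j₁.add j₂) (j.const_mul 2) measurableSet_Ioo
  intro x hx
  have := lowEnd_le hL (hmid x hx _ (e₁ x hx).1 _ (e₂ x hx).1 (lowEnd_mem hL₁ (h₁ x hx))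
    (lowEnd_mem hL₂ (h₂ x hx)))
  simp only [Pi.add_apply]
  linarith

/-- The part of the moved disc outside the unit disc lies in an annulus of width ‖b‖ + |R - 1|. -/
theorem area_inter_closedBall_le (A : Set Plane) {b : Plane} {R : ℝ} :
    area (A ∩ Metric.closedBall b R) ≤ area (A ∩ Metric.closedBall 0 1) +
      Real.pi * ((1 + (‖b‖ + |R - 1|)) ^ 2 - 1) := by
  set e := ‖b‖ + |R - 1| with he
  have he0 : 0 ≤ e := by positivity
  have hsub : Metric.closedBall b R ⊆ Metric.closedBall 0 (1 + e) := by
    apply Metric.closedBall_subset_closedBall'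
    rw [dist_zero_right]
    linarith [le_abs_self (R - 1)]
  have hsub1 : Metric.closedBall (0 : Plane) 1 ⊆ Metric.closedBall 0 (1 + e) :=
    Metric.closedBall_subset_closedBall (by linarith)
  have h1 : area (Metric.closedBall (0 : Plane) (1 + e) \ Metric.closedBall 0 1) =
      Real.pi * ((1 + e) ^ 2 - 1) := by
    have := measureReal_sdiff (μ := volume) hsub1 (Metric.isClosed_closedBall.measurableSet)
      (isCompact_closedBall _ _).measure_lt_top.ne
    change area _ = area _ - area _ at this
    rw [this, area_closedBall _ (by linarith), area_closedBall _ zero_le_one]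
    ring
  rw [← h1]
  have hfin : volume (A ∩ Metric.closedBall 0 1 ∪
      (Metric.closedBall (0 : Plane) (1 + e) \ Metric.closedBall 0 1)) ≠ ⊤ :=
    ((measure_mono (union_subset (inter_subset_right.trans hsub1) sdiff_subset)).trans_lt
      (isCompact_closedBall _ _).measure_lt_top).ne
  refine (measureReal_mono ?_ hfin).trans (measureReal_union_le _ _)
  rintro p ⟨hpA, hp⟩
  by_cases h : p ∈ Metric.closedBall (0 : Plane) 1
  · exact Or.inl ⟨hpA, h⟩
  · exact Or.inr ⟨hsub hp, h⟩

theorem tendsto_div_of_hasDerivAt {F : ℝ → ℝ} {F' : ℝ} (h : HasDerivAt F F' 0) :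
    Tendsto (fun t => (F t - F 0) / t) (𝓝[>] 0) (𝓝 F') := by
  have := h.tendsto_slope_zero_right
  simp only [zero_add, smul_eq_mul] at this
  simpa [div_eq_inv_mul] using this

theorem hasDerivAt_comp_neg_zero {E : Type*} [NormedAddCommGroup E] [NormedSpace ℝ E]
    {F : ℝ → E} {F' : E} (h : HasDerivAt F F' 0) : HasDerivAt (fun t => F (-t)) (-F') 0 := by
  have h0 : HasDerivAt F F' (-0) := by rwa [neg_zero]
  have := h0.scomp (0 : ℝ) (hasDerivAt_neg 0)
  simpa [Function.comp_def] using this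

/-- The symmetric average of a differentiable function has derivative zero at 0. It makes the disc
averaged over t and -t agree with the unit disc up to o(t). -/
theorem tendsto_norm_add_div {E : Type*} [NormedAddCommGroup E] [NormedSpace ℝ E]
    {F : ℝ → E} {F' : E} (h : HasDerivAt F F' 0) :
    Tendsto (fun t : ℝ => ‖(1 / 2 : ℝ) • (F t + F (-t)) - F 0‖ / t) (𝓝[>] 0) (𝓝 0) := by
  have h1 : HasDerivAt (fun t => (1 / 2 : ℝ) • (F t + F (-t)) - F 0)
      ((1 / 2 : ℝ) • (F' + -F')) 0 :=
    ((h.add (hasDerivAt_comp_neg_zero h)).const_smul (1 / 2 : ℝ)).sub_const _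
  have h2 := h1.tendsto_slope_zero_right.norm
  have e0 : (1 / 2 : ℝ) • (F 0 + F (-0)) - F 0 = 0 := by
    rw [neg_zero, ← two_smul ℝ (F 0), smul_smul]; norm_num
  simp only [zero_add, e0, sub_zero] at h2
  rw [add_neg_cancel, smul_zero, norm_zero] at h2
  refine h2.congr' ?_
  filter_upwards [self_mem_nhdsWithin] with t ht
  rw [mem_Ioi] at ht
  rw [norm_smul (t⁻¹), norm_inv, Real.norm_eq_abs, abs_of_pos ht]
  exact (div_eq_inv_mul _ _).symm

theorem eventually_mem_closedBall {b : ℝ → Plane} {R : ℝ → ℝ} {m : ℝ} (hb : ContinuousAt b 0)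
    (hR : ContinuousAt R 0) (hb0 : b 0 = 0) (hR0 : R 0 = 1) (hm : m < 1) :
    ∀ᶠ t in 𝓝 (0 : ℝ), ∀ p : Plane, ‖p‖ ≤ m → p ∈ Metric.closedBall (b t) (R t) := by
  have h : Tendsto (fun t => m + ‖b t‖) (𝓝 0) (𝓝 (m + ‖b 0‖)) := hb.norm.const_add m
  have h2 := h.eventually_lt hR (by rw [hb0, hR0, norm_zero]; linarith)
  filter_upwards [h2] with t ht p hp
  rw [Metric.mem_closedBall, dist_eq_norm]
  linarith [norm_sub_le p (b t)]

theorem IsFrame.norm_axis (hΦ : IsFrame Φ) (x : ℝ) : ‖Φ (x, 0)‖ = |x| := by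
  rw [← abs_of_nonneg (norm_nonneg (Φ (x, 0))), ← sq_eq_sq_iff_abs_eq_abs, hΦ.norm_sq]
  simp

theorem mem_midpoint_closedBall {p₁ p₂ b₁ b₂ : Plane} {R₁ R₂ : ℝ}
    (h₁ : p₁ ∈ Metric.closedBall b₁ R₁) (h₂ : p₂ ∈ Metric.closedBall b₂ R₂) :
    (1 / 2 : ℝ) • (p₁ + p₂) ∈
      Metric.closedBall ((1 / 2 : ℝ) • (b₁ + b₂)) ((1 / 2 : ℝ) • (R₁ + R₂)) := by
  rw [Metric.mem_closedBall, dist_eq_norm] at *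
  have e : (1 / 2 : ℝ) • (p₁ + p₂) - (1 / 2 : ℝ) • (b₁ + b₂) =
      (1 / 2 : ℝ) • ((p₁ - b₁) + (p₂ - b₂)) := by
    rw [← smul_sub]; congr 1; abel
  rw [e, norm_smul, smul_eq_mul, Real.norm_of_nonneg (by norm_num)]
  linarith [norm_add_le (p₁ - b₁) (p₂ - b₂)]

theorem integrableOn_indicator_circlePoint {A : Set Plane} (hA : MeasurableSet A) {h : ℝ → ℝ}
    (hh : Continuous h) :
    IntegrableOn (fun θ => A.indicator 1 (circlePoint θ) * h θ) (Ioo (-Real.pi) Real.pi) := by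
  have h1 : IntegrableOn h (Ioo (-Real.pi) Real.pi) :=
    (hh.continuousOn.integrableOn_compact isCompact_Icc).mono_set Ioo_subset_Icc_self
  refine Integrable.mono h1 (((measurable_one.indicator hA).comp
    continuous_circlePoint.measurable).aestronglyMeasurable.mul h1.1) ?_
  refine Eventually.of_forall fun θ => ?_
  rw [norm_mul]
  refine mul_le_of_le_one_left (norm_nonneg _) ?_
  by_cases hm : circlePoint θ ∈ A <;> simp [hm]

namespace IsOptimalArc

variable (hΩ : IsOptimalArc Φ Ω c d u f) (hv : IsVariation c d f c₁ d₁ t₀ v g)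
include hΩ hv

/-- In the strip, u + tv and u - tv average to u, and the midpoint of points of two discs lies in
the averaged disc. So averaging vertical sections bounds the two overlaps by twice that of Ω with
the averaged disc, hence with the unit disc up to an annulus. Outside the strip the sets coincide
with Ω. The bounds on c and d keep the axis segment inside both discs, so that all sections reach
level 0. -/
theorem eventually_overlap_le (hc : -1 < c) (hd : d < 1) : ∀ᶠ t in 𝓝 (0 : ℝ),
    area (perturb Φ Ω c d u v t ∩
      Metric.closedBall (perturbCentre Φ c d u v t) (perturbRadius c d v t)) +
    area (perturb Φ Ω c d u v (-t) ∩
      Metric.closedBall (perturbCentre Φ c d u v (-t)) (perturbRadius c d v (-t))) ≤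
    2 * (area (Ω ∩ strip Φ c d 0 ∩ Metric.closedBall 0 1) + Real.pi * ((1 +
      (‖(1 / 2 : ℝ) • (perturbCentre Φ c d u v t + perturbCentre Φ c d u v (-t))‖ +
      |(1 / 2 : ℝ) • (perturbRadius c d v t + perturbRadius c d v (-t)) - 1|)) ^ 2 - 1)) +
    (area (Ω \ strip Φ c d 0 ∩
      Metric.closedBall (perturbCentre Φ c d u v t) (perturbRadius c d v t)) +
    area (Ω \ strip Φ c d 0 ∩
      Metric.closedBall (perturbCentre Φ c d u v (-t)) (perturbRadius c d v (-t)))) := by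
  have hneg : Tendsto (fun t : ℝ => -t) (𝓝 0) (𝓝 0) := by
    simpa using (continuous_neg (G := ℝ)).tendsto 0
  have hball := eventually_mem_closedBall (m := max (-c) d)
    (hasDerivAt_perturbCentre Φ c d u v).continuousAt (hasDerivAt_perturbRadius c d v).continuousAt
    (perturbCentre_zero Φ c d u v) (perturbRadius_zero c d v) (max_lt (by linarith) hd)
  have hS := (isOpen_strip Φ c d 0).measurableSet
  have hsplit : ∀ t, (|t| ≤ t₀ ∧ ∀ x ∈ Icc c d, u x + t * v x < 0) → ∀ b R,
      area (perturb Φ Ω c d u v t ∩ Metric.closedBall b R) =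
      area (perturb Φ Ω c d u v t ∩ Metric.closedBall b R ∩ strip Φ c d 0) +
      area (Ω \ strip Φ c d 0 ∩ Metric.closedBall b R) := by
    intro t ht b R
    have := measureReal_inter_add_sdiff (μ := volume)
      (s := perturb Φ Ω c d u v t ∩ Metric.closedBall b R) hS
      ((hΩ.isCompact_perturb hv ht).inter (isCompact_closedBall b R)).measure_lt_top.ne
    rw [hΩ.perturb_diff_strip hv ht, inter_comm (_ \ _), ← inter_sdiff_assoc,
      inter_comm (Metric.closedBall b R)]
    exact this.symm
  filter_upwards [hΩ.eventually_small hv, hneg.eventually (hΩ.eventually_small hv), hball,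
    hneg.eventually hball] with t ht ht' hb hb'
  rw [hsplit t ht, hsplit (-t) ht']
  set b := perturbCentre Φ c d u v t
  set b' := perturbCentre Φ c d u v (-t)
  set R := perturbRadius c d v t
  set R' := perturbRadius c d v (-t)
  have hax : ∀ x ∈ Ioo c d, ‖Φ (x, 0)‖ ≤ max (-c) d := fun x hx => by
    rw [hΩ.frame.norm_axis]
    exact abs_le.2 ⟨by linarith [hx.1, le_max_left (-c) d], hx.2.le.trans (le_max_right _ _)⟩
  have key := area_strip_add_le (c := c) (d := d) hΩ.frame
    (L := Ω ∩ Metric.closedBall ((1 / 2 : ℝ) • (b + b')) ((1 / 2 : ℝ) • (R + R')))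
    (hΩ.isCompact.inter (isCompact_closedBall _ _)) (hΩ.convex.inter (convex_closedBall _ _))
    ((hΩ.isCompact_perturb hv ht).inter (isCompact_closedBall b R))
    ((hΩ.convex_perturb hv ht).inter (convex_closedBall _ _))
    ((hΩ.isCompact_perturb hv ht').inter (isCompact_closedBall b' R'))
    ((hΩ.convex_perturb hv ht').inter (convex_closedBall _ _))
    (fun x hx => ⟨(hΩ.isLowerArc_perturb hv ht).top x (Ioo_subset_Icc_self hx), hb _ (hax x hx)⟩)
    (fun x hx => ⟨(hΩ.isLowerArc_perturb hv ht').top x (Ioo_subset_Icc_self hx),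
      hb' _ (hax x hx)⟩)
    (by
      intro x hx y₁ hy₁ y₂ hy₂ h₁ h₂
      have hx' := Ioo_subset_Icc_self hx
      constructor
      · rw [hΩ.arc.mem_iff hΩ.convex hx' (by linarith)]
        have e₁ := ((hΩ.isLowerArc_perturb hv ht).mem_iff (hΩ.convex_perturb hv ht) hx' hy₁).1 h₁.1
        have e₂ := ((hΩ.isLowerArc_perturb hv ht').mem_iff (hΩ.convex_perturb hv ht') hx' hy₂).1
          h₂.1
        linarith
      · have := mem_midpoint_closedBall h₁.2 h₂.2
        rw [← map_add, ← map_smul] at this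
        convert this using 2
        ext
        · simp; ring
        · simp; ring)
  have h3 := area_inter_closedBall_le (Ω ∩ strip Φ c d 0)
    (b := (1 / 2 : ℝ) • (b + b')) (R := (1 / 2 : ℝ) • (R + R'))
  rw [inter_right_comm] at h3
  linarith

/-- The points of the circle that lie on the boundary of an optimal set, outside of the support
of a variation which changes the area, form a null set. -/
theorem ae_notMem_frontier_diff_strip (hc : -1 < c) (hd : d < 1)
    (hV : ∫ x in Ioo c d, v x ≠ 0) : ∀ᵐ θ, θ ∈ Ioo (-Real.pi) Real.pi →
      ¬(circlePoint θ ∈ frontier Ω ∧ circlePoint θ ∉ strip Φ c d 0) := by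
  have hK := hΩ.isCompact
  have hS := (isOpen_strip Φ c d 0).measurableSet
  set E : Set Plane := Ω ∩ (strip Φ c d 0)ᶜ with hEdef
  have hEd : Ω \ strip Φ c d 0 = E := rfl
  have hE : MeasurableSet E := hK.measurableSet.inter hS.compl
  set E' : Set Plane := interior Ω ∩ (strip Φ c d 0)ᶜ with hE'def
  have hE' : MeasurableSet E' := isOpen_interior.measurableSet.inter hS.compl
  have hχ : ∀ᵐ θ, θ ∈ Ioo (-Real.pi) Real.pi →
      (∀ᶠ r : ℝ in 𝓝[>] 1, E.indicator (1 : Plane → ℝ) (r • circlePoint θ) =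
        E'.indicator 1 (circlePoint θ)) ∧
      ∀ᶠ r : ℝ in 𝓝[<] 1, E.indicator (1 : Plane → ℝ) (r • circlePoint θ) =
        E.indicator 1 (circlePoint θ) := by
    filter_upwards [ae_strip_mem_nhds hΩ.frame c d] with θ hθ _
    exact indicator_ray_eventually hK hΩ.convex hΩ.zero_mem_interior hθ
  set V := ∫ x in Ioo c d, v x with hVdef
  have hb := hasDerivAt_perturbCentre Φ c d u v
  have hR := hasDerivAt_perturbRadius c d v
  rw [← hVdef] at hR
  set β := -(Real.pi⁻¹ • Φ (∫ x in Ioo c d, v x * x, ∫ x in Ioo c d, v x * u x))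
  set b := perturbCentre Φ c d u v with hbdef
  set R := perturbRadius c d v with hRdef
  set ρ := -V / (2 * Real.pi) with hρ
  have hρ0 : ρ ≠ 0 := by
    rw [hρ]; exact div_ne_zero (neg_ne_zero.2 hV) (by have := Real.pi_pos; positivity)
  have hb0 : b 0 = 0 := perturbCentre_zero Φ c d u v
  have hR0 : R 0 = 1 := perturbRadius_zero c d v
  have T1 := tendsto_area_inter_closedBall hE hχ hb hR hb0 hR0
  have T2 := tendsto_area_inter_closedBall hE hχ (hasDerivAt_comp_neg_zero hb)
    (hasDerivAt_comp_neg_zero hR) (by rw [neg_zero, hb0]) (by rw [neg_zero, hR0])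
  have hF := hΩ.hasDerivAt_smoothPart hv
  set F := smoothPart Ω c d f v g with hFdef
  have T3 := tendsto_div_of_hasDerivAt hF
  have T4 := tendsto_div_of_hasDerivAt (hasDerivAt_comp_neg_zero hF)
  have hδ := hΩ.isoDeficit_pos
  set δ := isoDeficit Ω with hδdef
  have T5 := tendsto_norm_add_div hb
  have T6 := tendsto_norm_add_div hR
  set e : ℝ → ℝ := fun t => ‖(1 / 2 : ℝ) • (b t + b (-t))‖ + |(1 / 2 : ℝ) • (R t + R (-t)) - 1|
    with hedef
  have T7 : Tendsto (fun t => e t / t) (𝓝[>] 0) (𝓝 0) := by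
    have := T5.add T6
    rw [add_zero] at this
    refine this.congr fun t => ?_
    rw [hb0, hR0, sub_zero, hedef, add_div, Real.norm_eq_abs]
  have T8 : Tendsto (fun t => e t) (𝓝[>] 0) (𝓝 0) := by
    have := T7.mul (tendsto_id.mono_left nhdsWithin_le_nhds : Tendsto id (𝓝[>] (0 : ℝ)) (𝓝 0))
    rw [zero_mul] at this
    refine this.congr' ?_
    filter_upwards [self_mem_nhdsWithin] with t ht
    rw [mem_Ioi] at ht
    simp only [id]; field_simp
  have T9 : Tendsto (fun t => Real.pi * ((1 + e t) ^ 2 - 1) / t) (𝓝[>] 0) (𝓝 0) := by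
    have := (T7.mul (T8.const_add 2)).const_mul Real.pi
    rw [zero_mul, mul_zero] at this
    refine this.congr fun t => ?_
    ring
  have hsum := (T3.add T4).add (((T1.add T2).add (T9.const_mul 2)).const_mul (4 * δ))
  have hneg : Tendsto (fun t : ℝ => -t) (𝓝 0) (𝓝 0) := by
    simpa using (continuous_neg (G := ℝ)).tendsto 0
  have hF0 := hΩ.smoothPart_zero (f := f) (v := v) (g := g)
  have hzero : area (Ω ∩ Metric.closedBall 0 1) = area (Ω ∩ strip Φ c d 0 ∩ Metric.closedBall 0 1) +
      area (E ∩ Metric.closedBall 0 1) := by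
    have := measureReal_inter_add_sdiff (μ := volume)
      (s := Ω ∩ Metric.closedBall 0 1) hS (hK.inter (isCompact_closedBall 0 1)).measure_lt_top.ne
    rw [inter_right_comm, ← hEd, inter_comm (_ \ _), ← inter_sdiff_assoc,
      inter_comm (Metric.closedBall 0 1)]
    exact this.symm
  -- The inequalities for t and -t are added and twice the value 0 at the optimal set is subtracted.
  -- Only the part outside the strip contributes nontrivially to the overlap at first order.
  have hnn := ge_of_tendsto hsum (by
    filter_upwards [self_mem_nhdsWithin,
      nhdsWithin_le_nhds (hΩ.eventually_overlap_le hv hc hd),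
      nhdsWithin_le_nhds (hΩ.smoothPart_nonneg hv),
      nhdsWithin_le_nhds (hneg.eventually (hΩ.smoothPart_nonneg hv))] with t ht h1 h2 h3
    rw [mem_Ioi] at ht
    rw [hEd] at h1
    have h4 : 4 * δ * (area (perturb Φ Ω c d u v t ∩ Metric.closedBall (b t) (R t)) +
        area (perturb Φ Ω c d u v (-t) ∩ Metric.closedBall (b (-t)) (R (-t)))) ≤ 4 * δ * _ :=
      mul_le_mul_of_nonneg_left h1 (by linarith)
    have e1 : (F t - F 0) / t + (F (-t) - F (-0)) / t +
        4 * δ * ((area (E ∩ Metric.closedBall (b t) (R t)) - area (E ∩ Metric.closedBall 0 1)) / t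
        + (area (E ∩ Metric.closedBall (b (-t)) (R (-t))) - area (E ∩ Metric.closedBall 0 1)) / t
        + 2 * (Real.pi * ((1 + e t) ^ 2 - 1) / t)) =
      ((F t + F (-t) - 2 * F 0) + 4 * δ * (area (E ∩ Metric.closedBall (b t) (R t)) +
        area (E ∩ Metric.closedBall (b (-t)) (R (-t))) - 2 * area (E ∩ Metric.closedBall 0 1)
        + 2 * (Real.pi * ((1 + e t) ^ 2 - 1)))) / t := by
      rw [neg_zero]; ring
    rw [e1]
    apply div_nonneg _ ht.le
    rw [hzero] at hF0
    linarith)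
  have hn : Continuous fun θ => ρ + inner ℝ β (circlePoint θ) :=
    continuous_const.add (continuous_const.inner continuous_circlePoint)
  set n : ℝ → ℝ := fun θ => ρ + inner ℝ β (circlePoint θ) with hndef
  have i1 := (integrableOn_indicator_circlePoint hE (continuous_abs.comp hn)).sub (integrableOn_indicator_circlePoint hE' (continuous_abs.comp hn))
  -- In the sum over t and -t the derivatives of the smooth part cancel. What remains is the
  -- integral of (1_{E'} - 1_E)|n|, n being the normal speed of the circle; it is nonnegative by
  -- minimality and nonpositive pointwise, as E' ⊆ E.
  have hle : ∫ θ in Ioo (-Real.pi) Real.pi, (E.indicator 1 (circlePoint θ) * |n θ| -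
      E'.indicator 1 (circlePoint θ) * |n θ|) ≤ 0 := by
    have hp := hn.max (continuous_const (y := (0 : ℝ)))
    have hm := hn.neg.max (continuous_const (y := (0 : ℝ)))
    have j1 : IntegrableOn (fun θ => E'.indicator 1 (circlePoint θ) * max (n θ) 0 -
        E.indicator 1 (circlePoint θ) * max (-n θ) 0) (Ioo (-Real.pi) Real.pi) := (integrableOn_indicator_circlePoint hE' hp).sub (integrableOn_indicator_circlePoint hE hm)
    have j2 : IntegrableOn (fun θ => E'.indicator 1 (circlePoint θ) * max (-n θ) 0 -
        E.indicator 1 (circlePoint θ) * max (n θ) 0) (Ioo (-Real.pi) Real.pi) := (integrableOn_indicator_circlePoint hE' hm).sub (integrableOn_indicator_circlePoint hE hp)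
    have hsum0 : 0 ≤ (∫ θ in Ioo (-Real.pi) Real.pi, (E'.indicator 1 (circlePoint θ) * max (n θ) 0
        - E.indicator 1 (circlePoint θ) * max (-n θ) 0)) +
        ∫ θ in Ioo (-Real.pi) Real.pi, (E'.indicator 1 (circlePoint θ) * max (-n θ) 0
        - E.indicator 1 (circlePoint θ) * max (n θ) 0) := by
      have e2 : ∀ θ, -ρ + inner ℝ (-β) (circlePoint θ) = -n θ := fun θ => by
        rw [inner_neg_left, hndef]; ring
      simp only [e2, neg_neg] at hnn
      have h5 : 0 ≤ 4 * δ * ((∫ θ in Ioo (-Real.pi) Real.pi,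
        (E'.indicator 1 (circlePoint θ) * max (n θ) 0
        - E.indicator 1 (circlePoint θ) * max (-n θ) 0)) +
        ∫ θ in Ioo (-Real.pi) Real.pi, (E'.indicator 1 (circlePoint θ) * max (-n θ) 0
        - E.indicator 1 (circlePoint θ) * max (n θ) 0)) := by
        refine hnn.trans (le_of_eq ?_)
        ring
      exact nonneg_of_mul_nonneg_right h5 (by linarith)
    rw [← integral_add j1 j2] at hsum0
    rw [← neg_nonneg, ← integral_neg]
    refine hsum0.trans (le_of_eq (integral_congr_ae (Eventually.of_forall fun θ => ?_)))
    simp only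
    rcases le_total 0 (n θ) with h | h
    · rw [max_eq_left h, max_eq_right (by linarith), abs_of_nonneg h]; ring
    · rw [max_eq_right h, max_eq_left (by linarith), abs_of_nonpos h]; ring
  have hsub : E' ⊆ E := inter_subset_inter_left _ interior_subset
  have hpos : ∀ θ, 0 ≤ E.indicator 1 (circlePoint θ) * |n θ| -
      E'.indicator 1 (circlePoint θ) * |n θ| := by
    intro θ
    rw [← sub_mul]
    apply mul_nonneg _ (abs_nonneg _)
    rw [sub_nonneg]
    exact indicator_le_indicator_of_subset hsub (fun _ => zero_le_one) _
  have hae := (integral_eq_zero_iff_of_nonneg hpos i1).1 (le_antisymm hle (integral_nonneg hpos))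
  -- Because the area changes, ρ ≠ 0, so the normal speed n vanishes only at countably many angles.
  filter_upwards [(ae_restrict_iff' measurableSet_Ioo).1 hae,
    ae_inner_circlePoint_ne (v := β) (k := -ρ) (Or.inr (neg_ne_zero.2 hρ0))] with θ h1 h2 hθ h3
  have h4 := h1 hθ
  have hn0 : n θ ≠ 0 := fun h => h2 (by simp only [hndef] at h; linarith)
  have hmem : circlePoint θ ∈ E := ⟨hK.isClosed.frontier_subset h3.1, h3.2⟩
  have hnot : circlePoint θ ∉ E' := fun h => h3.1.2 h.1
  simp only [Pi.zero_apply] at h4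
  rw [indicator_of_mem hmem, indicator_of_notMem hnot] at h4
  simp at h4
  exact hn0 h4

end IsOptimalArc

end

section

variable {Φ : (ℝ × ℝ) ≃L[ℝ] Plane} {Ω : Set Plane} {c d c₁ d₁ t₀ : ℝ} {u f v g : ℝ → ℝ}

theorem IsLowerArc.mem_frontier {L : Set Plane} (h : IsLowerArc Φ L c d u f) {x : ℝ}
    (hx : x ∈ Icc c d) : Φ (x, u x) ∈ frontier L := by
  refine ⟨subset_closure (h.mem x hx), fun hint => ?_⟩
  have hcont : Tendsto (fun y : ℝ => Φ (x, y)) (𝓝 (u x)) (𝓝 (Φ (x, u x))) :=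
    (Φ.continuous.comp (continuous_const.prodMk continuous_id)).tendsto (u x)
  have h1 : ∀ᶠ y in 𝓝[<] (u x), Φ (x, y) ∈ L :=
    (hcont.eventually (mem_interior_iff_mem_nhds.1 hint)).filter_mono nhdsWithin_le_nhds
  obtain ⟨y, hy, hlt⟩ := (h1.and (eventually_mem_nhdsWithin (a := u x) (s := Iio (u x)))).exists
  have h2 : y < u x := hlt
  have := h.supp x hx _ hy
  simp at this
  linarith

/-! ### Existence of variations -/

theorem integrable_comp_slope {ζ : ℝ → ℝ} (hζ : Continuous ζ) (hf : MonotoneOn f (Icc c d)) :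
    IntegrableOn (fun x => ζ (f x)) (Icc c d) := by
  rcases lt_or_ge d c with h | h
  · rw [Icc_eq_empty (not_le.2 h)]; exact integrableOn_empty
  have hfi := hf.integrableOn_isCompact (μ := volume) isCompact_Icc
  obtain ⟨C, hC⟩ := isCompact_Icc.exists_bound_of_continuousOn
    (hζ.continuousOn (s := Icc (f c) (f d)))
  refine Integrable.mono' (integrableOn_const (C := C) (by simp))
    (hζ.comp_aestronglyMeasurable hfi.1) ?_
  filter_upwards [ae_restrict_mem measurableSet_Icc] with x hx
  exact hC _ ⟨hf (left_mem_Icc.2 h) hx hx.1, hf hx (right_mem_Icc.2 h) hx.2⟩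

/-- Perturbing the slope by a Lipschitz function of the slope changes its increments by at most a
factor |t|L, so f + tζ(f) stays nondecreasing for |t| ≤ 1/(L+1), even where `f` jumps. The zero mean
makes the primitive vanish again to the right of d₁. -/
theorem isVariation_of_lipschitz {ζ : ℝ → ℝ} {L : ℝ≥0} (hζ : LipschitzWith L ζ)
    (hf : MonotoneOn f (Icc c d)) (hc : c < c₁) (h1 : c₁ ≤ d₁) (hd : d₁ < d)
    (hl : ∀ s ≤ f c₁, ζ s = 0) (hr : ∀ s, f d₁ ≤ s → ζ s = 0)
    (hint : ∫ x in c..d, ζ (f x) = 0) :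
    IsVariation c d f c₁ d₁ (1 / (L + 1)) (fun x => ∫ s in c..x, ζ (f s)) fun x => ζ (f x) := by
  have hcd : c ≤ d := by linarith
  have hi : ∀ x ∈ Icc c d, ∀ y ∈ Icc c d,
      IntervalIntegrable (fun s => ζ (f s)) volume x y := fun x hx y hy =>
    ((integrable_comp_slope hζ.continuous hf).mono_set
      (uIcc_subset_Icc hx hy)).intervalIntegrable
  have hcm : c ∈ Icc c d := left_mem_Icc.2 hcd
  have hdm : d ∈ Icc c d := right_mem_Icc.2 hcd
  have hc₁ : c₁ ∈ Icc c d := ⟨hc.le, h1.trans hd.le⟩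
  have hd₁ : d₁ ∈ Icc c d := ⟨hc.le.trans h1, hd.le⟩
  have hL : (0 : ℝ) ≤ L := L.2
  have hgl : ∀ x ∈ Icc c d, x ≤ c₁ → ζ (f x) = 0 := fun x hx h => hl _ (hf hx hc₁ h)
  have hgr : ∀ x ∈ Icc c d, d₁ ≤ x → ζ (f x) = 0 := fun x hx h => hr _ (hf hd₁ hx h)
  refine ⟨by positivity, hc, hd, ?_, ?_, ?_, ?_⟩
  · intro t ht x hx y hy hxy
    simp only
    have h2 := hζ.dist_le_mul (f y) (f x)
    rw [Real.dist_eq, Real.dist_eq, abs_of_nonneg (sub_nonneg.2 (hf hx hy hxy))] at h2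
    have h3 : |t * (ζ (f y) - ζ (f x))| ≤ f y - f x := by
      rw [abs_mul]
      have h4 : |t| * (L + 1) ≤ 1 := by
        rwa [← le_div_iff₀ (by positivity)]
      nlinarith [abs_nonneg t, sub_nonneg.2 (hf hx hy hxy), abs_nonneg (ζ (f y) - ζ (f x))]
    have := (abs_le.1 h3).1
    linarith
  · intro x hx y hy
    have := intervalIntegral.integral_add_adjacent_intervals (hi c hcm x hx) (hi x hx y hy)
    linarith
  · intro x hx hx'
    rcases le_or_gt x c₁ with h | h
    · apply intervalIntegral.integral_zero_ae
      refine Eventually.of_forall fun s hs => ?_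
      rw [uIoc_of_le hx.1] at hs
      exact hgl s ⟨hs.1.le, hs.2.trans hx.2⟩ (hs.2.trans h)
    · have h' : d₁ ≤ x := not_lt.1 fun h' => hx' ⟨h, h'⟩
      have h2 := intervalIntegral.integral_add_adjacent_intervals (hi c hcm x hx) (hi x hx d hdm)
      have h3 : ∫ s in x..d, ζ (f s) = 0 := by
        apply intervalIntegral.integral_zero_ae
        refine Eventually.of_forall fun s hs => ?_
        rw [uIoc_of_le hx.2] at hs
        exact hgr s ⟨hx.1.trans hs.1.le, hs.2⟩ (h'.trans hs.1.le)
      linarith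
  · intro x hx hx'
    rcases le_or_gt x c₁ with h | h
    · exact hgl x hx h
    · exact hgr x hx (not_lt.1 fun h' => hx' ⟨h, h'⟩)

/-- A tent function over `[p, q]`. -/
def tent (p q s : ℝ) : ℝ := max 0 (min (s - p) (q - s))

theorem tent_nonneg (p q s : ℝ) : 0 ≤ tent p q s := le_max_left _ _

theorem tent_of_le {p q s : ℝ} (h : s ≤ p) : tent p q s = 0 :=
  max_eq_left ((min_le_left _ _).trans (sub_nonpos.2 h))

theorem tent_of_ge {p q s : ℝ} (h : q ≤ s) : tent p q s = 0 :=
  max_eq_left ((min_le_right _ _).trans (sub_nonpos.2 h))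

theorem tent_pos {p q s : ℝ} (h : p < s) (h' : s < q) : 0 < tent p q s :=
  lt_max_of_lt_right (lt_min (sub_pos.2 h) (sub_pos.2 h'))

theorem lipschitzWith_tent (p q : ℝ) : LipschitzWith 1 (tent p q) := by
  unfold tent
  have h1 : LipschitzWith 1 fun s : ℝ => s - p := by
    simpa using (LipschitzWith.id (α := ℝ)).sub (LipschitzWith.const p)
  have h2 : LipschitzWith 1 fun s : ℝ => q - s := by
    simpa using (LipschitzWith.const q).sub (LipschitzWith.id (α := ℝ))
  simpa using (h1.min h2).const_max 0

section tent

variable (hf : StrictMonoOn f (Icc c d)) {a b : ℝ}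
include hf

theorem integral_tent_left (ha : a ∈ Icc c d) {x : ℝ} (hx : c ≤ x) (hxa : x ≤ a) :
    ∫ s in c..x, tent (f a) (f b) (f s) = 0 := by
  apply intervalIntegral.integral_zero_ae
  refine Eventually.of_forall fun s hs => ?_
  rw [uIoc_of_le hx] at hs
  exact tent_of_le (hf.monotoneOn ⟨hs.1.le, hs.2.trans (hxa.trans ha.2)⟩ ha (hs.2.trans hxa))

theorem integral_tent_right (hb : b ∈ Icc c d) {x : ℝ} (hx : x ≤ d) (hxb : b ≤ x) :
    ∫ s in x..d, tent (f a) (f b) (f s) = 0 := by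
  apply intervalIntegral.integral_zero_ae
  refine Eventually.of_forall fun s hs => ?_
  rw [uIoc_of_le hx] at hs
  exact tent_of_ge (hf.monotoneOn hb ⟨hb.1.trans (hxb.trans hs.1.le), hs.2⟩ (hxb.trans hs.1.le))

theorem intervalIntegrable_tent {x y : ℝ} (hx : x ∈ Icc c d) (hy : y ∈ Icc c d) :
    IntervalIntegrable (fun s => tent (f a) (f b) (f s)) volume x y :=
  ((integrable_comp_slope (lipschitzWith_tent _ _).continuous hf.monotoneOn).mono_set
      (uIcc_subset_Icc hx hy)).intervalIntegrable

theorem integral_tent_pos (ha : a ∈ Icc c d) (hb : b ∈ Icc c d) (hab : a < b) : 0 < ∫ s in c..d, tent (f a) (f b) (f s) := by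
  have hcd : c ≤ d := ha.1.trans ha.2
  have hc : c ∈ Icc c d := left_mem_Icc.2 hcd
  have hd : d ∈ Icc c d := right_mem_Icc.2 hcd
  rw [← intervalIntegral.integral_add_adjacent_intervals
    (intervalIntegrable_tent hf hc ha) (intervalIntegrable_tent hf ha hd),
    ← intervalIntegral.integral_add_adjacent_intervals
    (intervalIntegrable_tent hf ha hb) (intervalIntegrable_tent hf hb hd),
    integral_tent_left hf ha ha.1 le_rfl, integral_tent_right hf hb hb.2 le_rfl, zero_add,
    add_zero]
  apply intervalIntegral.intervalIntegral_pos_of_pos_on (intervalIntegrable_tent hf ha hb)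
    _ hab
  intro s hs
  have hsm : s ∈ Icc c d := ⟨ha.1.trans hs.1.le, hs.2.le.trans hb.2⟩
  exact tent_pos (hf ha hsm hs.1) (hf hsm hb hs.2)

end tent

/-- There is a variation that changes the area. -/
theorem exists_isVariation (hf : StrictMonoOn f (Icc c d)) (hcd : c < d) :
    ∃ c₁ d₁ t₀ v g, IsVariation c d f c₁ d₁ t₀ v g ∧ ∫ x in Ioo c d, v x ≠ 0 := by
  set a := c + (d - c) / 4 with ha
  set m := c + (d - c) / 2 with hm
  set b := c + 3 * (d - c) / 4 with hb
  have ham : a ∈ Icc c d := ⟨by linarith, by linarith⟩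
  have hmm : m ∈ Icc c d := ⟨by linarith, by linarith⟩
  have hbm : b ∈ Icc c d := ⟨by linarith, by linarith⟩
  have hc : c ∈ Icc c d := left_mem_Icc.2 hcd.le
  have hd : d ∈ Icc c d := right_mem_Icc.2 hcd.le
  set A := ∫ s in c..d, tent (f a) (f m) (f s) with hA
  set B := ∫ s in c..d, tent (f m) (f b) (f s) with hB
  have hApos : 0 < A := integral_tent_pos hf ham hmm (by linarith)
  have hBpos : 0 < B := integral_tent_pos hf hmm hbm (by linarith)
  -- Two consecutive tents of opposite sign, weighted to have total mean zero: the primitive rises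
  -- on the first and falls back on the second, so it is nonnegative, and it is positive at m.
  set ζ : ℝ → ℝ := fun s => B * tent (f a) (f m) s - A * tent (f m) (f b) s with hζ
  have hζL : LipschitzWith (‖B‖₊ * 1 + ‖A‖₊ * 1) ζ := by
    have h1 : LipschitzWith (‖B‖₊ * 1) fun s => B * tent (f a) (f m) s :=
      (lipschitzWith_smul B).comp (lipschitzWith_tent (f a) (f m))
    have h2 : LipschitzWith (‖A‖₊ * 1) fun s => A * tent (f m) (f b) s :=
      (lipschitzWith_smul A).comp (lipschitzWith_tent (f m) (f b))
    exact h1.sub h2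
  have hamf : f a ≤ f m := hf.monotoneOn ham hmm (by linarith)
  have hmbf : f m ≤ f b := hf.monotoneOn hmm hbm (by linarith)
  have hζi : ∀ x ∈ Icc c d, ∀ y ∈ Icc c d, ∫ s in x..y, ζ (f s) =
      B * (∫ s in x..y, tent (f a) (f m) (f s)) - A * ∫ s in x..y, tent (f m) (f b) (f s) := by
    intro x hx y hy
    rw [hζ, intervalIntegral.integral_sub
      ((intervalIntegrable_tent hf hx hy).const_mul B)
      ((intervalIntegrable_tent hf hx hy).const_mul A),
      intervalIntegral.integral_const_mul, intervalIntegral.integral_const_mul]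
  have hint : ∫ x in c..d, ζ (f x) = 0 := by
    rw [hζi c hc d hd, ← hA, ← hB]; ring
  have hvar := isVariation_of_lipschitz hζL hf.monotoneOn (c₁ := a) (d₁ := b) (by linarith)
    (by linarith) (by linarith)
    (fun s hs => by rw [hζ]; simp only; rw [tent_of_le hs, tent_of_le (hs.trans hamf)]; ring)
    (fun s hs => by rw [hζ]; simp only; rw [tent_of_ge hs, tent_of_ge (hmbf.trans hs)]; ring) hint
  refine ⟨a, b, _, _, _, hvar, ne_of_gt ?_⟩
  rw [← integral_Ioc_eq_integral_Ioo, ← intervalIntegral.integral_of_le hcd.le]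
  have hsplit : ∀ x ∈ Icc c d, ∀ p q, p ∈ Icc c d → q ∈ Icc c d →
      (∫ s in c..x, tent (f p) (f q) (f s)) + ∫ s in x..d, tent (f p) (f q) (f s) =
      ∫ s in c..d, tent (f p) (f q) (f s) := fun x hx p q hp hq =>
    intervalIntegral.integral_add_adjacent_intervals (intervalIntegrable_tent hf hc hx)
      (intervalIntegrable_tent hf hx hd)
  have hleft : ∀ x ∈ Icc c d, x ≤ m → ∫ s in c..x, ζ (f s) =
      B * ∫ s in c..x, tent (f a) (f m) (f s) := by
    intro x hx hxm
    rw [hζi c hc x hx, integral_tent_left hf hmm hx.1 hxm]; ring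
  have hright : ∀ x ∈ Icc c d, m ≤ x → ∫ s in c..x, ζ (f s) =
      A * ∫ s in x..d, tent (f m) (f b) (f s) := by
    intro x hx hxm
    have h1 := hsplit x hx a m ham hmm
    have h2 := hsplit x hx m b hmm hbm
    rw [integral_tent_right hf hmm hx.2 hxm] at h1
    rw [hζi c hc x hx]
    rw [← hA] at h1
    rw [← hB] at h2
    linear_combination B * h1 - A * h2
  refine intervalIntegral.integral_pos hcd hvar.continuousOn ?_ ⟨m, hmm, ?_⟩
  · intro x hx
    have hx' : x ∈ Icc c d := ⟨hx.1.le, hx.2⟩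
    rcases le_total x m with h | h
    · rw [hleft x hx' h]
      exact mul_nonneg hBpos.le
        (intervalIntegral.integral_nonneg hx.1.le fun s _ => tent_nonneg _ _ _)
    · rw [hright x hx' h]
      exact mul_nonneg hApos.le
        (intervalIntegral.integral_nonneg hx.2 fun s _ => tent_nonneg _ _ _)
  · have h1 := hsplit m hmm a m ham hmm
    rw [integral_tent_right hf hmm hmm.2 le_rfl, add_zero] at h1
    rw [hleft m hmm le_rfl, h1]
    exact mul_pos hBpos hApos

namespace IsOptimalArc

theorem mono (hΩ : IsOptimalArc Φ Ω c d u f) {c' d' : ℝ} (h : c' < d') (hc : c ≤ c')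
    (hd : d' ≤ d) : IsOptimalArc Φ Ω c' d' u f :=
  ⟨hΩ.optimal, hΩ.area_eq, hΩ.bary_eq, hΩ.frame, hΩ.arc.mono h hc hd⟩

variable (hΩ : IsOptimalArc Φ Ω c d u f) (hf : StrictMonoOn f (Icc c d))
  (hc : -1 < c) (hd : d < 1)
include hΩ hf hc hd

/-- If an optimal set has a strictly convex boundary arc, then its boundary meets the circle in a
null set. -/
theorem ae_notMem_frontier :
    ∀ᵐ θ, θ ∈ Ioo (-Real.pi) Real.pi → circlePoint θ ∉ frontier Ω := by
  have hcd := hΩ.arc.lt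
  set m := (c + d) / 2 with hm
  have hcm : c < m := by linarith
  have hmd : m < d := by linarith
  obtain ⟨_, _, _, _, _, hv₁, hV₁⟩ :=
    exists_isVariation (hf.mono (Icc_subset_Icc le_rfl hmd.le)) hcm
  obtain ⟨_, _, _, _, _, hv₂, hV₂⟩ :=
    exists_isVariation (hf.mono (Icc_subset_Icc hcm.le le_rfl)) hmd
  -- Each half of the arc carries a variation that controls the circle outside its own strip; the
  -- two strips are disjoint.
  filter_upwards [(hΩ.mono hcm le_rfl hmd.le).ae_notMem_frontier_diff_strip hv₁ hc
      (by linarith) hV₁,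
    (hΩ.mono hmd hcm.le le_rfl).ae_notMem_frontier_diff_strip hv₂ (by linarith) hd hV₂]
    with θ h1 h2 hθ hfr
  have h3 : circlePoint θ ∈ strip Φ c m 0 := not_not.1 fun h => h1 hθ ⟨hfr, h⟩
  have h4 : circlePoint θ ∈ strip Φ m d 0 := not_not.1 fun h => h2 hθ ⟨hfr, h⟩
  exact lt_asymm h3.1.2 h4.1.1

/-- The abscissa of a circle point is a differentiable function of its angle, so the null set of
angles is carried to a null set of abscissae. -/
theorem volume_norm_eq_one : volume {x ∈ Ioo c d | ‖Φ (x, u x)‖ = 1} = 0 := by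
  have h := hΩ.ae_notMem_frontier hf hc hd
  set N : Set ℝ := {θ | θ ∈ Ioo (-Real.pi) Real.pi ∧ circlePoint θ ∈ frontier Ω} with hN
  -- The argument of a complex number may equal π, which the open interval of angles omits.
  have hN0 : volume (N ∪ {Real.pi}) = 0 := by
    rw [measure_union_null_iff]
    refine ⟨?_, by simp⟩
    rw [ae_iff] at h
    convert h using 2
    ext θ
    simp [hN, and_assoc]
  have himg : volume ((fun θ => (Φ.symm (circlePoint θ)).1) '' (N ∪ {Real.pi})) = 0 := by
    apply addHaar_image_eq_zero_of_differentiableOn_of_addHaar_eq_zero _ _ hN0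
    have hd : Differentiable ℝ fun θ => (Φ.symm (circlePoint θ)).1 := by
      have e : (fun θ => (Φ.symm (circlePoint θ)).1) = fun θ =>
          (Φ (1, 0)) 0 * Real.cos θ + (Φ (1, 0)) 1 * Real.sin θ := by
        ext θ
        rw [hΩ.frame.symm_fst, inner_circlePoint]
      rw [e]
      fun_prop
    exact hd.differentiableOn
  refine measure_mono_null ?_ himg
  rintro x ⟨hx, hn⟩
  set p := Φ (x, u x) with hp
  have hpf : p ∈ frontier Ω := hΩ.arc.mem_frontier (Ioo_subset_Icc_self hx)
  set z : ℂ := ⟨p 0, p 1⟩ with hz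
  have hzn : ‖z‖ = 1 := by
    have h2 := plane_norm_sq p
    have h3 : ‖z‖ ^ 2 = 1 := by
      rw [← Complex.normSq_eq_norm_sq, Complex.normSq_apply]
      rw [hn] at h2
      simp only [hz]
      linarith
    nlinarith [norm_nonneg z]
  have hpz : circlePoint z.arg = p := by
    have hre := Complex.norm_mul_cos_arg z
    have him := Complex.norm_mul_sin_arg z
    rw [hzn, one_mul] at hre him
    ext i; fin_cases i
    · exact hre
    · exact him
  refine ⟨z.arg, ?_, ?_⟩
  · rcases (Complex.arg_le_pi z).eq_or_lt with h | h
    · exact Or.inr h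
    · exact Or.inl ⟨⟨Complex.neg_pi_lt_arg z, h⟩, by rwa [hpz]⟩
  · simp only
    rw [hpz, hp, Φ.symm_apply_apply]

end IsOptimalArc

end

section

variable {Φ : (ℝ × ℝ) ≃L[ℝ] Plane} {Ω : Set Plane} {c d c₁ d₁ t₀ : ℝ} {u f v g : ℝ → ℝ}

/-! ### The weak form of the curvature equation -/

theorem integrableOn_sub_of_isEpiOn {E : Type*} [NormedAddCommGroup E] [NormedSpace ℝ E]
    (hΦ : IsFrame Φ) {L L' : Set Plane} (hL : MeasurableSet L)
    (hL' : MeasurableSet L') {y₀ : ℝ} {f f' : ℝ → ℝ} (hf : IsEpiOn Φ L c d y₀ f)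
    (hf' : IsEpiOn Φ L' c d y₀ f') {h : Plane → E} (hh : IntegrableOn h L)
    (hh' : IntegrableOn h L') :
    IntegrableOn (fun x => ∫ y in f' x..f x, h (Φ (x, y))) (Ioo c d) := by
  obtain ⟨-, h2, h3⟩ := setIntegral_inter_strip hΦ hL hf (hh.mono_set inter_subset_left)
  obtain ⟨-, h2', h3'⟩ := setIntegral_inter_strip hΦ hL' hf' (hh'.mono_set inter_subset_left)
  refine (h2'.sub h2).congr ?_
  filter_upwards [ae_restrict_of_ae h3, ae_restrict_of_ae h3', ae_restrict_mem measurableSet_Ioo]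
    with x hx hx' hxm
  simp only [Pi.sub_apply]
  rw [sub_eq_iff_eq_add, intervalIntegral.integral_add_adjacent_intervals
    ((hx' hxm).trans (hx hxm).symm) (hx hxm)]

/-- Near a point off the circle, the indicator function of a disc close to the unit disc is
constant along a vertical line. -/
theorem eventually_indicator_closedBall_eq {b : ℝ → Plane} {R : ℝ → ℝ} (hb : ContinuousAt b 0)
    (hR : ContinuousAt R 0) (hb0 : b 0 = 0) (hR0 : R 0 = 1) {x y₀ : ℝ} (h : ‖Φ (x, y₀)‖ ≠ 1) :
    ∀ᶠ p : ℝ × ℝ in 𝓝 0 ×ˢ 𝓝 y₀,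
      (Metric.closedBall (b p.1) (R p.1)).indicator (1 : Plane → ℝ) (Φ (x, p.2)) =
        if ‖Φ (x, y₀)‖ < 1 then 1 else 0 := by
  have h1 : Tendsto (fun p : ℝ × ℝ => ‖Φ (x, p.2) - b p.1‖) (𝓝 0 ×ˢ 𝓝 y₀)
      (𝓝 ‖Φ (x, y₀) - b 0‖) := by
    have e1 : Tendsto (fun p : ℝ × ℝ => Φ (x, p.2)) (𝓝 0 ×ˢ 𝓝 y₀) (𝓝 (Φ (x, y₀))) :=
      ((Φ.continuous.comp (continuous_const.prodMk continuous_id)).tendsto y₀).comp tendsto_snd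
    exact (e1.sub (hb.tendsto.comp tendsto_fst)).norm
  have h2 : Tendsto (fun p : ℝ × ℝ => R p.1) (𝓝 0 ×ˢ 𝓝 y₀) (𝓝 (R 0)) :=
    hR.tendsto.comp tendsto_fst
  rw [hb0, sub_zero] at h1
  rw [hR0] at h2
  rcases lt_or_gt_of_ne h with h | h
  · rw [if_pos h]
    filter_upwards [h1.eventually_lt h2 h] with p hp
    apply indicator_of_mem
    rw [Metric.mem_closedBall, dist_eq_norm]
    exact hp.le
  · rw [if_neg (not_lt.2 h.le)]
    filter_upwards [h2.eventually_lt h1 h] with p hp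
    apply indicator_of_notMem
    rw [Metric.mem_closedBall, dist_eq_norm]
    exact not_le.2 hp

/-- Off the unit circle the indicator of the moving disc is eventually constant on the short
vertical segment between the two graphs. -/
theorem tendsto_integral_indicator_div {b : ℝ → Plane} {R : ℝ → ℝ} (hb : ContinuousAt b 0)
    (hR : ContinuousAt R 0) (hb0 : b 0 = 0) (hR0 : R 0 = 1) {x y₀ : ℝ} (h : ‖Φ (x, y₀)‖ ≠ 1)
    (w : ℝ) :
    Tendsto (fun t => (∫ y in (y₀ + t * w)..y₀,
      (Metric.closedBall (b t) (R t)).indicator (1 : Plane → ℝ) (Φ (x, y))) / t) (𝓝[>] 0)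
      (𝓝 (-(w * if ‖Φ (x, y₀)‖ < 1 then 1 else 0))) := by
  obtain ⟨P, hP, Q, hQ, hPQ⟩ := eventually_prod_iff.1
    (eventually_indicator_closedBall_eq hb hR hb0 hR0 h)
  obtain ⟨ε, hε, hball⟩ := Metric.eventually_nhds_iff.1 hQ
  have h1 : ∀ᶠ t in 𝓝 (0 : ℝ), |t * w| < ε := by
    have : Tendsto (fun t : ℝ => |t * w|) (𝓝 0) (𝓝 |0 * w|) :=
      (continuous_abs.comp (continuous_id.mul continuous_const)).tendsto 0
    exact this.eventually (eventually_lt_nhds (by simpa using hε))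
  refine tendsto_const_nhds.congr' ?_
  filter_upwards [self_mem_nhdsWithin, nhdsWithin_le_nhds hP, nhdsWithin_le_nhds h1]
    with t ht hPt htw
  have ht0 : t ≠ 0 := (mem_Ioi.1 ht).ne'
  have e : ∫ y in (y₀ + t * w)..y₀,
      (Metric.closedBall (b t) (R t)).indicator (1 : Plane → ℝ) (Φ (x, y)) =
      ∫ _ in (y₀ + t * w)..y₀, if ‖Φ (x, y₀)‖ < 1 then (1 : ℝ) else 0 := by
    apply intervalIntegral.integral_congr
    intro y hy
    refine hPQ hPt (hball ?_)
    have := abs_sub_right_of_mem_uIcc hy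
    rw [Real.dist_eq, abs_sub_comm]
    refine this.trans_lt ?_
    rwa [sub_add_cancel_left, abs_neg]
  rw [e, intervalIntegral.integral_const, smul_eq_mul]
  field_simp
  ring

theorem abs_integral_indicator_le (A : Set Plane) (x y₀ t w : ℝ) :
    |∫ y in (y₀ + t * w)..y₀, A.indicator (1 : Plane → ℝ) (Φ (x, y))| ≤ |t| * |w| := by
  have := intervalIntegral.norm_integral_le_of_norm_le_const (a := y₀ + t * w) (b := y₀) (C := 1)
    (f := fun y => A.indicator (1 : Plane → ℝ) (Φ (x, y))) fun y _ => by
      by_cases h : Φ (x, y) ∈ A <;> simp [h]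
  rw [one_mul, sub_add_cancel_left, abs_neg, abs_mul] at this
  exact this

/-- `∫_{∂B^IN} (cos t, sin t) dt`. -/
def circleMoment (Ω : Set Plane) : Plane :=
  !₂[∫ t in circleIn Ω, Real.cos t, ∫ t in circleIn Ω, Real.sin t]

/-- The curvature that the Euler equation prescribes over `x`. -/
def prescribedCurvature (Φ : (ℝ × ℝ) ≃L[ℝ] Plane) (Ω : Set Plane) (u : ℝ → ℝ) (x : ℝ) : ℝ :=
  1 - 3 * isoDeficit Ω + 8 * isoDeficit Ω / baryAsymmetry Ω *
    (1 - (if ‖Φ (x, u x)‖ < 1 then 1 else 0) - volume.real (circleIn Ω) / (2 * Real.pi)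
      - inner ℝ (Φ (x, u x)) (circleMoment Ω) / Real.pi)

theorem setIntegral_circleIn_inner (Ω : Set Plane) (β : Plane) (ρ : ℝ) :
    ∫ θ in circleIn Ω, (ρ + inner ℝ β (circlePoint θ)) =
      ρ * volume.real (circleIn Ω) + inner ℝ β (circleMoment Ω) := by
  have hsub : circleIn Ω ⊆ Icc 0 (2 * Real.pi) := fun t ht => Ioc_subset_Icc_self ht.1
  have hi : ∀ h : ℝ → ℝ, Continuous h → IntegrableOn h (circleIn Ω) := fun h hh =>
    (hh.continuousOn.integrableOn_compact isCompact_Icc).mono_set hsub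
  simp_rw [inner_circlePoint]
  rw [integral_add (hi _ continuous_const) (hi _ (by fun_prop)),
    integral_add (hi _ (by fun_prop)) (hi _ (by fun_prop)), integral_const_mul,
    integral_const_mul, setIntegral_const, smul_eq_mul]
  simp [circleMoment, PiLp.inner_apply, Fin.sum_univ_two]
  ring

theorem IsFrame.inner_apply (Φ : (ℝ × ℝ) ≃L[ℝ] Plane) (z : ℝ × ℝ) (p : Plane) :
    inner ℝ (Φ z) p = z.1 * inner ℝ (Φ (1, 0)) p + z.2 * inner ℝ (Φ (0, 1)) p := by
  have : z = z.1 • ((1, 0) : ℝ × ℝ) + z.2 • ((0, 1) : ℝ × ℝ) := by ext <;> simp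
  conv_lhs => rw [this]
  rw [map_add, map_smul, map_smul, inner_add_left, real_inner_smul_left, real_inner_smul_left]

namespace IsOptimalArc

variable (hΩ : IsOptimalArc Φ Ω c d u f) (hv : IsVariation c d f c₁ d₁ t₀ v g)
  (hf : StrictMonoOn f (Icc c d)) (hc : -1 < c) (hd : d < 1)
include hΩ hv hf hc hd

/-- Two effects add up: Ω changes while being measured by the moving disc, and the disc moves over
the fixed Ω. The first sees the points of the arc inside the unit disc, the second the part ∂B^IN of
the circle. -/
theorem tendsto_overlap : Tendsto (fun t => (area (perturb Φ Ω c d u v t ∩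
      Metric.closedBall (perturbCentre Φ c d u v t) (perturbRadius c d v t)) -
      area (Ω ∩ Metric.closedBall 0 1)) / t) (𝓝[>] 0)
    (𝓝 ((∫ x in Ioo c d, -(v x * if ‖Φ (x, u x)‖ < 1 then 1 else 0)) +
      ∫ θ in circleIn Ω, (-(∫ x in Ioo c d, v x) / (2 * Real.pi) +
        inner ℝ (-(Real.pi⁻¹ • Φ (∫ x in Ioo c d, v x * x, ∫ x in Ioo c d, v x * u x)))
          (circlePoint θ)))) := by
  have hK := hΩ.isCompact
  have hb := hasDerivAt_perturbCentre Φ c d u v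
  have hR := hasDerivAt_perturbRadius c d v
  have hb0 : perturbCentre Φ c d u v 0 = 0 := perturbCentre_zero Φ c d u v
  have hR0 : perturbRadius c d v 0 = 1 := perturbRadius_zero c d v
  set V := ∫ x in Ioo c d, v x
  set β := -(Real.pi⁻¹ • Φ (∫ x in Ioo c d, v x * x, ∫ x in Ioo c d, v x * u x))
  set b := perturbCentre Φ c d u v
  set R := perturbRadius c d v
  have hind : ∀ t (L : Set Plane), IsCompact L → ∫ p in L,
      (Metric.closedBall (b t) (R t)).indicator (1 : Plane → ℝ) p =
      area (L ∩ Metric.closedBall (b t) (R t)) := fun t L _ => by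
    rw [setIntegral_indicator Metric.isClosed_closedBall.measurableSet, ← setIntegral_one_eq_area]
    rfl
  have hii : ∀ t (L : Set Plane), IsCompact L → IntegrableOn
      ((Metric.closedBall (b t) (R t)).indicator (1 : Plane → ℝ)) L := fun t L hL =>
    Integrable.indicator (integrableOn_const (C := (1 : ℝ)) hL.measure_lt_top.ne)
      Metric.isClosed_closedBall.measurableSet
  have hsmall := nhdsWithin_le_nhds (s := Ioi 0) (hΩ.eventually_small hv)
  have T1 : Tendsto (fun t => ∫ x in Ioo c d, (∫ y in (u x + t * v x)..u x,
      (Metric.closedBall (b t) (R t)).indicator (1 : Plane → ℝ) (Φ (x, y))) / t) (𝓝[>] 0)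
      (𝓝 (∫ x in Ioo c d, -(v x * if ‖Φ (x, u x)‖ < 1 then 1 else 0))) := by
    apply tendsto_integral_filter_of_dominated_convergence (fun x => |v x|)
    · filter_upwards [hsmall] with t ht
      exact ((integrableOn_sub_of_isEpiOn hΩ.frame hK.measurableSet
        (hΩ.isCompact_perturb hv ht).measurableSet (hΩ.arc.isEpiOn hΩ.convex)
        ((hΩ.isLowerArc_perturb hv ht).isEpiOn (hΩ.convex_perturb hv ht)) (hii t _ hK)
        (hii t _ (hΩ.isCompact_perturb hv ht))).div_const t).1
    · filter_upwards [self_mem_nhdsWithin] with t ht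
      have ht0 : 0 < t := ht
      refine Eventually.of_forall fun x => ?_
      rw [Real.norm_eq_abs, abs_div, div_le_iff₀ (abs_pos.2 ht0.ne'), mul_comm |v x|]
      exact abs_integral_indicator_le _ x (u x) t (v x)
    · exact hv.integrable_v.abs
    -- The pointwise limit is available where the arc is off the circle, which is almost everywhere.
    · have h0 : ∀ᵐ x, x ∉ {x ∈ Ioo c d | ‖Φ (x, u x)‖ = 1} :=
        measure_eq_zero_iff_ae_notMem.1 (hΩ.volume_norm_eq_one hf hc hd)
      filter_upwards [ae_restrict_of_ae h0, ae_restrict_mem measurableSet_Ioo] with x hx hxI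
      exact tendsto_integral_indicator_div hb.continuousAt hR.continuousAt hb0 hR0
        (fun h => hx ⟨hxI, h⟩) (v x)
  -- Almost no circle point lies on ∂Ω, so the outer and inner limits of the indicator agree and the
  -- one-sided derivative becomes linear in the velocity.
  have hχ : ∀ᵐ θ, θ ∈ Ioo (-Real.pi) Real.pi →
      (∀ᶠ r : ℝ in 𝓝[>] 1, Ω.indicator (1 : Plane → ℝ) (r • circlePoint θ) =
        Ω.indicator 1 (circlePoint θ)) ∧
      ∀ᶠ r : ℝ in 𝓝[<] 1, Ω.indicator (1 : Plane → ℝ) (r • circlePoint θ) =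
        Ω.indicator 1 (circlePoint θ) := by
    filter_upwards [hΩ.ae_notMem_frontier hf hc hd] with θ hθ hθI
    have h1 := indicator_ray_eventually (A := univ) hK hΩ.convex hΩ.zero_mem_interior
      (θ := θ) (Or.inl univ_mem)
    rw [inter_univ, inter_univ] at h1
    have h2 : (interior Ω).indicator (1 : Plane → ℝ) (circlePoint θ) =
        Ω.indicator 1 (circlePoint θ) := by
      by_cases h : circlePoint θ ∈ Ω
      · have h3 : circlePoint θ ∈ interior Ω := by
          by_contra h3
          exact hθ hθI ⟨subset_closure h, h3⟩
        rw [indicator_of_mem h, indicator_of_mem h3]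
      · rw [indicator_of_notMem h, indicator_of_notMem fun h3 => h (interior_subset h3)]
    rwa [h2] at h1
  have T2 := tendsto_area_inter_closedBall hK.measurableSet hχ hb hR hb0 hR0
  have e2 : ∫ θ in Ioo (-Real.pi) Real.pi, (Ω.indicator 1 (circlePoint θ) *
      max (-V / (2 * Real.pi) + inner ℝ β (circlePoint θ)) 0 - Ω.indicator 1 (circlePoint θ) *
      max (-(-V / (2 * Real.pi) + inner ℝ β (circlePoint θ))) 0) =
      ∫ θ in circleIn Ω, (-V / (2 * Real.pi) + inner ℝ β (circlePoint θ)) := by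
    rw [← setIntegral_circleIn_eq hK]
    · congr 1
      ext θ
      rw [← mul_sub]
      congr 1
      rcases le_total 0 (-V / (2 * Real.pi) + inner ℝ β (circlePoint θ)) with h | h
      · rw [max_eq_left h, max_eq_right (by linarith), sub_zero]
      · rw [max_eq_right h, max_eq_left (by linarith)]; ring
    · intro θ
      simp only
      rw [circlePoint_periodic]
  rw [e2] at T2
  refine (T1.add T2).congr' ?_
  filter_upwards [hsmall] with t ht
  have h := setIntegral_sub_of_isEpiOn hΩ.frame hK.measurableSet
    (hΩ.isCompact_perturb hv ht).measurableSet (hΩ.arc.isEpiOn hΩ.convex)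
    ((hΩ.isLowerArc_perturb hv ht).isEpiOn (hΩ.convex_perturb hv ht))
    (hΩ.perturb_diff_strip hv ht) (hii t _ hK) (hii t _ (hΩ.isCompact_perturb hv ht))
  rw [hind t _ hK, hind t _ (hΩ.isCompact_perturb hv ht)] at h
  rw [integral_div, ← h]
  ring

/-- First-order optimality, one-sided. -/
theorem first_variation_nonneg : 0 ≤ (∫ x in Ioo c d, f x / √(1 + f x ^ 2) * g x) +
    ∫ x in Ioo c d, v x * prescribedCurvature Φ Ω u x := by
  have hl := hΩ.baryAsymmetry_pos
  have hδ := hΩ.isoDeficit_pos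
  have T1 := tendsto_div_of_hasDerivAt (hΩ.hasDerivAt_smoothPart hv)
  have T2 := (hΩ.tendsto_overlap hv hf hc hd).const_mul (4 * isoDeficit Ω)
  have hF0 := hΩ.smoothPart_zero (f := f) (v := v) (g := g)
  have h1 := ge_of_tendsto (T1.add T2) (by
    filter_upwards [self_mem_nhdsWithin, nhdsWithin_le_nhds (hΩ.smoothPart_nonneg hv)]
      with t ht h
    have ht0 : 0 < t := ht
    rw [← mul_div_assoc, ← add_div]
    apply div_nonneg _ ht0.le
    linarith)
  rw [setIntegral_circleIn_inner] at h1
  have hiu : IntegrableOn (fun x => v x * u x) (Ioo c d) := hv.integrable_mul hΩ.continuousOn_u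
  have hix : IntegrableOn (fun x => v x * x) (Ioo c d) := hv.integrable_mul continuousOn_id
  have hmeas : MeasurableSet {x ∈ Ioo c d | ‖Φ (x, u x)‖ < 1} := by
    have hcont : ContinuousOn (fun x => ‖Φ (x, u x)‖) (Ioo c d) :=
      (Φ.continuous.comp_continuousOn (continuousOn_id.prodMk
        (hΩ.continuousOn_u.mono Ioo_subset_Icc_self))).norm
    exact (hcont.isOpen_inter_preimage isOpen_Ioo isOpen_Iio).measurableSet
  have hiH : IntegrableOn (fun x => v x * if ‖Φ (x, u x)‖ < 1 then (1 : ℝ) else 0) (Ioo c d) := by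
    have h2 : IntegrableOn ({x ∈ Ioo c d | ‖Φ (x, u x)‖ < 1}.indicator v) (Ioo c d) :=
      Integrable.indicator hv.integrable_v hmeas
    refine h2.congr_fun (fun x hx => ?_) measurableSet_Ioo
    by_cases h : ‖Φ (x, u x)‖ < 1
    · rw [indicator_of_mem (show x ∈ {x ∈ Ioo c d | ‖Φ (x, u x)‖ < 1} from ⟨hx, h⟩)]
      simp [h]
    · rw [indicator_of_notMem fun h' => h h'.2]
      simp [h]
  have hexp : ∫ x in Ioo c d, v x * prescribedCurvature Φ Ω u x =
      (1 - 3 * isoDeficit Ω + 8 * isoDeficit Ω / baryAsymmetry Ω *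
        (1 - volume.real (circleIn Ω) / (2 * Real.pi))) * (∫ x in Ioo c d, v x) -
      8 * isoDeficit Ω / baryAsymmetry Ω * ((∫ x in Ioo c d, v x * if ‖Φ (x, u x)‖ < 1 then 1
        else 0) + (inner ℝ (Φ (1, 0)) (circleMoment Ω) * (∫ x in Ioo c d, v x * x) +
          inner ℝ (Φ (0, 1)) (circleMoment Ω) * ∫ x in Ioo c d, v x * u x) / Real.pi) := by
    have j1 : IntegrableOn (fun x => inner ℝ (Φ (1, 0)) (circleMoment Ω) * (v x * x) +
        inner ℝ (Φ (0, 1)) (circleMoment Ω) * (v x * u x)) (Ioo c d) :=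
      (hix.const_mul _).add (hiu.const_mul _)
    have j2 : IntegrableOn (fun x => (v x * if ‖Φ (x, u x)‖ < 1 then 1 else 0) +
        (inner ℝ (Φ (1, 0)) (circleMoment Ω) * (v x * x) +
        inner ℝ (Φ (0, 1)) (circleMoment Ω) * (v x * u x)) / Real.pi) (Ioo c d) :=
      hiH.add (j1.div_const _)
    rw [← integral_const_mul, ← integral_const_mul (inner ℝ (Φ (1, 0)) (circleMoment Ω)),
      ← integral_const_mul (inner ℝ (Φ (0, 1)) (circleMoment Ω)),
      ← integral_add (hix.const_mul _) (hiu.const_mul _), ← integral_div,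
      ← integral_add hiH (j1.div_const _), ← integral_const_mul,
      ← integral_sub (hv.integrable_v.const_mul _) (j2.const_mul _)]
    congr 1
    ext x
    rw [prescribedCurvature, IsFrame.inner_apply Φ (x, u x)]
    ring
  rw [hexp]
  rw [integral_neg, inner_neg_left, real_inner_smul_left, IsFrame.inner_apply] at h1
  simp only at h1
  have hpi := Real.pi_pos
  refine nonneg_of_mul_nonneg_right (a := baryAsymmetry Ω / 2) (h1.trans (le_of_eq ?_))
    (by positivity)
  field_simp
  ring

/-- The weak form of the curvature equation. -/
theorem first_variation_eq_zero : (∫ x in Ioo c d, f x / √(1 + f x ^ 2) * g x) +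
    ∫ x in Ioo c d, v x * prescribedCurvature Φ Ω u x = 0 := by
  have h1 := hΩ.first_variation_nonneg hv hf hc hd
  -- The expression is linear in the variation, and -v is a variation too.
  have h2 := hΩ.first_variation_nonneg hv.neg hf hc hd
  simp only [mul_neg, neg_mul] at h2
  rw [integral_neg, integral_neg] at h2
  linarith

end IsOptimalArc

end

section

variable {Φ : (ℝ × ℝ) ≃L[ℝ] Plane} {Ω : Set Plane} {c d c₁ d₁ : ℝ} {u f : ℝ → ℝ}

/-! ### Slopes as a parameter -/

/-- A measurable left inverse of a strictly monotone function on an interval. -/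
theorem exists_measurable_leftInverse (hf : StrictMonoOn f (Icc c d)) :
    ∃ k : ℝ → ℝ, Measurable k ∧ ∀ x ∈ Icc c d, k (f x) = x := by
  set k : ℝ → ℝ := fun s => sSup (insert c {x ∈ Icc c d | f x ≤ s}) with hk
  have hbdd : ∀ s, BddAbove (insert c {x ∈ Icc c d | f x ≤ s}) := fun s =>
    ⟨max c d, by
      rintro x (rfl | hx)
      · exact le_max_left _ _
      · exact hx.1.2.trans (le_max_right _ _)⟩
  refine ⟨k, Monotone.measurable fun s t hst => ?_, fun x hx => ?_⟩
  · exact csSup_le_csSup (hbdd t) (insert_nonempty _ _)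
      (insert_subset_insert fun y hy => ⟨hy.1, hy.2.trans hst⟩)
  · refine IsGreatest.csSup_eq ⟨Or.inr ⟨hx, le_rfl⟩, ?_⟩
    rintro y (rfl | hy)
    · exact hx.1
    · exact (hf.le_iff_le hy.1 hx).1 hy.2

/-- A du Bois-Reymond lemma in the slope variable. As `f` is injective, `H` is a function of f(x),
and the fundamental lemma of the calculus of variations is applied to the image of Lebesgue measure
under `f`; no continuity of `f` is needed. -/
theorem ae_eq_const_of_integral_slope_eq_zero (hf : StrictMonoOn f (Icc c d)) (hc : c < c₁)
    (h1 : c₁ < d₁) (hd : d₁ < d) {H : ℝ → ℝ} (hH : IntegrableOn H (Ioo c d))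
    (h : ∀ (ζ : ℝ → ℝ) (L : ℝ≥0), LipschitzWith L ζ → (∀ s ≤ f c₁, ζ s = 0) →
      (∀ s, f d₁ ≤ s → ζ s = 0) → ∫ x in Ioo c d, ζ (f x) = 0 →
      ∫ x in Ioo c d, H x * ζ (f x) = 0) :
    ∃ k, ∀ᵐ x, x ∈ Ioo c₁ d₁ → H x = k := by
  have hcd : c < d := by linarith
  have hc₁ : c₁ ∈ Icc c d := ⟨hc.le, by linarith⟩
  have hd₁ : d₁ ∈ Icc c d := ⟨by linarith, hd.le⟩
  set ζ₁ := tent (f c₁) (f d₁) with hζ₁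
  have hA : 0 < ∫ x in Ioo c d, ζ₁ (f x) := by
    have := integral_tent_pos hf hc₁ hd₁ h1
    rwa [intervalIntegral.integral_of_le hcd.le, integral_Ioc_eq_integral_Ioo] at this
  set A := ∫ x in Ioo c d, ζ₁ (f x) with hAdef
  -- The multiplier of the mean-zero constraint, computed with one fixed tent.
  set k := (∫ x in Ioo c d, H x * ζ₁ (f x)) / A with hk
  refine ⟨k, ?_⟩
  have hfm : AEMeasurable f (volume.restrict (Ioo c d)) :=
    ((hf.monotoneOn.integrableOn_isCompact (μ := volume) isCompact_Icc).mono_set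
      Ioo_subset_Icc_self).1.aemeasurable
  obtain ⟨ι, hι, hιf⟩ := exists_measurable_leftInverse hf
  have hicomp : ∀ ζ : ℝ → ℝ, Continuous ζ → IntegrableOn (fun x => ζ (f x)) (Ioo c d) :=
    fun ζ hζ => (integrable_comp_slope hζ hf.monotoneOn).mono_set Ioo_subset_Icc_self
  have hiH : ∀ ζ : ℝ → ℝ, Continuous ζ → (∃ C, ∀ s, |ζ s| ≤ C) →
      IntegrableOn (fun x => H x * ζ (f x)) (Ioo c d) := by
    rintro ζ hζ ⟨C, hC⟩
    exact hH.mul_bdd (c := C) (hicomp ζ hζ).1 (Eventually.of_forall fun x => hC (f x))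
  have hζ₁b : ∃ C, ∀ s, |ζ₁ s| ≤ C := by
    refine ⟨max 0 (f d₁ - f c₁), fun s => ?_⟩
    rw [abs_of_nonneg (tent_nonneg _ _ _)]
    apply max_le (le_max_left _ _)
    rcases le_total s (f d₁) with hs | hs
    · exact (min_le_left _ _).trans (le_trans (by linarith) (le_max_right _ _))
    · exact (min_le_right _ _).trans (le_trans (by linarith) (le_max_left _ _))
  have hζ₁c : Continuous ζ₁ := (lipschitzWith_tent _ _).continuous
  have key : ∀ ζ : ℝ → ℝ, ContDiff ℝ (⊤ : ℕ∞) ζ → HasCompactSupport ζ →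
      tsupport ζ ⊆ Ioo (f c₁) (f d₁) → ∫ x in Ioo c d, (H x - k) * ζ (f x) = 0 := by
    intro ζ hζ hζs hζt
    have hz : ∀ s, s ∉ Ioo (f c₁) (f d₁) → ζ s = 0 := fun s hs =>
      image_eq_zero_of_notMem_tsupport fun h => hs (hζt h)
    obtain ⟨L, hL⟩ := ContDiff.lipschitzWith_of_hasCompactSupport hζs hζ (by simp)
    have hζb : ∃ C, ∀ s, |ζ s| ≤ C := by
      obtain ⟨C, hC⟩ := hζs.exists_bound_of_continuous hζ.continuous
      exact ⟨C, hC⟩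
    -- Subtracting r times the tent gives an arbitrary test function mean zero without leaving the
    -- class.
    set r := (∫ x in Ioo c d, ζ (f x)) / A with hr
    have hLip : LipschitzWith (L + ‖r‖₊ * 1) fun s => ζ s - r * ζ₁ s :=
      hL.sub ((lipschitzWith_smul r).comp (lipschitzWith_tent (f c₁) (f d₁)))
    have h2 := h _ _ hLip
      (fun s hs => by
        rw [hz s fun h => not_lt.2 hs h.1, hζ₁, tent_of_le hs]; ring)
      (fun s hs => by
        rw [hz s fun h => not_lt.2 hs h.2, hζ₁, tent_of_ge hs]; ring)
      (by
        rw [integral_sub (hicomp _ hζ.continuous) ((hicomp _ hζ₁c).const_mul r),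
          integral_const_mul, ← hAdef, hr]
        field_simp
        ring)
    have e1 : ∀ x, H x * (ζ (f x) - r * ζ₁ (f x)) = H x * ζ (f x) - r * (H x * ζ₁ (f x)) :=
      fun x => by ring
    simp_rw [e1] at h2
    rw [integral_sub (hiH _ hζ.continuous hζb) ((hiH _ hζ₁c hζ₁b).const_mul r),
      integral_const_mul] at h2
    simp_rw [sub_mul]
    rw [integral_sub (hiH _ hζ.continuous hζb) ((hicomp _ hζ.continuous).const_mul k),
      integral_const_mul]
    rw [← h2, hr, hk]
    ring
  set μ := Measure.map f (volume.restrict (Ioo c d)) with hμ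
  set H' := hH.1.mk H with hH'
  -- `H - k` written as a function of the slope; a strongly measurable representative of `H` is
  -- composed with the measurable left inverse of `f`.
  set F : ℝ → ℝ := fun s => H' (ι s) - k with hF
  have hFm : StronglyMeasurable F :=
    (hH.1.stronglyMeasurable_mk.comp_measurable hι).sub stronglyMeasurable_const
  have hFf : (fun x => F (f x)) =ᵐ[volume.restrict (Ioo c d)] fun x => H x - k := by
    filter_upwards [hH.1.ae_eq_mk, ae_restrict_mem measurableSet_Ioo] with x hx hxm
    simp only [hF]
    rw [hιf x (Ioo_subset_Icc_self hxm), hH', ← hx]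
  have hFi : Integrable F μ := by
    rw [hμ, integrable_map_measure hFm.aestronglyMeasurable hfm]
    have : Integrable (fun x => H x - k) (volume.restrict (Ioo c d)) :=
      hH.sub (integrableOn_const (by simp))
    exact this.congr hFf.symm
  have hzero := isOpen_Ioo.ae_eq_zero_of_integral_contDiff_smul_eq_zero (μ := μ) (f := F)
    (U := Ioo (f c₁) (f d₁)) (hFi.locallyIntegrable.locallyIntegrableOn _) (by
      intro ζ hζ hζs hζt
      have hm : AEStronglyMeasurable (fun s => ζ s • F s)
          (Measure.map f (volume.restrict (Ioo c d))) :=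
        hζ.continuous.aestronglyMeasurable.smul hFm.aestronglyMeasurable
      rw [hμ, integral_map hfm hm, ← key ζ hζ hζs hζt]
      apply integral_congr_ae
      filter_upwards [hFf] with x hx
      rw [hx, smul_eq_mul, mul_comm])
  have h3 := ae_of_ae_map hfm hzero
  rw [EventuallyEq] at hFf
  have h4 : ∀ᵐ x ∂volume.restrict (Ioo c d), x ∈ Ioo c₁ d₁ → H x = k := by
    filter_upwards [h3, hFf, ae_restrict_mem measurableSet_Ioo] with x hx hx2 hxm hx1
    have hxI := Ioo_subset_Icc_self hxm
    have := hx ⟨hf hc₁ hxI hx1.1, hf hxI hd₁ hx1.2⟩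
    rw [this] at hx2
    linarith
  rw [ae_restrict_iff' measurableSet_Ioo] at h4
  filter_upwards [h4] with x hx hx1
  exact hx ⟨hc.trans hx1.1, hx1.2.trans hd⟩ hx1

/-! ### Integration by parts -/

theorem lipschitzOnWith_primitive {κ : ℝ → ℝ} {C : ℝ≥0} (hκ : IntegrableOn κ (Icc c d))
    (hC : ∀ x ∈ Icc c d, |κ x| ≤ C) :
    LipschitzOnWith C (fun x => ∫ s in c..x, κ s) (Icc c d) := by
  refine LipschitzOnWith.of_dist_le_mul fun x hx y hy => ?_
  have hcd : c ≤ d := hx.1.trans hx.2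
  have hi : ∀ z ∈ Icc c d, IntervalIntegrable κ volume c z := fun z hz =>
    (hκ.mono_set (uIcc_subset_Icc (left_mem_Icc.2 hcd) hz)).intervalIntegrable
  rw [Real.dist_eq, Real.dist_eq, intervalIntegral.integral_interval_sub_left (hi x hx) (hi y hy)]
  exact intervalIntegral.norm_integral_le_of_norm_le_const (f := κ) (C := C) fun s hs =>
    hC s (uIcc_subset_Icc hy hx (uIoc_subset_uIcc hs))

/-- Both primitives are Lipschitz, hence absolutely continuous, and the boundary terms vanish
because v(c) = v(d) = 0. -/
theorem integral_mul_primitive {v g κ : ℝ → ℝ} {C D : ℝ≥0} (hcd : c ≤ d)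
    (hκ : IntegrableOn κ (Icc c d)) (hC : ∀ x ∈ Icc c d, |κ x| ≤ C)
    (hg : IntegrableOn g (Icc c d)) (hD : ∀ x ∈ Icc c d, |g x| ≤ D)
    (hv : ∀ x, v x = ∫ s in c..x, g s) (hvd : v d = 0) :
    ∫ x in c..d, v x * κ x = -∫ x in c..d, (∫ s in c..x, κ s) * g x := by
  set Q : ℝ → ℝ := fun x => ∫ s in c..x, κ s with hQ
  have hv' : v = fun x => ∫ s in c..x, g s := funext hv
  have hvc : v c = 0 := by rw [hv]; simp
  have a1 : AbsolutelyContinuousOnInterval Q c d := by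
    apply LipschitzOnWith.absolutelyContinuousOnInterval
    rw [uIcc_of_le hcd]
    exact lipschitzOnWith_primitive hκ hC
  have a2 : AbsolutelyContinuousOnInterval v c d := by
    apply LipschitzOnWith.absolutelyContinuousOnInterval
    rw [uIcc_of_le hcd, hv']
    exact lipschitzOnWith_primitive hg hD
  have iκ : IntervalIntegrable κ volume c d :=
    (intervalIntegrable_iff_integrableOn_Icc_of_le hcd).2 hκ
  have ig : IntervalIntegrable g volume c d :=
    (intervalIntegrable_iff_integrableOn_Icc_of_le hcd).2 hg
  have key := a2.integral_mul_deriv_eq_deriv_mul a1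
  rw [hvd, hvc, zero_mul, zero_mul, sub_zero, zero_sub] at key
  have hcm : c ∈ uIcc c d := left_mem_uIcc
  have e1 : ∫ x in c..d, v x * deriv Q x = ∫ x in c..d, v x * κ x := by
    apply intervalIntegral.integral_congr_ae
    filter_upwards [iκ.ae_hasDerivAt_integral] with x hx hxm
    rw [(hx (uIoc_subset_uIcc hxm) c hcm).deriv]
  have e2 : ∫ x in c..d, deriv v x * Q x = ∫ x in c..d, Q x * g x := by
    apply intervalIntegral.integral_congr_ae
    filter_upwards [ig.ae_hasDerivAt_integral] with x hx hxm
    rw [hv', (hx (uIoc_subset_uIcc hxm) c hcm).deriv, mul_comm]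
  rw [← e1, key, e2]

end

section

variable {Φ : (ℝ × ℝ) ≃L[ℝ] Plane} {Ω : Set Plane} {c d c₁ d₁ : ℝ} {u f : ℝ → ℝ}

/-! ### Regularity -/

theorem sq_div_sqrt_one_add_sq (s : ℝ) : (s / √(1 + s ^ 2)) ^ 2 = s ^ 2 / (1 + s ^ 2) := by
  rw [div_pow, Real.sq_sqrt (by positivity)]

/-- The slope as a function of the sine of the angle. -/
def slopeOfSine (s : ℝ) : ℝ := s / √(1 - s ^ 2)

theorem slopeOfSine_div_sqrt (s : ℝ) : slopeOfSine (s / √(1 + s ^ 2)) = s := by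
  have h : 0 < 1 + s ^ 2 := by positivity
  have h1 : 1 - (s / √(1 + s ^ 2)) ^ 2 = (1 + s ^ 2)⁻¹ := by
    rw [sq_div_sqrt_one_add_sq]; field_simp; ring
  rw [slopeOfSine, h1, Real.sqrt_inv]
  field_simp

theorem one_add_slopeOfSine_sq {s : ℝ} (hs : s ^ 2 < 1) :
    1 + slopeOfSine s ^ 2 = (1 - s ^ 2)⁻¹ := by
  have h : 0 < 1 - s ^ 2 := by linarith
  rw [slopeOfSine, div_pow, Real.sq_sqrt h.le]
  field_simp
  ring

/-- The derivative, expressed through the slope, is the factor (1 + w²)^(3/2) of the curvature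
formula: differentiating the sine of the slope angle gives the curvature of the graph. -/
theorem hasDerivAt_slopeOfSine {s : ℝ} (hs : s ^ 2 < 1) :
    HasDerivAt slopeOfSine (√(1 + slopeOfSine s ^ 2) ^ 3) s := by
  have h : 0 < 1 - s ^ 2 := by linarith
  have h0 : HasDerivAt (fun s : ℝ => 1 - s ^ 2) (-(2 * s)) s := by
    simpa using ((hasDerivAt_id s).pow 2).const_sub 1
  have h1 : HasDerivAt slopeOfSine _ s := (hasDerivAt_id s).div (h0.sqrt h.ne')
    (Real.sqrt_pos.2 h).ne'
  refine h1.congr_deriv ?_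
  rw [one_add_slopeOfSine_sq hs, Real.sqrt_inv]
  have h2 := Real.sq_sqrt h.le
  have h3 := (Real.sqrt_pos.2 h).ne'
  simp only [id]
  field_simp
  linear_combination h2

theorem contDiffAt_slopeOfSine {s : ℝ} (hs : s ^ 2 < 1) : ContDiffAt ℝ 1 slopeOfSine s := by
  have h : 0 < 1 - s ^ 2 := by linarith
  exact contDiffAt_id.div ((contDiffAt_const.sub (contDiffAt_id.pow 2)).sqrt h.ne')
    (Real.sqrt_pos.2 h).ne'

theorem monotone_div_sqrt : Monotone fun s : ℝ => s / √(1 + s ^ 2) := by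
  apply monotone_of_deriv_nonneg
  · intro s
    have h0 : HasDerivAt (fun s : ℝ => s / √(1 + s ^ 2)) _ s :=
      (hasDerivAt_id s).div (hasDerivAt_sqrt_one_add_sq s) (by positivity)
    exact h0.differentiableAt
  · intro s
    have h0 : HasDerivAt (fun s : ℝ => s / √(1 + s ^ 2)) _ s :=
      (hasDerivAt_id s).div (hasDerivAt_sqrt_one_add_sq s) (by positivity)
    rw [h0.deriv]
    simp only [id]
    apply div_nonneg _ (sq_nonneg _)
    have h1 : 0 < √(1 + s ^ 2) := by positivity
    have h2 : √(1 + s ^ 2) ^ 2 = 1 + s ^ 2 := Real.sq_sqrt (by positivity)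
    rw [one_mul, sub_nonneg, ← mul_div_assoc, div_le_iff₀ h1]
    nlinarith

theorem sq_div_sqrt_lt_one (s : ℝ) : (s / √(1 + s ^ 2)) ^ 2 < 1 := by
  rw [sq_div_sqrt_one_add_sq, div_lt_one (by positivity)]
  linarith

/-- If the sine of the slope angle agrees almost everywhere with a Lipschitz function `W`, then
`u` is of class `C^{1,1}`. -/
theorem IsSubgradOn.regularity (h : IsSubgradOn u f c d) (hc : c < c₁) (h1 : c₁ < d₁)
    (hd : d₁ < d) {W : ℝ → ℝ} {C : ℝ≥0} (hW : LipschitzOnWith C W (Icc c d))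
    (hae : ∀ᵐ x, x ∈ Ioo c₁ d₁ → f x / √(1 + f x ^ 2) = W x) :
    (∀ x ∈ Ioo c₁ d₁, W x ^ 2 < 1) ∧
    (∀ x ∈ Ioo c₁ d₁, HasDerivAt u (slopeOfSine (W x)) x) ∧
    ∃ D : ℝ≥0, LipschitzOnWith D (fun x => slopeOfSine (W x)) (Ioo c₁ d₁) := by
  have hsub : Ioo c₁ d₁ ⊆ Icc c d := fun x hx => ⟨hc.le.trans hx.1.le, hx.2.le.trans hd.le⟩
  have hc₁ : c₁ ∈ Icc c d := ⟨hc.le, by linarith⟩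
  have hd₁ : d₁ ∈ Icc c d := ⟨by linarith, hd.le⟩
  set p := f c₁ / √(1 + f c₁ ^ 2) with hp
  set q := f d₁ / √(1 + f d₁ ^ 2) with hq
  have hsq : ∀ s ∈ Icc p q, s ^ 2 < 1 := by
    intro s hs
    have hp1 := sq_div_sqrt_lt_one (f c₁)
    have hq1 := sq_div_sqrt_lt_one (f d₁)
    rw [← hp] at hp1
    rw [← hq] at hq1
    rw [sq_lt_one_iff_abs_lt_one, abs_lt] at *
    exact ⟨hp1.1.trans_le hs.1, hs.2.trans_lt hq1.2⟩
  have hWc : ContinuousOn W (Ioo c₁ d₁) := hW.continuousOn.mono hsub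
  -- W equals the sine of the slope angle almost everywhere, so by continuity it stays everywhere
  -- between its values p and q for the end slopes, strictly inside (-1, 1). This rules out vertical
  -- tangents.
  have hWm : ∀ x ∈ Ioo c₁ d₁, W x ∈ Icc p q := by
    intro x hx
    by_contra hn
    have hopen : IsOpen (Ioo c₁ d₁ ∩ W ⁻¹' (Icc p q)ᶜ) :=
      hWc.isOpen_inter_preimage isOpen_Ioo isClosed_Icc.isOpen_compl
    have hpos := hopen.measure_pos volume ⟨x, hx, hn⟩
    refine hpos.ne' (measure_mono_null ?_ (ae_iff.1 hae))
    rintro y ⟨hy, hyn⟩ hy2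
    apply hyn
    show W y ∈ Icc p q
    rw [← hy2 hy]
    exact ⟨monotone_div_sqrt (h.monotoneOn hc₁ (hsub hy) hy.1.le),
      monotone_div_sqrt (h.monotoneOn (hsub hy) hd₁ hy.2.le)⟩
  have hsl : ∀ x ∈ Ioo c₁ d₁, W x ^ 2 < 1 := fun x hx => hsq _ (hWm x hx)
  have hτc : ContinuousOn (fun x => slopeOfSine (W x)) (Ioo c₁ d₁) := fun x hx =>
    (hasDerivAt_slopeOfSine (hsl x hx)).continuousAt.comp_continuousWithinAt (hWc x hx)
  refine ⟨hsl, ?_, ?_⟩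
  · intro x hx
    -- `u` is the primitive of a function almost everywhere equal to the continuous function
    -- `slopeOfSine ∘ W`, so its slope has no jumps.
    have e : ∀ y ∈ Ioo c₁ d₁, u y = u x + ∫ s in x..y, slopeOfSine (W s) := by
      intro y hy
      rw [eq_add_of_sub_eq' (h.integral_eq (hsub hx) (hsub hy)).symm]
      congr 1
      apply intervalIntegral.integral_congr_ae
      filter_upwards [hae] with s hs hsm
      have hsI : s ∈ Ioo c₁ d₁ := by
        have := uIoc_subset_uIcc hsm
        rw [mem_uIcc] at this
        rcases this with h | h
        · exact ⟨hx.1.trans_le h.1, h.2.trans_lt hy.2⟩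
        · exact ⟨hy.1.trans_le h.1, h.2.trans_lt hx.2⟩
      rw [← hs hsI, slopeOfSine_div_sqrt]
    have h2 : HasDerivAt (fun y => u x + ∫ s in x..y, slopeOfSine (W s)) (slopeOfSine (W x)) x := by
      refine HasDerivAt.const_add _ (intervalIntegral.integral_hasDerivAt_right (by simp) ?_ ?_)
      · exact hτc.stronglyMeasurableAtFilter isOpen_Ioo x hx
      · exact hτc.continuousAt (Ioo_mem_nhds hx.1 hx.2)
    refine h2.congr_of_eventuallyEq ?_
    filter_upwards [Ioo_mem_nhds hx.1 hx.2] with y hy using e y hy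
  · have hcd : ContDiffOn ℝ 1 slopeOfSine (Icc p q) := fun s hs =>
      (contDiffAt_slopeOfSine (hsq s hs)).contDiffWithinAt
    obtain ⟨D, hD⟩ := hcd.exists_lipschitzOnWith one_ne_zero (convex_Icc p q) isCompact_Icc
    exact ⟨D * C, hD.comp (hW.mono hsub) hWm⟩

theorem continuousAt_prescribedCurvature {x : ℝ} (hu : ContinuousAt u x)
    (hx : ‖Φ (x, u x)‖ ≠ 1) : ContinuousAt (prescribedCurvature Φ Ω u) x := by
  have hΦu : ContinuousAt (fun y => Φ (y, u y)) x :=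
    Φ.continuous.continuousAt.comp (continuousAt_id.prodMk hu)
  have hite : ContinuousAt (fun y => if ‖Φ (y, u y)‖ < 1 then (1 : ℝ) else 0) x := by
    rcases lt_or_gt_of_ne hx with h | h
    · refine (continuousAt_const (y := (1 : ℝ))).congr ?_
      filter_upwards [hΦu.norm.eventually (eventually_lt_nhds h)] with y hy
      rw [if_pos hy]
    · refine (continuousAt_const (y := (0 : ℝ))).congr ?_
      filter_upwards [hΦu.norm.eventually (eventually_gt_nhds h)] with y hy
      rw [if_neg (not_lt.2 hy.le)]
  unfold prescribedCurvature
  exact continuousAt_const.add (continuousAt_const.mul (((continuousAt_const.sub hite).sub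
    continuousAt_const).sub ((hΦu.inner continuousAt_const).div_const _)))

theorem prescribedCurvature_integrable (hu : ContinuousOn u (Icc c d)) :
    IntegrableOn (prescribedCurvature Φ Ω u) (Icc c d) ∧
    ∃ C : ℝ≥0, ∀ x ∈ Icc c d, |prescribedCurvature Φ Ω u x| ≤ C := by
  have hΦu : ContinuousOn (fun y => Φ (y, u y)) (Icc c d) :=
    Φ.continuous.comp_continuousOn (continuousOn_id.prodMk hu)
  set A := 8 * isoDeficit Ω / baryAsymmetry Ω with hA
  set κ₁ : ℝ → ℝ := fun x => 1 - 3 * isoDeficit Ω + A *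
    (1 - volume.real (circleIn Ω) / (2 * Real.pi)
      - inner ℝ (Φ (x, u x)) (circleMoment Ω) / Real.pi) with hκ₁
  have hκ₁c : ContinuousOn κ₁ (Icc c d) :=
    continuousOn_const.add (continuousOn_const.mul (continuousOn_const.sub
      ((hΦu.inner continuousOn_const).div_const _)))
  set H : ℝ → ℝ := fun x => if ‖Φ (x, u x)‖ < 1 then 1 else 0 with hH
  have e : ∀ x, prescribedCurvature Φ Ω u x = κ₁ x - A * H x := fun x => by
    rw [prescribedCurvature, hκ₁, hH]; ring
  have hHi : IntegrableOn H (Icc c d) := by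
    rw [integrableOn_Icc_iff_integrableOn_Ioo]
    have hmeas : MeasurableSet (Ioo c d ∩ (fun x => ‖Φ (x, u x)‖) ⁻¹' Iio 1) :=
      ((hΦu.mono Ioo_subset_Icc_self).norm.isOpen_inter_preimage isOpen_Ioo
        isOpen_Iio).measurableSet
    have h2 : IntegrableOn ((Ioo c d ∩ (fun x => ‖Φ (x, u x)‖) ⁻¹' Iio 1).indicator
        fun _ => (1 : ℝ)) (Ioo c d) :=
      Integrable.indicator (integrableOn_const (by simp)) hmeas
    refine h2.congr_fun (fun x hx => ?_) measurableSet_Ioo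
    by_cases h : ‖Φ (x, u x)‖ < 1
    · rw [indicator_of_mem (show x ∈ Ioo c d ∩ (fun x => ‖Φ (x, u x)‖) ⁻¹' Iio 1 from ⟨hx, h⟩)]
      simp [hH, h]
    · rw [indicator_of_notMem fun h' => h h'.2]
      simp [hH, h]
  constructor
  · have : IntegrableOn (fun x => κ₁ x - A * H x) (Icc c d) :=
      (hκ₁c.integrableOn_compact isCompact_Icc).sub (hHi.const_mul A)
    exact this.congr_fun (fun x _ => (e x).symm) measurableSet_Icc
  · obtain ⟨C, hC⟩ := isCompact_Icc.exists_bound_of_continuousOn hκ₁c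
    refine ⟨Real.toNNReal (C + |A|), fun x hx => le_trans ?_ (Real.le_coe_toNNReal _)⟩
    rw [e]
    refine (abs_sub _ _).trans (add_le_add (hC x hx) ?_)
    rw [abs_mul]
    refine mul_le_of_le_one_right (abs_nonneg _) ?_
    simp only [hH]
    split_ifs <;> simp

namespace IsOptimalArc

variable (hΩ : IsOptimalArc Φ Ω c d u f) (hf : StrictMonoOn f (Icc c d))
  (hc : -1 < c) (hd : d < 1)
include hΩ hf hc hd

/-- The sine of the slope angle is, up to a constant, a primitive of the prescribed curvature. -/
theorem exists_sine_eq (hc₁ : c < c₁) (h₁ : c₁ < d₁) (hd₁ : d₁ < d) : ∃ k, ∀ᵐ x, x ∈ Ioo c₁ d₁ →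
    f x / √(1 + f x ^ 2) = (∫ s in c..x, prescribedCurvature Φ Ω u s) + k := by
  obtain ⟨hκ, C, hC⟩ := prescribedCurvature_integrable (Φ := Φ) (Ω := Ω) hΩ.continuousOn_u
  set κ := prescribedCurvature Φ Ω u
  set Q : ℝ → ℝ := fun x => ∫ s in c..x, κ s with hQ
  have hQc : ContinuousOn Q (Icc c d) := (lipschitzOnWith_primitive hκ hC).continuousOn
  have hσ : Continuous fun s : ℝ => s / √(1 + s ^ 2) :=
    continuous_id.div (by fun_prop) fun s => by positivity
  have hi : IntegrableOn (fun x => f x / √(1 + f x ^ 2) - Q x) (Ioo c d) :=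
    ((integrable_comp_slope hσ hf.monotoneOn).sub
      (hQc.integrableOn_compact isCompact_Icc)).mono_set Ioo_subset_Icc_self
  have hcd : c ≤ d := hΩ.arc.lt.le
  -- The weak equation for the variation generated by ζ, integrated by parts.
  obtain ⟨k, hk⟩ := ae_eq_const_of_integral_slope_eq_zero hf hc₁ h₁ hd₁ hi (by
    intro ζ L hζ hl hr hint
    rw [← integral_Ioc_eq_integral_Ioo, ← intervalIntegral.integral_of_le hcd] at hint
    have hv := isVariation_of_lipschitz hζ hf.monotoneOn hc₁ h₁.le hd₁ hl hr hint
    have h2 := hΩ.first_variation_eq_zero hv hf hc hd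
    obtain ⟨D, hD⟩ := hv.bounded
    have h3 := integral_mul_primitive (C := C) (D := D.toNNReal) hcd hκ hC hv.integrableOn
      (fun x hx => (hD x hx).trans (Real.le_coe_toNNReal _)) (fun _ => rfl) hint
    rw [intervalIntegral.integral_of_le hcd, intervalIntegral.integral_of_le hcd,
      integral_Ioc_eq_integral_Ioo, integral_Ioc_eq_integral_Ioo] at h3
    rw [h3] at h2
    have i1 : IntegrableOn (fun x => f x / √(1 + f x ^ 2) * ζ (f x)) (Ioo c d) :=
      (integrable_comp_slope (hσ.mul hζ.continuous) hf.monotoneOn).mono_set Ioo_subset_Icc_self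
    have i2 : IntegrableOn (fun x => Q x * ζ (f x)) (Ioo c d) :=
      (hv.integrableOn.continuousOn_mul hQc isCompact_Icc).mono_set Ioo_subset_Icc_self
    simp_rw [sub_mul]
    rw [integral_sub i1 i2]
    linarith)
  refine ⟨k, ?_⟩
  filter_upwards [hk] with x hx hxm
  linarith [hx hxm]

/-- Strictly convex arcs of an optimal set are `C^{1,1}`, and off the circle they are `C²` with
the prescribed curvature. -/
theorem exists_slope (hc₁ : c < c₁) (h₁ : c₁ < d₁) (hd₁ : d₁ < d) : ∃ w : ℝ → ℝ,
    (∀ x ∈ Ioo c₁ d₁, HasDerivAt u (w x) x) ∧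
    (∃ D : ℝ≥0, LipschitzOnWith D w (Ioo c₁ d₁)) ∧
    ∀ x ∈ Ioo c₁ d₁, ‖Φ (x, u x)‖ ≠ 1 → ContDiffAt ℝ 2 u x ∧
      HasDerivAt w (prescribedCurvature Φ Ω u x * √(1 + w x ^ 2) ^ 3) x := by
  obtain ⟨k, hk⟩ := hΩ.exists_sine_eq hf hc hd hc₁ h₁ hd₁
  obtain ⟨hκ, C, hC⟩ := prescribedCurvature_integrable (Φ := Φ) (Ω := Ω) hΩ.continuousOn_u
  set κ := prescribedCurvature Φ Ω u with hκdef
  set W : ℝ → ℝ := fun x => (∫ s in c..x, κ s) + k with hW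
  have hWL : LipschitzOnWith C W (Icc c d) := by
    have h2 := lipschitzOnWith_primitive hκ hC
    refine LipschitzOnWith.of_dist_le_mul fun x hx y hy => ?_
    have := h2.dist_le_mul x hx y hy
    simpa [hW] using this
  obtain ⟨hsq, hder, hLip⟩ := hΩ.arc.isSubgradOn.regularity hc₁ h₁ hd₁ hWL hk
  refine ⟨fun x => slopeOfSine (W x), hder, hLip, ?_⟩
  have hcd : c ≤ d := hΩ.arc.lt.le
  have hW' : ∀ x ∈ Ioo c₁ d₁, ‖Φ (x, u x)‖ ≠ 1 → HasDerivAt (fun x => slopeOfSine (W x))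
      (κ x * √(1 + slopeOfSine (W x) ^ 2) ^ 3) x := by
    intro x hx hn
    have hxI : x ∈ Ioo c d := ⟨hc₁.trans hx.1, hx.2.trans hd₁⟩
    have h2 : HasDerivAt W (κ x) x := by
      refine HasDerivAt.add_const _ (intervalIntegral.integral_hasDerivAt_right ?_ ?_ ?_)
      · exact (hκ.mono_set (uIcc_subset_Icc (left_mem_Icc.2 hcd)
          (Ioo_subset_Icc_self hxI))).intervalIntegrable
      · exact ⟨Icc c d, Icc_mem_nhds hxI.1 hxI.2, hκ.1⟩
      · exact continuousAt_prescribedCurvature (hder x hx).continuousAt hn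
    have h3 := (hasDerivAt_slopeOfSine (hsq x hx)).comp x h2
    exact h3.congr_deriv (mul_comm _ _)
  intro x hx hn
  refine ⟨?_, hW' x hx hn⟩
  -- The abscissae off the circle form an open set on which the prescribed curvature is continuous,
  -- so w is C¹ and `u` is C² there.
  set V : Set ℝ := Ioo c₁ d₁ ∩ (fun x => ‖Φ (x, u x)‖) ⁻¹' {1}ᶜ with hV
  have huc : ContinuousOn u (Ioo c₁ d₁) := fun y hy => (hder y hy).continuousAt.continuousWithinAt
  have hVo : IsOpen V :=
    (Φ.continuous.comp_continuousOn (continuousOn_id.prodMk huc)).norm.isOpen_inter_preimage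
      isOpen_Ioo isOpen_compl_singleton
  have hw1 : ContDiffOn ℝ 1 (fun x => slopeOfSine (W x)) V := by
    rw [show (1 : WithTop ℕ∞) = 0 + 1 by rw [zero_add], contDiffOn_succ_iff_deriv_of_isOpen hVo]
    refine ⟨fun y hy => (hW' y hy.1 hy.2).differentiableAt.differentiableWithinAt, by simp, ?_⟩
    rw [contDiffOn_zero]
    have h4 : ContinuousOn (fun x => κ x * √(1 + slopeOfSine (W x) ^ 2) ^ 3) V := by
      intro y hy
      have h5 : ContinuousAt κ y :=
        continuousAt_prescribedCurvature (hder y hy.1).continuousAt hy.2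
      have h6 : ContinuousAt (fun x => slopeOfSine (W x)) y := (hW' y hy.1 hy.2).continuousAt
      exact (h5.mul (((continuousAt_const.add (h6.pow 2)).sqrt).pow 3)).continuousWithinAt
    exact h4.congr fun y hy => (hW' y hy.1 hy.2).deriv
  have hu2 : ContDiffOn ℝ 2 u V := by
    rw [show (2 : WithTop ℕ∞) = 1 + 1 by norm_num, contDiffOn_succ_iff_deriv_of_isOpen hVo]
    refine ⟨fun y hy => (hder y hy.1).differentiableAt.differentiableWithinAt, by simp, ?_⟩
    exact hw1.congr fun y hy => (hder y hy.1).deriv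
  exact hu2.contDiffAt (hVo.mem_nhds ⟨hx, hn⟩)

end IsOptimalArc

end

section

variable {Φ : (ℝ × ℝ) ≃L[ℝ] Plane} {K : Set Plane} {c d c₁ d₁ : ℝ} {u f w : ℝ → ℝ}

/-! ### Graph representation of the boundary -/

theorem IsFrame.apply_eq (Φ : (ℝ × ℝ) ≃L[ℝ] Plane) (ℓ : Plane →L[ℝ] ℝ) (z : ℝ × ℝ) :
    ℓ (Φ z) = z.1 * ℓ (Φ (1, 0)) + z.2 * ℓ (Φ (0, 1)) := by
  have : z = z.1 • ((1, 0) : ℝ × ℝ) + z.2 • ((0, 1) : ℝ × ℝ) := by ext <;> simp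
  conv_lhs => rw [this]
  rw [map_add, map_smul, map_smul, map_add, map_smul, map_smul, smul_eq_mul, smul_eq_mul]

/-- The lower boundary of a convex body over an interval of the axis in its interior. -/
theorem exists_isLowerArc (hK : IsCompact K) (hc : Convex ℝ K) (hcd : c < d)
    (hint : ∀ x ∈ Icc c d, Φ (x, 0) ∈ interior K) :
    ∃ f, IsLowerArc Φ K c d (lowEnd Φ K) f := by
  set u := lowEnd Φ K with hu
  have hmem : ∀ x ∈ Icc c d, Φ (x, u x) ∈ K := fun x hx =>
    lowEnd_mem hK (interior_subset (hint x hx))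
  have hnot : ∀ x ∈ Icc c d, Φ (x, u x) ∉ interior K := by
    intro x hx hi
    have hcont : Tendsto (fun y : ℝ => Φ (x, y)) (𝓝 (u x)) (𝓝 (Φ (x, u x))) :=
      (Φ.continuous.comp (continuous_const.prodMk continuous_id)).tendsto (u x)
    have h1 : ∀ᶠ y in 𝓝[<] (u x), Φ (x, y) ∈ K :=
      (hcont.eventually (mem_interior_iff_mem_nhds.1 hi)).filter_mono nhdsWithin_le_nhds
    obtain ⟨y, hy, hlt⟩ := (h1.and (eventually_mem_nhdsWithin (a := u x) (s := Iio (u x)))).exists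
    exact not_lt.2 (lowEnd_le hK hy) hlt
  have hneg : ∀ x ∈ Icc c d, u x < 0 := by
    intro x hx
    refine lt_of_le_of_ne (lowEnd_le hK (interior_subset (hint x hx))) fun h => ?_
    have := hnot x hx
    rw [h] at this
    exact this (hint x hx)
  have hsupp : ∀ x, ∃ m, x ∈ Icc c d → ∀ z, Φ z ∈ K → u x + m * (z.1 - x) ≤ z.2 := by
    intro x
    by_cases hx : x ∈ Icc c d
    swap
    · exact ⟨0, fun h => absurd h hx⟩
    obtain ⟨ℓ, hℓ⟩ := geometric_hahn_banach_open_point hc.interior isOpen_interior (hnot x hx)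
    have hle : ∀ a ∈ K, ℓ a ≤ ℓ (Φ (x, u x)) := by
      have hcl : closure (interior K) = closure K :=
        hc.closure_interior_eq_closure_of_nonempty_interior ⟨_, hint x hx⟩
      have hsub : closure (interior K) ⊆ {a | ℓ a ≤ ℓ (Φ (x, u x))} :=
        closure_minimal (fun a ha => (hℓ a ha).le) (isClosed_le ℓ.continuous continuous_const)
      intro a ha
      exact hsub (hcl ▸ subset_closure ha)
    have h0 := hℓ _ (hint x hx)
    rw [IsFrame.apply_eq, IsFrame.apply_eq Φ ℓ (x, u x)] at h0
    set A := ℓ (Φ (1, 0))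
    set B := ℓ (Φ (0, 1))
    simp only at h0
    -- The axis point above is interior, so the functional is strictly smaller there; its kernel
    -- direction is therefore not vertical and -A/B is the slope of a supporting line.
    have hB : B < 0 := by nlinarith [hneg x hx]
    refine ⟨-A / B, fun _ z hz => ?_⟩
    have h1 := hle _ hz
    rw [IsFrame.apply_eq, IsFrame.apply_eq Φ ℓ (x, u x)] at h1
    change z.1 * A + z.2 * B ≤ x * A + u x * B at h1
    have h2 : -A / B * B = -A := div_mul_cancel₀ _ hB.ne
    by_contra! h3
    have h4 := mul_lt_mul_of_neg_right h3 hB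
    have h5 : (u x + -A / B * (z.1 - x)) * B = u x * B - A * (z.1 - x) := by
      linear_combination (z.1 - x) * h2
    linarith
  choose f hf using hsupp
  exact ⟨f, hcd, hmem, fun x hx => interior_subset (hint x hx), hneg, hf⟩

namespace IsLowerArc

/-- Below the axis, a point of `K` strictly above the graph is interior, since `u` is continuous;
the only frontier points left in the strip are those of the graph. -/
theorem image_eq_frontier_inter (h : IsLowerArc Φ K c d u f) (hK : IsCompact K)
    (hc : Convex ℝ K) (hc₁ : c ≤ c₁) (hd₁ : d₁ ≤ d) :
    (fun x => Φ (x, u x)) '' Ioo c₁ d₁ = frontier K ∩ strip Φ c₁ d₁ 0 := by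
  have hsub : Ioo c₁ d₁ ⊆ Icc c d := fun x hx => ⟨hc₁.trans hx.1.le, hx.2.le.trans hd₁⟩
  apply subset_antisymm
  · rintro _ ⟨x, hx, rfl⟩
    exact ⟨h.mem_frontier (hsub hx), mem_strip.2 ⟨hx, h.neg x (hsub hx)⟩⟩
  · rintro q ⟨hq, hqs⟩
    obtain ⟨⟨x, y⟩, rfl⟩ := Φ.surjective q
    rw [mem_strip] at hqs
    obtain ⟨hx, hy⟩ := hqs
    simp only at hx hy
    have hle := (h.mem_iff hc (hsub hx) hy.le).1 (hK.isClosed.frontier_subset hq)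
    rcases hle.eq_or_lt with he | hlt
    · exact ⟨x, hx, by simp only; rw [he]⟩
    exfalso
    apply hq.2
    have huc : ContinuousOn u (Ioo c₁ d₁) := h.isSubgradOn.continuousOn.mono hsub
    have hux : ContinuousAt u x := huc.continuousAt (Ioo_mem_nhds hx.1 hx.2)
    rw [mem_interior_iff_mem_nhds]
    have h1 : ∀ᶠ z : ℝ × ℝ in 𝓝 (x, y), Φ z ∈ K := by
      have e1 : ∀ᶠ z : ℝ × ℝ in 𝓝 (x, y), z.1 ∈ Ioo c₁ d₁ :=
        continuousAt_fst.eventually (Ioo_mem_nhds hx.1 hx.2)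
      have e2 : ∀ᶠ z : ℝ × ℝ in 𝓝 (x, y), z.2 < 0 :=
        continuousAt_snd.eventually (eventually_lt_nhds hy)
      have e3 : ∀ᶠ z : ℝ × ℝ in 𝓝 (x, y), u z.1 < z.2 := by
        have a1 : Tendsto (fun z : ℝ × ℝ => u z.1) (𝓝 (x, y)) (𝓝 (u x)) :=
          hux.tendsto.comp continuousAt_fst
        exact a1.eventually_lt continuousAt_snd hlt
      filter_upwards [e1, e2, e3] with z h1 h2 h3
      exact (h.mem_iff hc (hsub h1) h2.le).2 h3.le
    have h2 : Tendsto Φ.symm (𝓝 (Φ (x, y))) (𝓝 (x, y)) := by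
      have := Φ.symm.continuous.tendsto (Φ (x, y))
      rwa [Φ.symm_apply_apply] at this
    filter_upwards [h2.eventually h1] with q hq
    rwa [Φ.apply_symm_apply] at hq

/-- An arc that contains no segment has strictly monotone slopes. -/
theorem strictMonoOn (h : IsLowerArc Φ K c d u f) {Γ : Set Plane}
    (hΓ : ∀ x y : Plane, x ≠ y → ¬segment ℝ x y ⊆ Γ)
    (hsub : ∀ x ∈ Icc c d, Φ (x, u x) ∈ Γ) : StrictMonoOn f (Icc c d) := by
  intro x hx y hy hxy
  have hm := h.isSubgradOn.monotoneOn
  refine lt_of_le_of_ne (hm hx hy hxy.le) fun heq => ?_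
  refine hΓ (Φ (x, u x)) (Φ (y, u y)) ?_ ?_
  · intro he
    have := congrArg Prod.fst (Φ.injective he)
    exact hxy.ne this
  · rintro _ ⟨s, t, hs, ht, hst, rfl⟩
    have e : s • Φ (x, u x) + t • Φ (y, u y) = Φ (s * x + t * y, s * u x + t * u y) := by
      rw [← map_smul, ← map_smul, ← map_add]; rfl
    rw [e]
    set z := s * x + t * y with hz
    have hs' : s = 1 - t := by linarith
    have hxz : x ≤ z := by rw [hz, hs']; nlinarith
    have hzy : z ≤ y := by rw [hz, hs']; nlinarith
    have hzm : z ∈ Icc c d := ⟨hx.1.trans hxz, hzy.trans hy.2⟩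
    have hfz : f z = f x := le_antisymm ((hm hzm hy hzy).trans heq.ge) (hm hx hzm hxz)
    have a1 := h.isSubgradOn x hx y hy
    have a2 := h.isSubgradOn y hy x hx
    have a3 := h.isSubgradOn x hx z hzm
    have a4 := h.isSubgradOn z hzm x hx
    rw [← heq] at a2
    rw [hfz] at a4
    have hux : u y = u x + f x * (y - x) := by linarith
    have huz : u z = s * u x + t * u y := by
      have : z - x = t * (y - x) := by rw [hz, hs']; ring
      have b1 : u z = u x + f x * (z - x) := by linarith
      rw [b1, this, hux, hs']; ring
    rw [← huz]
    exact hsub z hzm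

/-- u minus its supporting line has a local minimum at x. -/
theorem slope_eq (h : IsLowerArc Φ K c d u f) {x m : ℝ} (hx : x ∈ Ioo c d)
    (hm : HasDerivAt u m x) : f x = m := by
  have hmin : IsLocalMin (fun y => u y - f x * (y - x)) x := by
    filter_upwards [Ioo_mem_nhds hx.1 hx.2] with y hy
    have := h.isSubgradOn x (Ioo_subset_Icc_self hx) y (Ioo_subset_Icc_self hy)
    simp only [sub_self, mul_zero, sub_zero]
    linarith
  have hd : HasDerivAt (fun y => u y - f x * (y - x)) (m - f x * 1) x :=
    hm.sub (((hasDerivAt_id x).sub_const x).const_mul (f x))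
  have := hmin.hasDerivAt_eq_zero hd
  linarith

theorem hasDerivAt_graph {x m : ℝ} (hm : HasDerivAt u m x) :
    HasDerivAt (fun y => Φ (y, u y)) (Φ (1, m)) x := by
  have h : HasDerivAt (fun y : ℝ => ((y, u y) : ℝ × ℝ)) (1, m) x := (hasDerivAt_id x).prodMk hm
  exact (Φ.hasFDerivAt (x := (x, u x))).comp_hasDerivAt x h

theorem isBoundaryParam (h : IsLowerArc Φ K c d u f) (hΦ : IsFrame Φ) (hK : IsCompact K)
    (hc : Convex ℝ K) (hc₁ : c ≤ c₁) (hd₁ : d₁ ≤ d) (hw : ∀ x ∈ Ioo c₁ d₁, HasDerivAt u (w x) x)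
    (hL : ∃ D : ℝ≥0, LipschitzOnWith D w (Ioo c₁ d₁)) :
    IsBoundaryParam K (fun x => Φ (x, u x)) c₁ d₁ := by
  have hder : ∀ x ∈ Ioo c₁ d₁, deriv (fun x => Φ (x, u x)) x = Φ (1, w x) := fun x hx =>
    (hasDerivAt_graph (hw x hx)).deriv
  refine ⟨⟨strip Φ c₁ d₁ 0, isOpen_strip Φ c₁ d₁ 0, h.image_eq_frontier_inter hK hc hc₁ hd₁⟩,
    ?_, ?_, ?_, ?_, ?_⟩
  · intro x _ y _ hxy
    exact congrArg Prod.fst (Φ.injective hxy)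
  · exact fun x hx => (hasDerivAt_graph (hw x hx)).differentiableAt
  · intro x hx
    rw [hder x hx, Ne, map_eq_zero_iff Φ Φ.injective]
    simp
  · obtain ⟨D, hD⟩ := hL
    refine ⟨D, LipschitzOnWith.of_dist_le_mul fun x hx y hy => ?_⟩
    rw [hder x hx, hder y hy]
    refine le_trans (le_of_eq ?_) (hD.dist_le_mul x hx y hy)
    have h1 := hΦ.dist_sq (1, w x) (1, w y)
    simp only [sub_self, ne_eq, OfNat.ofNat_ne_zero, not_false_eq_true, zero_pow, zero_add] at h1
    rw [← abs_of_nonneg (dist_nonneg (x := Φ (1, w x))), (sq_eq_sq_iff_abs_eq_abs _ _).1 h1,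
      Real.dist_eq]
  · intro x hx p hp
    obtain ⟨z, rfl⟩ := Φ.surjective p
    have hxO : x ∈ Ioo c d := ⟨hc₁.trans_lt hx.1, hx.2.trans_le hd₁⟩
    -- The cross product of (1, w) with z - (x, u x) is the height of z above the tangent line, so
    -- the orientation condition is the supporting line inequality.
    rw [hder x hx, ← map_sub, hΦ.cross]
    have := h.supp x (Ioo_subset_Icc_self hxO) z hp
    rw [h.slope_eq hxO (hw x hx)] at this
    simp only [Prod.fst_sub, Prod.snd_sub]
    linarith

end IsLowerArc

/-- The curvature of a graph. -/
theorem signedCurvature_graph (hΦ : IsFrame Φ) (hw : ∀ x ∈ Ioo c₁ d₁, HasDerivAt u (w x) x)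
    {x k : ℝ} (hx : x ∈ Ioo c₁ d₁) (hk : HasDerivAt w (k * √(1 + w x ^ 2) ^ 3) x) :
    signedCurvature (fun x => Φ (x, u x)) x = k := by
  have h1 : deriv (fun x => Φ (x, u x)) =ᶠ[𝓝 x] fun y => Φ (1, w y) := by
    filter_upwards [Ioo_mem_nhds hx.1 hx.2] with y hy
    exact (IsLowerArc.hasDerivAt_graph (hw y hy)).deriv
  have h2 : HasDerivAt (fun y => Φ (1, w y)) (Φ (0, k * √(1 + w x ^ 2) ^ 3)) x := by
    have h : HasDerivAt (fun y : ℝ => (((1 : ℝ), w y) : ℝ × ℝ)) (0, k * √(1 + w x ^ 2) ^ 3) x :=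
      (hasDerivAt_const x (1 : ℝ)).prodMk hk
    exact (Φ.hasFDerivAt (x := (1, w x))).comp_hasDerivAt x h
  have h3 : ‖Φ (1, w x)‖ = √(1 + w x ^ 2) := by
    rw [← Real.sqrt_sq (norm_nonneg (Φ (1, w x))), hΦ.norm_sq]
    simp
  rw [signedCurvature, h1.deriv_eq, h2.deriv, h1.eq_of_nhds, hΦ.cross, h3]
  have : √(1 + w x ^ 2) ≠ 0 := by positivity
  simp only
  field_simp
  ring

/-- Since cos and sin integrate to 0 over the circle and the two lengths add up to 2π, the integrals
over ∂B^IN can be rewritten as differences between OUT and IN. The term 1 - 1_{|γ|<1} splits as 1/2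
± 1/2; the first half completes the length term, and the second, times 8δ/λ₀, gives ±4δ/λ₀. -/
theorem prescribedCurvature_eq {Ω : Set Plane} (hK : IsCompact Ω) (x : ℝ) :
    prescribedCurvature Φ Ω u x = 1 - 3 * isoDeficit Ω
      + 4 * isoDeficit Ω / (2 * Real.pi * baryAsymmetry Ω)
        * (volume.real (circleOut Ω) - volume.real (circleIn Ω))
      + (1 - 2 * if ‖Φ (x, u x)‖ < 1 then 1 else 0) * (4 * isoDeficit Ω / baryAsymmetry Ω)
      + muHat₁ Ω * (Φ (x, u x)) 0 + muHat₂ Ω * (Φ (x, u x)) 1 := by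
  have hpi := Real.pi_pos.ne'
  rw [muHat₁, muHat₂, integral_circleOut hK Real.continuous_cos,
    integral_circleOut hK Real.continuous_sin, volume_circleOut hK, prescribedCurvature]
  have hin : inner ℝ (Φ (x, u x)) (circleMoment Ω) =
      (Φ (x, u x)) 0 * (∫ t in circleIn Ω, Real.cos t) +
      (Φ (x, u x)) 1 * ∫ t in circleIn Ω, Real.sin t := by
    simp [circleMoment, PiLp.inner_apply, Fin.sum_univ_two]
    ring
  rw [hin]
  simp only [integral_cos, integral_sin, Real.sin_two_pi, Real.cos_two_pi, Real.sin_zero,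
    Real.cos_zero, sub_self, zero_sub]
  by_cases hl : baryAsymmetry Ω = 0
  · simp [hl]
  field_simp
  ring

end

end

/-! ### The curvature equation at a boundary point -/

theorem theorem5p3 (Ω : Set Plane) (hΩ : IsOptimal Ω) (harea : area Ω = Real.pi)
    (hbary : barycentre Ω = 0) (Γ : Set Plane) (hΓ : IsStrictlyConvexPart Ω Γ)
    (p : Plane) (hp : p ∈ Γ) :
    ∃ (γ : ℝ → Plane) (a b : ℝ), IsBoundaryParam Ω γ a b ∧ γ '' Ioo a b ⊆ Γ ∧
      p ∈ γ '' Ioo a b ∧ volume {t ∈ Ioo a b | ‖γ t‖ = 1} = 0 ∧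
      ∀ t ∈ Ioo a b,
        (1 < ‖γ t‖ → ContDiffAt ℝ 2 γ t ∧
          signedCurvature γ t = 1 - 3 * isoDeficit Ω
            + 4 * isoDeficit Ω / (2 * Real.pi * baryAsymmetry Ω)
                * (volume.real (circleOut Ω) - volume.real (circleIn Ω))
            + 4 * isoDeficit Ω / baryAsymmetry Ω
            + muHat₁ Ω * γ t 0 + muHat₂ Ω * γ t 1) ∧
        (‖γ t‖ < 1 → ContDiffAt ℝ 2 γ t ∧
          signedCurvature γ t = 1 - 3 * isoDeficit Ω
            + 4 * isoDeficit Ω / (2 * Real.pi * baryAsymmetry Ω)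
                * (volume.real (circleOut Ω) - volume.real (circleIn Ω))
            - 4 * isoDeficit Ω / baryAsymmetry Ω
            + muHat₁ Ω * γ t 0 + muHat₂ Ω * γ t 1) := by
  have hK := hΩ.admissible.isCompact
  have hc := hΩ.admissible.convex
  have h0 := zero_mem_interior hK hc hΩ.admissible.area_pos hbary
  obtain ⟨U, hU, hΓU⟩ := hΓ.isOpen
  have hpf : p ∈ frontier Ω ∩ U := hΓU ▸ hp
  have hp0 : p ≠ 0 := fun h => hpf.1.2 (h ▸ h0)
  have hn : 0 < ‖p‖ := norm_pos_iff.2 hp0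
  -- With this second axis the point p lies at (0, -‖p‖), below the interior point 0, so ∂Ω near p
  -- is a lower arc.
  set e : Plane := -(‖p‖⁻¹ • p) with he
  have hen : ‖e‖ = 1 := by
    rw [he, norm_neg, norm_smul, norm_inv, norm_norm, inv_mul_cancel₀ hn.ne']
  set Φ := frameOf e hen
  have hΦ : IsFrame Φ := isFrame_frameOf e hen
  have hΦp : Φ (0, -‖p‖) = p := by
    have h1 : Φ (0, -‖p‖) = -‖p‖ • e := by
      rw [frameOf_apply]
      ext i; fin_cases i <;> simp
    rw [h1, he, smul_neg, neg_smul, neg_neg, smul_smul, mul_inv_cancel₀ hn.ne', one_smul]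
  set u := lowEnd Φ Ω with hu
  obtain ⟨r, hr, hball⟩ := Metric.isOpen_iff.1 isOpen_interior _ h0
  have hint : ∀ x ∈ Icc (-(r / 2)) (r / 2), Φ (x, 0) ∈ interior Ω := fun x hx => hball (by
    rw [Metric.mem_ball, dist_zero_right, hΦ.norm_axis]
    exact (abs_le.2 hx).trans_lt (by linarith))
  obtain ⟨f, hf⟩ := exists_isLowerArc hK hc (by linarith) hint
  have him := hf.image_eq_frontier_inter hK hc le_rfl le_rfl
  have hu0 : Φ (0, u 0) = p := by
    have h1 : p ∈ (fun x => Φ (x, u x)) '' Ioo (-(r / 2)) (r / 2) := by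
      rw [him]
      refine ⟨hpf.1, ?_⟩
      rw [← hΦp, mem_strip]
      exact ⟨⟨by simp only; linarith, by simp only; linarith⟩, by simp only; linarith⟩
    obtain ⟨x, -, hx⟩ := h1
    have hx0 : x = 0 := congrArg Prod.fst (Φ.injective (hx.trans hΦp.symm))
    rw [← hx0]; exact hx
  have hγc : ContinuousAt (fun x => Φ (x, u x)) 0 :=
    Φ.continuous.continuousAt.comp (continuousAt_id.prodMk
      (hf.isSubgradOn.continuousOn.continuousAt (Icc_mem_nhds (by linarith) (by linarith))))
  obtain ⟨ε, hε, hεU⟩ := Metric.eventually_nhds_iff.1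
    (hγc.eventually (hU.mem_nhds (show Φ (0, u 0) ∈ U by rw [hu0]; exact hpf.2)))
  -- The three bounds keep the arc inside Γ, the axis segment inside the interior of Ω, and the
  -- abscissae inside (-1, 1).
  set ρ := min (min (ε / 2) (r / 2)) (1 / 2) with hρ
  have hρ0 : 0 < ρ := lt_min (lt_min (by linarith) (by linarith)) (by norm_num)
  have hρε : ρ ≤ ε / 2 := (min_le_left _ _).trans (min_le_left _ _)
  have hρr : ρ ≤ r / 2 := (min_le_left _ _).trans (min_le_right _ _)
  have hρ1 : ρ ≤ 1 / 2 := min_le_right _ _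
  have harc := hf.mono (c' := -ρ) (d' := ρ) (by linarith) (by linarith) hρr
  have hsubΓ : ∀ x ∈ Icc (-ρ) ρ, Φ (x, u x) ∈ Γ := by
    intro x hx
    rw [hΓU]
    refine ⟨harc.mem_frontier hx, hεU ?_⟩
    rw [Real.dist_eq, sub_zero]
    exact (abs_le.2 hx).trans_lt (by linarith)
  have hmono := harc.strictMonoOn hΓ.no_segment hsubΓ
  have hopt : IsOptimalArc Φ Ω (-ρ) ρ u f := ⟨hΩ, harea, hbary, hΦ, harc⟩
  obtain ⟨w, hw, hL, hreg⟩ := hopt.exists_slope hmono (by linarith) (by linarith)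
    (c₁ := -(ρ / 2)) (d₁ := ρ / 2) (by linarith) (by linarith) (by linarith)
  have hsub : Ioo (-(ρ / 2)) (ρ / 2) ⊆ Ioo (-ρ) ρ :=
    Ioo_subset_Ioo (by linarith) (by linarith)
  have hcurv : ∀ t ∈ Ioo (-(ρ / 2)) (ρ / 2), ‖Φ (t, u t)‖ ≠ 1 →
      ContDiffAt ℝ 2 (fun x => Φ (x, u x)) t ∧
      signedCurvature (fun x => Φ (x, u x)) t = prescribedCurvature Φ Ω u t := by
    intro t ht hne
    obtain ⟨h1, h2⟩ := hreg t ht hne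
    exact ⟨Φ.contDiff.contDiffAt.comp t (contDiffAt_id.prodMk h1),
      signedCurvature_graph hΦ hw ht h2⟩
  refine ⟨fun x => Φ (x, u x), -(ρ / 2), ρ / 2,
    harc.isBoundaryParam hΦ hK hc (by linarith) (by linarith) hw hL, ?_,
    ⟨0, ⟨by linarith, by linarith⟩, hu0⟩, ?_, ?_⟩
  · rintro _ ⟨x, hx, rfl⟩
    exact hsubΓ x (Ioo_subset_Icc_self (hsub hx))
  · exact measure_mono_null
      (fun x hx => show x ∈ {x ∈ Ioo (-ρ) ρ | ‖Φ (x, u x)‖ = 1} from ⟨hsub hx.1, hx.2⟩)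
      (hopt.volume_norm_eq_one hmono (by linarith) (by linarith))
  · intro t ht
    constructor
    · intro hgt
      have h1 : 1 < ‖Φ (t, u t)‖ := hgt
      obtain ⟨h2, h3⟩ := hcurv t ht h1.ne'
      refine ⟨h2, ?_⟩
      rw [h3, prescribedCurvature_eq hK, if_neg (not_lt.2 h1.le)]
      ring
    · intro hlt
      have h1 : ‖Φ (t, u t)‖ < 1 := hlt
      obtain ⟨h2, h3⟩ := hcurv t ht h1.ne
      refine ⟨h2, ?_⟩
      rw [h3, prescribedCurvature_eq hK, if_pos h1]
      ring
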